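/- Let $M$ be a connected smooth $n$-dimensional manifold and let $(\mathcal D,g)$ be a sub-Riemannian structure on $M$ of corank $1$ and step $2$: $\mathcal D\subset TM$ is a smooth distribution of constant rank $k=n-1$, $g$ is a smooth scalar product on $\mathcal D$, and at every point the smooth sections of $\mathcal D$ together with their Lie brackets span the tangent space. If $\eta$ is a local one-form with $\mathcal D=\ker\eta$, let $J=J_\eta$ be the endomorphism of $\mathcal D$ with $g(X,JY)=d\eta(X,Y)$ for $X,Y\in\mathcal D$; its kernel $\ker J\subset\mathcal D$ does not depend on $\eta$. Let $\omega$ be a smooth volume form on $M$, and let $\Delta_\omega=\mathrm{div}_\omega\circ\mathrm{grad}$ be the macroscopic Laplacian, where $\mathrm{grad}$ is the horizontal gradient ($df(X)=g(\mathrm{grad} f,X)$ for $X\in\mathcal D$) and $\mathcal L_X\omega=\mathrm{div}_\omega(X)\,\omega$. A complement is a smooth sub-bundle $\mathcal V\subset TM$ with $T_qM=\mathcal D_q\oplus\mathcal V_q$ for all $q$. Let $H(\lambda)=\frac12\sum_{i=1}^k\langle\lambda,X_i\rangle^2$ (with $X_1,\dots,X_k$ an orthonormal frame of $\mathcal D$)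 be the Hamiltonian, let $\mathcal C_q=\{\lambda\in T_q^*M: 2H(\lambda)=1\}$, and let $\exp_q(t,\lambda)$ be the point at time $t$ of the normal geodesic with initial covector $\lambda$ (the projection of the integral curve of the Hamiltonian flow of $H$). Write $\mathcal C_q=\mathbb S_q\times\mathcal D_q^\perp$ where $\mathbb S_q$ is the unit sphere of the space $\mathcal V_q^\perp$ of covectors vanishing on $\mathcal V_q$. An adapted measure is a family $\mu_q$ of products of the uniform probability measure on $\mathbb S_q$ and of a probability measure on $\mathcal D_q^\perp$ for which linear functions are square integrable, such that $q\mapsto\int_{\mathcal C_q} f^2\,d\mu_q$ is continuous for every continuous fiberwise linear $f:T^*M\to\mathbb R$. For each complement choose an adapted measure $\mu=\{\mu_q\}$. The microscopic Laplacian is $$(L^{\mathcal V}\phi)(q)=\lim_{t\to0^+}\frac{2k}{t^2}\int_{\mathcal C_q}\bigl(\phi(\exp_q(t,\lambda))-\phi(q)\bigr)\,d\mu_q(\lambda).$$ Call $\mathcal V$ compatible if $L^{\mathcal V}\phi=\Delta_\omega\phi$ for all $\phi\in C^\infty_0(M)$ (the limit existing at every point). Then, for every choice of adapted measures: 1. If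 $\dim\ker J_q=0$ for all $q$, there is exactly one compatible complement $\mathcal V$. 2. If $\dim\ker J_q>0$ for all $q$ (for instance, if $\dim\ker J$ is constant and equal to some $p>0$, as in the quasi-contact case), the set of compatible complements is either empty or an affine space over $\ker J$. Precisely: if $\mathcal D=\ker\eta$ for a global smooth one-form $\eta$, the set is either empty or an affine space over the vector space of smooth sections $\xi$ of $\ker J$, where $\xi$ sends $\mathcal V=\mathrm{span}\{X_0\}$, with $\eta(X_0)=1$, to $\mathrm{span}\{X_0+\xi\}$. Without assuming that such a global $\eta$ exists, the set is either empty or an affine space over the vector space of smooth sections $B$ of $\mathrm{Hom}(TM/\mathcal D,\ker J)$ (a bundle which $\eta$, when it exists, identifies with $\ker J$), where $B$ sends $\mathcal V$ to $\{v+Bv: v\in\mathcal V\}$. -/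

import Mathlib

open Set Filter Topology Manifold MeasureTheory Bundle
open scoped ContDiff

noncomputable section

namespace SubRiem

/-- The model space of an `n`-dimensional manifold. -/
abbrev Eucl (n : ℕ) : Type := EuclideanSpace ℝ (Fin n)

/-- The tangent space of an `n`-dimensional manifold. -/
abbrev TSpace (n : ℕ) {M : Type*} [TopologicalSpace M] [ChartedSpace (Eucl n) M] (q : M) : Type :=
  TangentSpace (𝓡 n) q

/-- The cotangent space. -/
abbrev CSpace (n : ℕ) {M : Type*} [TopologicalSpace M] [ChartedSpace (Eucl n) M] (q : M) : Type :=
  TSpace n q →L[ℝ] ℝ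

section

variable {n k : ℕ} {M : Type*} [TopologicalSpace M] [ChartedSpace (Eucl n) M]

instance instFiniteDimensionalTSpace (q : M) : FiniteDimensional ℝ (TSpace n q) :=
  inferInstanceAs (FiniteDimensional ℝ (Eucl n))

instance instT2SpaceTSpace (q : M) : T2Space (TSpace n q) :=
  inferInstanceAs (T2Space (Eucl n))

/-- Covectors carry the Borel sigma-algebra. -/
instance instMeasurableSpaceCSpace (q : M) : MeasurableSpace (CSpace n q) := borel _

/-! ### Vector fields, one-forms, distributions -/

/-- The (possibly only locally meaningful) vector field `X` is smooth on the set `U`. -/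
def SmoothFieldOn [IsManifold (𝓡 n) ∞ M] (X : ∀ q : M, TSpace n q) (U : Set M) : Prop :=
  ContMDiffOn (𝓡 n) ((𝓡 n).prod 𝓘(ℝ, Eucl n)) ∞
    (fun q => TotalSpace.mk' (Eucl n) (E := fun q : M => TangentSpace (𝓡 n) q) q (X q)) U

/-- The one-form `η` is smooth on the set `U`. -/
def SmoothFormOn [IsManifold (𝓡 n) ∞ M] (η : ∀ q : M, CSpace n q) (U : Set M) : Prop :=
  ContMDiffOn (𝓡 n) ((𝓡 n).prod 𝓘(ℝ, Eucl n →L[ℝ] ℝ)) ∞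
    (fun q => TotalSpace.mk' (Eucl n →L[ℝ] ℝ)
      (E := fun q : M => TangentSpace (𝓡 n) q →L[ℝ] ℝ) q (η q)) U

/-- The differential of a function. -/
def dFun (f : M → ℝ) (q : M) : CSpace n q := mfderiv (𝓡 n) 𝓘(ℝ, ℝ) f q

/-- A family of subspaces of the tangent spaces is a smooth sub-bundle of `TM` if it is locally
spanned by pointwise linearly independent smooth vector fields. -/
def IsSmoothSubbundle [IsManifold (𝓡 n) ∞ M] (F : ∀ q : M, Submodule ℝ (TSpace n q)) : Prop :=
  ∀ q : M, ∃ U : Set M, IsOpen U ∧ q ∈ U ∧ ∃ (r : ℕ) (X : Fin r → ∀ x : M, TSpace n x),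
    (∀ i, SmoothFieldOn (X i) U) ∧
    ∀ x ∈ U, LinearIndependent ℝ (fun i => X i x) ∧ Submodule.span ℝ (range fun i => X i x) = F x

variable (n k M) in
/-- A smooth distribution `D` of constant rank `k` with a smooth scalar product `g` on it. The
bracket-generating condition is stated separately. -/
structure Structure [IsManifold (𝓡 n) ∞ M] where
  /-- the distribution -/
  D : ∀ q : M, Submodule ℝ (TSpace n q)
  smooth_D : IsSmoothSubbundle D
  finrank_D : ∀ q, Module.finrank ℝ (D q) = k
  /-- the scalar product on the distribution -/
  g : ∀ q : M, D q →ₗ[ℝ] D q →ₗ[ℝ] ℝ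
  symm : ∀ q (v w : D q), g q v w = g q w v
  pos : ∀ q (v : D q), v ≠ 0 → 0 < g q v v
  /-- `g(X, Y)` is smooth for all (local) smooth horizontal fields `X`, `Y` -/
  smooth_g : ∀ U : Set M, IsOpen U → ∀ X Y : ∀ q : M, D q,
    SmoothFieldOn (fun q => (X q : TSpace n q)) U →
    SmoothFieldOn (fun q => (Y q : TSpace n q)) U →
    ContMDiffOn (𝓡 n) 𝓘(ℝ, ℝ) ∞ (fun q => g q (X q) (Y q)) U

variable [IsManifold (𝓡 n) ∞ M]

namespace Structure

variable (S : Structure n k M)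

/-- Step `2`: the values at each point of the smooth horizontal fields and of their Lie brackets
span the tangent space. -/
def StepTwo : Prop :=
  ∀ q : M, S.D q ⊔ Submodule.span ℝ
    {v : TSpace n q | ∃ X Y : ∀ x : M, TSpace n x,
      SmoothFieldOn X univ ∧ SmoothFieldOn Y univ ∧ (∀ x, X x ∈ S.D x) ∧ (∀ x, Y x ∈ S.D x) ∧
      v = VectorField.mlieBracket (𝓡 n) X Y q} = ⊤

theorem exists_orthonormalBasis (q : M) :
    ∃ b : Module.Basis (Fin k) ℝ (S.D q), ∀ i j, S.g q (b i) (b j) = if i = j then 1 else 0 := by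
  let cd : InnerProductSpace.Core ℝ (S.D q) :=
    { inner := fun v w => S.g q v w
      conj_inner_symm := fun v w => by simpa using S.symm q w v
      re_inner_nonneg := fun v => by
        by_cases hv : v = 0
        · simp [hv]
        · simpa using (S.pos q v hv).le
      add_left := fun u v w => by simp
      smul_left := fun u v r => by simp
      definite := fun v hv => by
        by_contra h
        exact absurd hv (S.pos q v h).ne' }
  let : NormedAddCommGroup (S.D q) := cd.toNormedAddCommGroup
  let : InnerProductSpace ℝ (S.D q) := InnerProductSpace.ofCore cd.toCore
  have hk : Module.finrank ℝ (S.D q) = k := S.finrank_D q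
  let b := (stdOrthonormalBasis ℝ (S.D q)).reindex (finCongr hk)
  refine ⟨b.toBasis, fun i j => ?_⟩
  have h := orthonormal_iff_ite.mp b.orthonormal i j
  rw [b.coe_toBasis]
  exact h

/-- An orthonormal basis of `D_q`. -/
def onb (q : M) : Module.Basis (Fin k) ℝ (S.D q) := (S.exists_orthonormalBasis q).choose

theorem onb_spec (q : M) (i j : Fin k) :
    S.g q (S.onb q i) (S.onb q j) = if i = j then 1 else 0 :=
  (S.exists_orthonormalBasis q).choose_spec i j

/-- The horizontal vector `α♯ ∈ D_q` dual to a covector `α`. -/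
def sharp (q : M) : CSpace n q →ₗ[ℝ] S.D q where
  toFun α := ∑ i, α (S.onb q i : TSpace n q) • S.onb q i
  map_add' α β := by simp [add_smul, Finset.sum_add_distrib]
  map_smul' c α := by simp [mul_smul, Finset.smul_sum]

/-- `α♯` satisfies `g(α♯, v) = α(v)` for all horizontal `v`. -/
theorem sharp_spec (q : M) (α : CSpace n q) (v : S.D q) :
    S.g q (S.sharp q α) v = α (v : TSpace n q) := by
  have h : S.g q (S.sharp q α) = (α : TSpace n q →ₗ[ℝ] ℝ) ∘ₗ (S.D q).subtype := by
    refine (S.onb q).ext fun j => ?_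
    simp [sharp, S.onb_spec]
  rw [h]
  rfl

/-- `α♯` is the only horizontal vector with this property. -/
theorem eq_sharp (q : M) (α : CSpace n q) (u : S.D q)
    (h : ∀ v : S.D q, S.g q u v = α (v : TSpace n q)) : u = S.sharp q α := by
  by_contra hne
  have hpos := S.pos q (u - S.sharp q α) (sub_ne_zero.mpr hne)
  have : S.g q (u - S.sharp q α) (u - S.sharp q α) = 0 := by
    rw [map_sub (S.g q), LinearMap.sub_apply, h, S.sharp_spec, sub_self]
  exact hpos.ne' this

/-- The horizontal gradient: `df(X) = g(grad f, X)` for all horizontal `X`. -/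
def grad (f : M → ℝ) (q : M) : TSpace n q :=
  (S.sharp q (dFun f q) : TSpace n q)

end Structure

/-! ### The kernel of `J` -/

/-- The differential at `q` of the preferred chart at `c`. -/
def dChart (c q : M) : TSpace n q →L[ℝ] Eucl n :=
  (trivializationAt (Eucl n) (fun x : M => TangentSpace (𝓡 n) x) c).continuousLinearMapAt ℝ q

/-- The inverse of the differential at `q` of the preferred chart at `c`. -/
def dChartInv (c q : M) : Eucl n →L[ℝ] TSpace n q :=
  (trivializationAt (Eucl n) (fun x : M => TangentSpace (𝓡 n) x) c).symmL ℝ q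

/-- The exterior derivative of a one-form at `q`, computed in the chart at `q`:
`dη(v, w) = ∂_v η(w) - ∂_w η(v)`. -/
def extDer (η : ∀ q : M, CSpace n q) (q : M) : TSpace n q →ₗ[ℝ] TSpace n q →ₗ[ℝ] ℝ :=
  let A : Eucl n →L[ℝ] Eucl n →L[ℝ] ℝ :=
    fderiv ℝ (fun x : Eucl n =>
      (η ((extChartAt (𝓡 n) q).symm x)).comp (dChartInv q ((extChartAt (𝓡 n) q).symm x)))
      (extChartAt (𝓡 n) q q)
  LinearMap.mk₂ ℝ
    (fun v w => A (dChart q q v) (dChart q q w) - A (dChart q q w) (dChart q q v))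
    (fun v v' w => by simp only [map_add, add_apply]; ring)
    (fun c v w => by simp only [map_smul, smul_apply, smul_eq_mul]; ring)
    (fun v w w' => by simp only [map_add, add_apply]; ring)
    (fun c v w => by simp only [map_smul, smul_apply, smul_eq_mul]; ring)

namespace Structure

variable (S : Structure n k M)

/-- `η` is a smooth one-form on some neighbourhood of `q`, on which `D = ker η`. -/
def IsLocalDefiningForm (η : ∀ q : M, CSpace n q) (q : M) : Prop :=
  ∃ U : Set M, IsOpen U ∧ q ∈ U ∧ SmoothFormOn η U ∧
    ∀ x ∈ U, LinearMap.ker (η x : TSpace n x →ₗ[ℝ] ℝ) = S.D x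

/-- `η` is a global smooth one-form with `D = ker η`. -/
def IsDefiningForm (η : ∀ q : M, CSpace n q) : Prop :=
  SmoothFormOn η univ ∧ ∀ x, LinearMap.ker (η x : TSpace n x →ₗ[ℝ] ℝ) = S.D x

/-- The endomorphism `J_η` of `D_q`, defined by `g(X, J_η Y) = dη(X, Y)`. -/
def J (η : ∀ q : M, CSpace n q) (q : M) : S.D q →ₗ[ℝ] S.D q :=
  S.sharp q ∘ₗ (LinearMap.toContinuousLinearMap : (TSpace n q →ₗ[ℝ] ℝ) ≃ₗ[ℝ] CSpace n q) ∘ₗ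
    (extDer η q).flip ∘ₗ (S.D q).subtype

theorem J_spec (η : ∀ q : M, CSpace n q) (q : M) (X Y : S.D q) :
    S.g q X (S.J η q Y) = extDer η q X Y := by
  rw [S.symm]
  exact S.sharp_spec q _ X

/-- The kernel of `J` at `q`, as a subspace of `T_q M`. Two local defining one-forms differ by a
nowhere zero factor, and so do the corresponding endomorphisms of `D`, so that all of them have the
same kernel. -/
def kerJ (q : M) : Submodule ℝ (TSpace n q) :=
  (⨅ (η : ∀ x : M, CSpace n x) (_ : S.IsLocalDefiningForm η q), LinearMap.ker (S.J η q)).map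
    (S.D q).subtype

end Structure

/-! ### The macroscopic Laplacian -/

variable (n M) in
/-- A volume form: a smooth nowhere vanishing `n`-form. -/
structure VolumeForm where
  toFun : ∀ q : M, TSpace n q [⋀^Fin n]→ₗ[ℝ] ℝ
  smooth : ∀ U : Set M, IsOpen U → ∀ Y : Fin n → ∀ q : M, TSpace n q,
    (∀ i, SmoothFieldOn (Y i) U) →
    ContMDiffOn (𝓡 n) 𝓘(ℝ, ℝ) ∞ (fun q => toFun q (fun i => Y i q)) U
  ne_zero : ∀ q, toFun q ≠ 0

namespace VolumeForm

/-- The value at `q` of `(L_X Ω)(Y_1, …, Y_n)`, that is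
`X(Ω(Y_1, …, Y_n)) - ∑ Ω(Y_1, …, [X, Y_i], …, Y_n)`. -/
def lieDerivative (Ω : VolumeForm n M) (X : ∀ q : M, TSpace n q)
    (Y : Fin n → ∀ q : M, TSpace n q) (q : M) : ℝ :=
  dFun (fun x => Ω.toFun x (fun i => Y i x)) q (X q) -
    ∑ i, Ω.toFun q
      (Function.update (fun j => Y j q) i (VectorField.mlieBracket (𝓡 n) X (Y i) q))

/-- The divergence of a smooth vector field: the number `c` with `(L_X Ω)_q = c Ω_q`. -/
def divergence (Ω : VolumeForm n M) (X : ∀ q : M, TSpace n q) (q : M) : ℝ :=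
  Classical.epsilon fun c : ℝ => ∀ Y : Fin n → ∀ x : M, TSpace n x,
    (∀ i, SmoothFieldOn (Y i) univ) → Ω.lieDerivative X Y q = c * Ω.toFun q (fun i => Y i q)

end VolumeForm

/-- The macroscopic Laplacian `Δ_Ω = div_Ω ∘ grad`. -/
def Structure.macroLaplacian (S : Structure n k M) (Ω : VolumeForm n M) (f : M → ℝ) : M → ℝ :=
  Ω.divergence (S.grad f)

/-! ### Normal geodesics -/

variable (n M) in
/-- The cotangent bundle. -/
abbrev Cotangent : Type _ :=
  TotalSpace (Eucl n →L[ℝ] ℝ) (fun q : M => TangentSpace (𝓡 n) q →L[ℝ] ℝ)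

namespace Structure

variable (S : Structure n k M)

/-- The Hamiltonian `H(λ) = ½ ∑ ⟨λ, X_i⟩²`, where `X_1, …, X_k` is an orthonormal basis of `D_q`. -/
def hamiltonian (q : M) (α : CSpace n q) : ℝ :=
  (1 / 2) * ∑ i, (α (S.onb q i : TSpace n q)) ^ 2

/-- The Hamiltonian in the canonical coordinates `(x, p)` of the cotangent bundle given by the
preferred chart at `c`. -/
def localHamiltonian (c : M) (x : Eucl n) (p : Eucl n →L[ℝ] ℝ) : ℝ :=
  S.hamiltonian ((extChartAt (𝓡 n) c).symm x) (p.comp (dChart c ((extChartAt (𝓡 n) c).symm x)))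

/-- The position coordinates of a point of the cotangent bundle in the preferred chart at `c`. -/
def position (c : M) (z : Cotangent n M) : Eucl n := extChartAt (𝓡 n) c z.proj

/-- The momentum coordinates of a point of the cotangent bundle in the preferred chart at `c`. -/
def momentum (c : M) (z : Cotangent n M) : Eucl n →L[ℝ] ℝ :=
  (z.snd : TSpace n z.proj →L[ℝ] ℝ).comp (dChartInv c z.proj)

/-- `z` is an integral curve of the Hamiltonian vector field on `[0, T]`: in canonical coordinates
around each of its points, Hamilton's equations `ẋ = ∂H/∂p`, `ṗ = -∂H/∂x` hold. -/
def IsHamiltonianCurve (z : ℝ → Cotangent n M) (T : ℝ) : Prop :=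
  ContinuousOn (fun t => (z t).proj) (Icc 0 T) ∧
  ∀ s ∈ Icc 0 T, ∃ v : Eucl n,
    HasDerivWithinAt (fun t => position (z s).proj (z t)) v (Icc 0 T) s ∧
    (∀ β : Eucl n →L[ℝ] ℝ,
      fderiv ℝ (fun p => S.localHamiltonian (z s).proj (position (z s).proj (z s)) p)
        (momentum (z s).proj (z s)) β = β v) ∧
    HasDerivWithinAt (fun t => momentum (z s).proj (z t))
      (-(fderiv ℝ (fun x => S.localHamiltonian (z s).proj x (momentum (z s).proj (z s)))
        (position (z s).proj (z s)))) (Icc 0 T) s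

open Classical in
/-- The exponential map `exp_q(t, λ)`: the point at time `t` of the normal geodesic with initial
covector `λ` (and, by convention, `q` if that geodesic is not defined up to time `t`). -/
def expMap (q : M) (t : ℝ) (α : CSpace n q) : M :=
  if h : ∃ z : ℝ → Cotangent n M, z 0 = ⟨q, α⟩ ∧ S.IsHamiltonianCurve z t then
    (h.choose t).proj
  else q

/-! ### The microscopic Laplacian -/

/-- A complement: a smooth sub-bundle `V` of `TM` with `T_q M = D_q ⊕ V_q` for all `q`. -/
@[ext] structure Complement where
  fiber : ∀ q : M, Submodule ℝ (TSpace n q)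
  smooth : IsSmoothSubbundle fiber
  isCompl : ∀ q, IsCompl (S.D q) (fiber q)

end Structure

/-- The uniform probability measure on the unit sphere of `ℝ^k`. -/
def uniformSphere (k : ℕ) : Measure (Metric.sphere (0 : Eucl k) 1) :=
  ((volume : Measure (Eucl k)).toSphere univ)⁻¹ • (volume : Measure (Eucl k)).toSphere

namespace Structure.Complement

variable {S : Structure n k M} (V : S.Complement)

/-- The projection of `T_q M` onto `D_q` along `V_q`. -/
def proj (q : M) : TSpace n q →ₗ[ℝ] S.D q :=
  Submodule.projectionOnto (S.D q) (V.fiber q) (V.isCompl q)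

/-- The isometry `D_q → h_q` onto the covectors that vanish on `V_q`, written in an orthonormal
basis of `D_q`: it sends `y` to the covector `w ↦ g(∑ y_i X_i, π_D w)`. -/
def horizontalCovector (q : M) (y : Eucl k) : CSpace n q :=
  LinearMap.toContinuousLinearMap (S.g q (∑ i, y i • S.onb q i) ∘ₗ V.proj q)

/-- The uniform probability measure on the sphere of horizontal covectors `λ ∈ h_q` with
`2H(λ) = 1`. -/
def sphereMeasure (q : M) : Measure (CSpace n q) :=
  (uniformSphere k).map
    fun y : Metric.sphere (0 : Eucl k) 1 => V.horizontalCovector q (y : Eucl k)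

/-- The image, under the splitting of the cylinder into horizontal unit covectors and vertical
covectors, of the product of the uniform measure and of a measure `ν` on the vertical covectors. -/
def cylinderMeasure (q : M) (ν : Measure (CSpace n q)) : Measure (CSpace n q) :=
  ((V.sphereMeasure q).prod ν).map fun p => p.1 + p.2

/-- A collection of probability measures adapted to the splitting `TM = D ⊕ V`, given by its
vertical factors: `2`-decreasing probability measures on the spaces of covectors that vanish on
`D_q`. In the regularity condition, continuous fiberwise linear functions on the cotangent bundle
are written as `λ ↦ λ(Y)` with a continuous vector field `Y`. -/
structure AdaptedMeasure where
  vert : ∀ q : M, Measure (CSpace n q)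
  isProbability : ∀ q, IsProbabilityMeasure (vert q)
  vertical : ∀ q, ∀ᵐ α ∂(vert q), ∀ v ∈ S.D q, α v = 0
  twoDecreasing : ∀ q (w : TSpace n q), MemLp (fun α : CSpace n q => α w) 2 (vert q)
  regular : ∀ Y : ∀ q : M, TSpace n q,
    Continuous (fun q =>
      TotalSpace.mk' (Eucl n) (E := fun q : M => TangentSpace (𝓡 n) q) q (Y q)) →
    Continuous fun q => ∫ α, (α (Y q)) ^ 2 ∂(V.cylinderMeasure q (vert q))

variable {V}

/-- The quotient whose limit as `t → 0+` is the microscopic Laplacian. -/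
def AdaptedMeasure.quotient (μ : V.AdaptedMeasure) (φ : M → ℝ) (q : M) (t : ℝ) : ℝ :=
  2 * k / t ^ 2 *
    ∫ α, (φ (S.expMap q t α) - φ q) ∂(V.cylinderMeasure q (μ.vert q))

/-- `L^V φ = Δ_Ω φ` on `M` for all `φ ∈ C^∞_0(M)`, where `L^V` is the microscopic Laplacian computed
with the adapted measures `μ`: the limits that define it exist and are the values of `Δ_Ω φ`. -/
def AdaptedMeasure.Compatible (μ : V.AdaptedMeasure) (Ω : VolumeForm n M) : Prop :=
  ∀ φ : M → ℝ, ContMDiff (𝓡 n) 𝓘(ℝ, ℝ) ∞ φ → HasCompactSupport φ →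
    ∀ q : M, Tendsto (μ.quotient φ q) (𝓝[>] 0) (𝓝 (S.macroLaplacian Ω φ q))

end Structure.Complement

namespace Structure

variable (S : Structure n k M)

/-- The smooth sections of `ker J`. -/
def kerJSections :
    Submodule ℝ (ContMDiffSection (𝓡 n) (Eucl n) ∞ (fun q : M => TangentSpace (𝓡 n) q)) where
  carrier := {ξ | ∀ q, ξ q ∈ S.kerJ q}
  add_mem' ha hb q := (S.kerJ q).add_mem (ha q) (hb q)
  zero_mem' q := (S.kerJ q).zero_mem
  smul_mem' c _ ha q := (S.kerJ q).smul_mem c (ha q)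

/-- The smooth sections of `Hom(TM / D, ker J)`, as endomorphisms of `TM` that vanish on `D` and
take values in `ker J`. A global one-form `η` with `D = ker η` trivializes `TM / D` and identifies
them with the sections `ξ` of `ker J`, through `v ↦ η(v) ξ`. -/
def kerJHoms :
    Submodule ℝ (ContMDiffSection (𝓡 n) (Eucl n →L[ℝ] Eucl n) ∞
      (fun q : M => TangentSpace (𝓡 n) q →L[ℝ] TangentSpace (𝓡 n) q)) where
  carrier := {B | ∀ q, (∀ v ∈ S.D q, B q v = 0) ∧ ∀ v, B q v ∈ S.kerJ q}
  add_mem' ha hb q := ⟨fun v hv => by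
      simp only [ContMDiffSection.coe_add, Pi.add_apply, add_apply,
        (ha q).1 v hv, (hb q).1 v hv, add_zero],
    fun v => (S.kerJ q).add_mem ((ha q).2 v) ((hb q).2 v)⟩
  zero_mem' q := ⟨fun v _ => rfl, fun v => (S.kerJ q).zero_mem⟩
  smul_mem' c B hB q := ⟨fun v hv => by
      simp only [ContMDiffSection.coe_smul, Pi.smul_apply, smul_apply,
        (hB q).1 v hv, smul_zero],
    fun v => (S.kerJ q).smul_mem c ((hB q).2 v)⟩

/-- The set of the complements `V` with `L^V = Δ_Ω`, for a choice `μ` of adapted measures. -/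
def compatible (Ω : VolumeForm n M) (μ : ∀ V : S.Complement, V.AdaptedMeasure) :
    Set S.Complement :=
  {V | (μ V).Compatible Ω}

end Structure

end

end SubRiem

end

open SubRiem Manifold
open scoped ContDiff

/-! Let X_1, …, X_k be an orthonormal frame of D near q and u_i = ⟨λ, X_i⟩. Hamilton's equations
give q' = ∑ u_i X_i and u_i' = ∑_j u_j ⟨λ, [X_j, X_i]⟩, so the second-order expansion of φ(exp_q(t,
λ)) at t = 0 is explicit: its first-order term is ∑ u_i X_iφ, and its second derivative is a
combination of the products u_i u_j and u_j ⟨λ, [X_j, X_i]⟩. Under an adapted measure the u_i have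
mean zero and covariance δ_ij / k. In u_j ⟨λ, w⟩ the vertical part of λ is independent of u_j and
drops out, leaving g(X_j, π w) / k with π the projection on D along V. Hence, whatever the vertical
factor of the measure, L^V φ = ∑ X_i²φ + ∑_i (∑_j g(X_j, π[X_j, X_i])) X_iφ (`tendsto_quotient`). On
the other side Δ_Ω φ = ∑ X_i²φ + ∑_i div(X_i) X_iφ (`macroLaplacian_eq`). Testing with functions of
prescribed differential at q, compatibility becomes the pointwise equations `SolvesAt`: div X_i =
∑_j g(X_j, π[X_j, X_i]) for all i (`compatible_iff`).

The analytic difficulty is that the cylinder 2H = 1 is not compact when k < n. The speeds u_i stay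
on the unit sphere along the flow, and the momentum equation is linear in the momentum once the
speeds are bounded; hence all geodesics from the cylinder exist up to a common time, with momenta at
most a multiple of the initial ones (`exists_hamilton_flow`). The Taylor remainder is then at most
C(1 + ‖λ‖)t², which is integrable, and dominated convergence applies.

The equations are affine in π. In corank one, two projections on D differ by θ ⊗ δ with ker θ = D
and δ ∈ D, and the homogeneous equations for δ say exactly Jδ = 0, because dη(X_i, X_j) = -η([X_i,
X_j]) (`iff_sub_mem_kerJ`). If ker J = 0, Cramer's rule solves the k × k system with smooth
coefficients, and pointwise uniqueness glues the local solutions (`existsUnique_mem_compatible`). In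
general, shearing V by id + B with B in Hom(TM/D, ker J) acts freely and transitively on the
solutions, if there are any; a global η turns B into a section of ker J. -/

noncomputable section

namespace SubRiem

/-! ### Vector fields, brackets and differentials in charts -/

section Coordinates

variable {n : ℕ} {M : Type*} [TopologicalSpace M] [ChartedSpace (Eucl n) M]

theorem isOpen_chart_inter (c : M) {U : Set M} (hU : IsOpen U) :
    IsOpen ((extChartAt (𝓡 n) c).target ∩ (extChartAt (𝓡 n) c).symm ⁻¹' U) :=
  (continuousOn_extChartAt_symm c).isOpen_inter_preimage (isOpen_extChartAt_target c) hU

variable [IsManifold (𝓡 n) ∞ M]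

theorem dChart_eq_mfderiv {c p : M} (hp : p ∈ (extChartAt (𝓡 n) c).source) :
    dChart c p = mfderiv (𝓡 n) 𝓘(ℝ, Eucl n) (extChartAt (𝓡 n) c) p :=
  TangentBundle.continuousLinearMapAt_trivializationAt (by simpa using hp)

theorem dChartInv_eq_mfderiv {c p : M} (hp : p ∈ (extChartAt (𝓡 n) c).source) :
    dChartInv c p = mfderiv 𝓘(ℝ, Eucl n) (𝓡 n) (extChartAt (𝓡 n) c).symm
      (extChartAt (𝓡 n) c p) := by
  have := TangentBundle.symmL_trivializationAt (I := 𝓡 n) (x₀ := c) (x := p) (by simpa using hp)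
  rw [dChartInv, this]
  have : range (𝓡 n) = univ := by simp
  rw [this, mfderivWithin_univ]

theorem dChart_dChartInv {c p : M} (hp : p ∈ (extChartAt (𝓡 n) c).source) (v : Eucl n) :
    dChart c p (dChartInv c p v) = v := by
  have hp' : p ∈ (trivializationAt (Eucl n) (fun x : M => TangentSpace (𝓡 n) x) c).baseSet := by
    simpa using hp
  exact Trivialization.continuousLinearMapAt_symmL _ hp' v

theorem dChartInv_dChart {c p : M} (hp : p ∈ (extChartAt (𝓡 n) c).source) (v : TSpace n p) :
    dChartInv c p (dChart c p v) = v := by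
  have hp' : p ∈ (trivializationAt (Eucl n) (fun x : M => TangentSpace (𝓡 n) x) c).baseSet := by
    simpa using hp
  exact Trivialization.symmL_continuousLinearMapAt _ hp' v

/-- In the chart at `q` a tangent vector at `q` is literally its own coordinate vector. Formulas at
`q` below use this to identify `TSpace n q` with `Eucl n` without any transport. -/
theorem dChart_self (q : M) (v : TSpace n q) : dChart q q v = v := by
  rw [dChart_eq_mfderiv (mem_extChartAt_source q), mfderiv_extChartAt_self]
  rfl

theorem dChartInv_self (q : M) (v : Eucl n) : dChartInv q q v = v := by
  conv_rhs => rw [← dChart_dChartInv (mem_extChartAt_source (I := 𝓡 n) q) v]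
  exact (dChart_self q _).symm

/-- The differential of the chart at `c`, as an isomorphism. -/
def dChartEquiv {c p : M} (hp : p ∈ (extChartAt (𝓡 n) c).source) : TSpace n p ≃L[ℝ] Eucl n :=
  ContinuousLinearEquiv.equivOfInverse (dChart c p) (dChartInv c p) (dChartInv_dChart hp)
    (dChart_dChartInv hp)

/-- A vector field in the coordinates of the preferred chart at `c`. -/
def fieldRep (c : M) (X : ∀ q : M, TSpace n q) (x : Eucl n) : Eucl n :=
  dChart c ((extChartAt (𝓡 n) c).symm x) (X ((extChartAt (𝓡 n) c).symm x))

theorem fieldRep_self (q : M) (X : ∀ q : M, TSpace n q) :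
    fieldRep q X (extChartAt (𝓡 n) q q) = X q := by
  have h : (extChartAt (𝓡 n) q).symm (extChartAt (𝓡 n) q q) = q := by simp
  unfold fieldRep
  rw [h, dChart_self]

theorem fieldRep_extChartAt {c p : M} (hp : p ∈ (extChartAt (𝓡 n) c).source)
    (X : ∀ q : M, TSpace n q) :
    fieldRep c X (extChartAt (𝓡 n) c p) = dChart c p (X p) := by
  have h : (extChartAt (𝓡 n) c).symm (extChartAt (𝓡 n) c p) = p := (extChartAt (𝓡 n) c).left_inv hp
  unfold fieldRep
  rw [h]

theorem contDiffOn_fieldRep (c : M) {U : Set M} {X : ∀ q : M, TSpace n q} (hU : IsOpen U)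
    (hX : SmoothFieldOn X U) :
    ContDiffOn ℝ ∞ (fieldRep c X)
      ((extChartAt (𝓡 n) c).target ∩ (extChartAt (𝓡 n) c).symm ⁻¹' U) := by
  let e := trivializationAt (Eucl n) (fun x : M => TangentSpace (𝓡 n) x) c
  have hb : e.baseSet = (extChartAt (𝓡 n) c).source := by simp [e]
  have h1 : ContMDiffOn (𝓡 n) 𝓘(ℝ, Eucl n) ∞ (fun p => (e ⟨p, X p⟩).2)
      (U ∩ (extChartAt (𝓡 n) c).source) := by
    have := (e.contMDiffOn_section_iff (IB := 𝓡 n) (n := ∞)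
      (s := X) (a := U ∩ (extChartAt (𝓡 n) c).source)
      (hU.inter (isOpen_extChartAt_source c)) (by rw [hb]; exact inter_subset_right)).1
    exact this (hX.mono inter_subset_left)
  have h2 := h1.comp (s := (extChartAt (𝓡 n) c).target ∩ (extChartAt (𝓡 n) c).symm ⁻¹' U)
    ((contMDiffOn_extChartAt_symm (n := ∞) c).mono inter_subset_left)
    (fun x hx => ⟨hx.2, (extChartAt (𝓡 n) c).map_target hx.1⟩)
  rw [contMDiffOn_iff_contDiffOn] at h2
  refine h2.congr fun x hx => ?_
  have hx' : (extChartAt (𝓡 n) c).symm x ∈ e.baseSet := by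
    rw [hb]; exact (extChartAt (𝓡 n) c).map_target hx.1
  simp only [fieldRep, dChart, Function.comp]
  rw [Trivialization.continuousLinearMapAt_apply, Trivialization.coe_linearMapAt_of_mem _ hx']

theorem contDiffAt_fieldRep {c p : M} {U : Set M} {X : ∀ q : M, TSpace n q} (hU : IsOpen U)
    (hX : SmoothFieldOn X U) (hp : p ∈ U) (hc : p ∈ (extChartAt (𝓡 n) c).source) :
    ContDiffAt ℝ ∞ (fieldRep c X) (extChartAt (𝓡 n) c p) :=
  (contDiffOn_fieldRep c hU hX).contDiffAt ((isOpen_chart_inter c hU).mem_nhds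
    ⟨(extChartAt (𝓡 n) c).map_source hc, by
      rw [mem_preimage, (extChartAt (𝓡 n) c).left_inv hc]; exact hp⟩)

theorem smoothFieldOn_of_forall_contDiffAt {U : Set M} (hU : IsOpen U) {X : ∀ q : M, TSpace n q}
    (c : M) (hc : U ⊆ (extChartAt (𝓡 n) c).source)
    (h : ContDiffOn ℝ ∞ (fieldRep c X)
      ((extChartAt (𝓡 n) c).target ∩ (extChartAt (𝓡 n) c).symm ⁻¹' U)) : SmoothFieldOn X U := by
  let e := trivializationAt (Eucl n) (fun x : M => TangentSpace (𝓡 n) x) c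
  have hb : e.baseSet = (extChartAt (𝓡 n) c).source := by simp [e]
  refine (e.contMDiffOn_section_iff (IB := 𝓡 n) (n := ∞) (s := X) hU (by rwa [hb])).2 ?_
  have h2 := (contMDiffOn_iff_contDiffOn.2 h).comp (s := U)
    ((contMDiffOn_extChartAt (I := 𝓡 n) (n := ∞) (x := c)).mono (by simpa using hc))
    (fun p hp => ⟨(extChartAt (𝓡 n) c).map_source (hc hp), by
      rw [mem_preimage, (extChartAt (𝓡 n) c).left_inv (hc hp)]; exact hp⟩)
  refine h2.congr fun p hp => ?_
  have hp' : p ∈ e.baseSet := by rw [hb]; exact hc hp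
  simp only [Function.comp]
  rw [fieldRep_extChartAt (hc hp)]
  simp only [dChart]
  rw [Trivialization.continuousLinearMapAt_apply, Trivialization.coe_linearMapAt_of_mem _ hp']

/-- The manifold bracket is the bracket of the pullbacks under the inverse chart at `q`. These
pullbacks are the coordinate fields near the centre, and the differential of the chart is the
identity there. -/
theorem mlieBracket_eq (X Y : ∀ q : M, TSpace n q) (q : M) :
    VectorField.mlieBracket (𝓡 n) X Y q =
      fderiv ℝ (fieldRep q Y) (extChartAt (𝓡 n) q q) (X q) -
        fderiv ℝ (fieldRep q X) (extChartAt (𝓡 n) q q) (Y q) := by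
  have key : ∀ Z : ∀ q : M, TSpace n q,
      VectorField.mpullbackWithin 𝓘(ℝ, Eucl n) (𝓡 n) (extChartAt (𝓡 n) q).symm Z (range (𝓡 n))
        =ᶠ[𝓝 (extChartAt (𝓡 n) q q)] fieldRep q Z := by
    intro Z
    filter_upwards [(isOpen_extChartAt_target (I := 𝓡 n) q).mem_nhds (mem_extChartAt_target q)]
      with x hx
    have hs := (extChartAt (𝓡 n) q).map_target hx
    have hr : extChartAt (𝓡 n) q ((extChartAt (𝓡 n) q).symm x) = x :=
      (extChartAt (𝓡 n) q).right_inv hx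
    rw [VectorField.mpullbackWithin_apply]
    have h1 := dChartInv_eq_mfderiv hs
    rw [hr] at h1
    have h2 : mfderivWithin 𝓘(ℝ, Eucl n) (𝓡 n) (extChartAt (𝓡 n) q).symm (range (𝓡 n)) x =
        ((dChartEquiv hs).symm : Eucl n →L[ℝ] TSpace n ((extChartAt (𝓡 n) q).symm x)) := by
      have : (range (𝓡 n)) = univ := by simp
      rw [this, mfderivWithin_univ, ← h1]
      rfl
    rw [h2]
    erw [ContinuousLinearMap.inverse_equiv]
    rfl
  have hr : (extChartAt (𝓡 n) q).symm ⁻¹' univ ∩ range (𝓡 n) = univ := by simp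
  have h : VectorField.mlieBracket (𝓡 n) X Y q = VectorField.lieBracket ℝ
      (VectorField.mpullbackWithin 𝓘(ℝ, Eucl n) (𝓡 n) (extChartAt (𝓡 n) q).symm X (range (𝓡 n)))
      (VectorField.mpullbackWithin 𝓘(ℝ, Eucl n) (𝓡 n) (extChartAt (𝓡 n) q).symm Y (range (𝓡 n)))
      (extChartAt (𝓡 n) q q) := by
    rw [VectorField.mlieBracket, VectorField.mlieBracketWithin_apply, mfderiv_extChartAt_self]
    erw [ContinuousLinearMap.inverse_id]
    rw [hr]
    exact congrFun (VectorField.lieBracketWithin_univ (𝕜 := ℝ) (E := Eucl n)) _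
  rw [h, (key X).lieBracket_vectorField_eq (key Y), VectorField.lieBracket, fieldRep_self,
    fieldRep_self]

theorem dFun_eq {f : M → ℝ} {c p : M} (hf : MDifferentiableAt (𝓡 n) 𝓘(ℝ, ℝ) f p)
    (hp : p ∈ (extChartAt (𝓡 n) c).source) (v : TSpace n p) :
    dFun f p v = fderiv ℝ (f ∘ (extChartAt (𝓡 n) c).symm) (extChartAt (𝓡 n) c p) (dChart c p v) := by
  have hl : (extChartAt (𝓡 n) c).symm (extChartAt (𝓡 n) c p) = p := (extChartAt (𝓡 n) c).left_inv hp
  have hs : MDifferentiableAt 𝓘(ℝ, Eucl n) (𝓡 n) (extChartAt (𝓡 n) c).symm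
      (extChartAt (𝓡 n) c p) := by
    have := (contMDiffOn_extChartAt_symm (I := 𝓡 n) (n := ∞) c).contMDiffAt
      ((isOpen_extChartAt_target c).mem_nhds ((extChartAt (𝓡 n) c).map_source hp))
    exact this.mdifferentiableAt (by simp)
  rw [← mfderiv_eq_fderiv, mfderiv_comp (I' := 𝓡 n) _ (by rwa [hl]) hs,
    ← dChartInv_eq_mfderiv hp]
  change _ = mfderiv (𝓡 n) 𝓘(ℝ, ℝ) f ((extChartAt (𝓡 n) c).symm (extChartAt (𝓡 n) c p))
    (dChartInv c p (dChart c p v))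
  rw [dChartInv_dChart hp, dFun]
  congr 1
  rw [hl]

/-- The change of coordinates from the chart at `c` to the chart at `d`. -/
def transition (n : ℕ) {M : Type*} [TopologicalSpace M] [ChartedSpace (Eucl n) M] (c d : M) :
    Eucl n → Eucl n := extChartAt (𝓡 n) d ∘ (extChartAt (𝓡 n) c).symm

theorem contDiffAt_transition {c d p : M} (hc : p ∈ (extChartAt (𝓡 n) c).source)
    (hd : p ∈ (extChartAt (𝓡 n) d).source) :
    ContDiffAt ℝ ∞ (transition n c d) (extChartAt (𝓡 n) c p) := by
  have h : extChartAt (𝓡 n) c p ∈ ((extChartAt (𝓡 n) c).symm ≫ extChartAt (𝓡 n) d).source := by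
    rw [PartialEquiv.trans_source'', PartialEquiv.symm_symm, PartialEquiv.symm_target]
    exact mem_image_of_mem _ ⟨hc, hd⟩
  have := contDiffWithinAt_ext_coord_change (I := 𝓡 n) (n := ∞) d c h
  have hr : range (𝓡 n) = univ := by simp
  rwa [hr, contDiffWithinAt_univ] at this

theorem dChart_eq_fderiv_transition {c d p : M} (hc : p ∈ (extChartAt (𝓡 n) c).source)
    (hd : p ∈ (extChartAt (𝓡 n) d).source) (v : TSpace n p) :
    dChart d p v = fderiv ℝ (transition n c d) (extChartAt (𝓡 n) c p) (dChart c p v) := by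
  have hl : (extChartAt (𝓡 n) c).symm (extChartAt (𝓡 n) c p) = p := (extChartAt (𝓡 n) c).left_inv hc
  have hs : MDifferentiableAt 𝓘(ℝ, Eucl n) (𝓡 n) (extChartAt (𝓡 n) c).symm
      (extChartAt (𝓡 n) c p) := by
    have := (contMDiffOn_extChartAt_symm (I := 𝓡 n) (n := ∞) c).contMDiffAt
      ((isOpen_extChartAt_target c).mem_nhds ((extChartAt (𝓡 n) c).map_source hc))
    exact this.mdifferentiableAt (by simp)
  have hf : MDifferentiableAt (𝓡 n) 𝓘(ℝ, Eucl n) (extChartAt (𝓡 n) d) p :=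
    mdifferentiableAt_extChartAt (by simpa using hd)
  rw [transition, ← mfderiv_eq_fderiv, mfderiv_comp (I' := 𝓡 n) _ (by rwa [hl]) hs,
    ← dChartInv_eq_mfderiv hc]
  change _ = mfderiv (𝓡 n) 𝓘(ℝ, Eucl n) (extChartAt (𝓡 n) d)
    ((extChartAt (𝓡 n) c).symm (extChartAt (𝓡 n) c p)) (dChartInv c p (dChart c p v))
  rw [dChartInv_dChart hc, dChart_eq_mfderiv hd]
  congr 1
  rw [hl]

end Coordinates

/-! ### Smooth orthonormal frames of the distribution -/

section Frames

variable {n k : ℕ} {M : Type*} [TopologicalSpace M] [ChartedSpace (Eucl n) M]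
  [IsManifold (𝓡 n) ∞ M]

theorem SmoothFieldOn.mono {X : ∀ q : M, TSpace n q} {U V : Set M} (h : SmoothFieldOn X U)
    (hV : V ⊆ U) : SmoothFieldOn X V := ContMDiffOn.mono h hV

theorem SmoothFieldOn.add {X Y : ∀ q : M, TSpace n q} {U : Set M} (hX : SmoothFieldOn X U)
    (hY : SmoothFieldOn Y U) : SmoothFieldOn (fun q => X q + Y q) U :=
  ContMDiffOn.add_section hX hY

theorem SmoothFieldOn.sub {X Y : ∀ q : M, TSpace n q} {U : Set M} (hX : SmoothFieldOn X U)
    (hY : SmoothFieldOn Y U) : SmoothFieldOn (fun q => X q - Y q) U :=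
  ContMDiffOn.sub_section hX hY

theorem SmoothFieldOn.smul {f : M → ℝ} {X : ∀ q : M, TSpace n q} {U : Set M}
    (hf : ContMDiffOn (𝓡 n) 𝓘(ℝ, ℝ) ∞ f U) (hX : SmoothFieldOn X U) :
    SmoothFieldOn (fun q => f q • X q) U :=
  ContMDiffOn.smul_section hf hX

theorem SmoothFieldOn.sum {ι : Type*} (s : Finset ι) {X : ι → ∀ q : M, TSpace n q} {U : Set M}
    (hX : ∀ i ∈ s, SmoothFieldOn (X i) U) : SmoothFieldOn (fun q => ∑ i ∈ s, X i q) U :=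
  ContMDiffOn.sum_section hX

theorem SmoothFieldOn.congr {X Y : ∀ q : M, TSpace n q} {U : Set M} (hX : SmoothFieldOn X U)
    (h : ∀ q ∈ U, Y q = X q) : SmoothFieldOn Y U :=
  ContMDiffOn.congr hX fun q hq => by rw [h q hq]

namespace Structure

variable (S : Structure n k M)

/-- The fields `X i` form a smooth orthonormal frame of the distribution on the open set `U`. -/
structure IsOrthoFrame (U : Set M) (X : Fin k → ∀ x : M, S.D x) : Prop where
  isOpen : IsOpen U
  smooth : ∀ i, SmoothFieldOn (fun x => (X i x : TSpace n x)) U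
  orth : ∀ x ∈ U, ∀ i j, S.g x (X i x) (X j x) = if i = j then 1 else 0

variable {S}

theorem linearIndependent_of_orth {m : ℕ} {q : M} {b : Fin m → S.D q}
    (hb : ∀ i j, S.g q (b i) (b j) = if i = j then 1 else 0) : LinearIndependent ℝ b := by
  rw [Fintype.linearIndependent_iff]
  intro c hc j
  have := congrArg (S.g q (b j)) hc
  simpa [hb] using this

/-- The basis given by an orthonormal family. -/
def basisOfOrth {q : M} {b : Fin k → S.D q}
    (hb : ∀ i j, S.g q (b i) (b j) = if i = j then 1 else 0) : Module.Basis (Fin k) ℝ (S.D q) :=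
  Module.Basis.mk (linearIndependent_of_orth hb)
    ((linearIndependent_of_orth hb).span_eq_top_of_card_eq_finrank'
      (by rw [S.finrank_D, Fintype.card_fin])).ge

theorem basisOfOrth_apply {q : M} {b : Fin k → S.D q}
    (hb : ∀ i j, S.g q (b i) (b j) = if i = j then 1 else 0) (i : Fin k) :
    basisOfOrth hb i = b i := by
  simp [basisOfOrth]

theorem eq_sum_of_orth {q : M} {b : Fin k → S.D q}
    (hb : ∀ i j, S.g q (b i) (b j) = if i = j then 1 else 0) (v : S.D q) :
    v = ∑ i, S.g q (b i) v • b i := by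
  have h : LinearMap.id = (∑ i, (S.g q (b i)).smulRight (b i)) := by
    refine (basisOfOrth hb).ext fun j => ?_
    simp [basisOfOrth_apply, hb]
  simpa using congrArg (fun f => f v) h

theorem g_eq_sum_of_orth {q : M} {b : Fin k → S.D q}
    (hb : ∀ i j, S.g q (b i) (b j) = if i = j then 1 else 0) (v w : S.D q) :
    S.g q v w = ∑ i, S.g q (b i) v * S.g q (b i) w := by
  conv_lhs => rw [eq_sum_of_orth hb v]
  simp

theorem sharp_eq_of_orth {q : M} {b : Fin k → S.D q}
    (hb : ∀ i j, S.g q (b i) (b j) = if i = j then 1 else 0) (α : CSpace n q) :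
    S.sharp q α = ∑ i, α (b i : TSpace n q) • b i := by
  rw [eq_sum_of_orth hb (S.sharp q α)]
  refine Finset.sum_congr rfl fun i _ => ?_
  rw [S.symm, S.sharp_spec]

/-- The sum of squares is g(α♯, α♯) for every orthonormal basis. The pointwise choice `onb` carries
no smoothness, so this is what lets smooth frames replace it. -/
theorem hamiltonian_eq_of_orth {q : M} {b : Fin k → S.D q}
    (hb : ∀ i j, S.g q (b i) (b j) = if i = j then 1 else 0) (α : CSpace n q) :
    S.hamiltonian q α = (1 / 2) * ∑ i, α (b i : TSpace n q) ^ 2 := by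
  have key : ∀ {c : Fin k → S.D q}, (∀ i j, S.g q (c i) (c j) = if i = j then 1 else 0) →
      ∑ i, α (c i : TSpace n q) ^ 2 = S.g q (S.sharp q α) (S.sharp q α) := by
    intro c hc
    rw [g_eq_sum_of_orth hc]
    refine Finset.sum_congr rfl fun i _ => ?_
    rw [S.symm, S.sharp_spec, sq]
  rw [hamiltonian, key (S.onb_spec q), key hb]

/-- Gram-Schmidt with smooth coefficients. The equality of spans belongs to the induction because it
shows that the next orthogonalized vector does not vanish, so that its norm can be inverted
smoothly. -/
theorem exists_orth_of_linearIndependent {U : Set M} (hU : IsOpen U) (m : ℕ)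
    (Z : Fin m → ∀ x : M, S.D x) (hZ : ∀ i, SmoothFieldOn (fun x => (Z i x : TSpace n x)) U)
    (hli : ∀ x ∈ U, LinearIndependent ℝ (fun i => Z i x)) :
    ∃ X : Fin m → ∀ x : M, S.D x, (∀ i, SmoothFieldOn (fun x => (X i x : TSpace n x)) U) ∧
      ∀ x ∈ U, (∀ i j, S.g x (X i x) (X j x) = if i = j then 1 else 0) ∧
        Submodule.span ℝ (range fun i => X i x) = Submodule.span ℝ (range fun i => Z i x) := by
  induction m with
  | zero => exact ⟨Z, hZ, fun x _ => ⟨fun i => i.elim0, rfl⟩⟩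
  | succ m ih =>
    have hli' : ∀ x ∈ U, LinearIndependent ℝ (fun i : Fin m => Z i.castSucc x) ∧
        Z (Fin.last m) x ∉ Submodule.span ℝ (range fun i : Fin m => Z i.castSucc x) :=
      fun x hx => (linearIndependent_finSucc' (K := ℝ) (v := fun i => Z i x)).1 (hli x hx)
    obtain ⟨X, hX, hX'⟩ := ih (fun i => Z i.castSucc) (fun i => hZ _) (fun x hx => (hli' x hx).1)
    let W : ∀ x : M, S.D x := fun x =>
      Z (Fin.last m) x - ∑ i, S.g x (Z (Fin.last m) x) (X i x) • X i x
    have hW : SmoothFieldOn (fun x => (W x : TSpace n x)) U := by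
      have : ∀ x, (W x : TSpace n x) = (Z (Fin.last m) x : TSpace n x) -
          ∑ i, S.g x (Z (Fin.last m) x) (X i x) • (X i x : TSpace n x) := by
        intro x; simp [W]
      simp only [this]
      exact SmoothFieldOn.sub (hZ _) (SmoothFieldOn.sum _ fun i _ =>
        SmoothFieldOn.smul (S.smooth_g U hU _ _ (hZ _) (hX i)) (hX i))
    have hWX : ∀ x ∈ U, ∀ j, S.g x (W x) (X j x) = 0 := by
      intro x hx j
      simp [W, (hX' x hx).1]
    have hspan : ∀ x ∈ U, W x - Z (Fin.last m) x ∈ Submodule.span ℝ (range fun i => X i x) := by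
      intro x hx
      simp only [W, sub_sub_cancel_left]
      exact neg_mem (Submodule.sum_mem _ fun i _ => Submodule.smul_mem _ _
        (Submodule.subset_span ⟨i, rfl⟩))
    have hW0 : ∀ x ∈ U, W x ≠ 0 := by
      intro x hx h0
      apply (hli' x hx).2
      have := hspan x hx
      rw [h0, zero_sub, (hX' x hx).2] at this
      simpa using neg_mem this
    let r : M → ℝ := fun x => (Real.sqrt (S.g x (W x) (W x)))⁻¹
    have hpos : ∀ x ∈ U, 0 < S.g x (W x) (W x) := fun x hx => S.pos x _ (hW0 x hx)
    have hr : ContMDiffOn (𝓡 n) 𝓘(ℝ, ℝ) ∞ r U := by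
      intro x hx
      have h1 := S.smooth_g U hU _ _ hW hW x hx
      have h2 : ContDiffAt ℝ ∞ (fun y : ℝ => (Real.sqrt y)⁻¹) (S.g x (W x) (W x)) :=
        (Real.contDiffAt_sqrt (hpos x hx).ne').inv (Real.sqrt_pos.2 (hpos x hx)).ne'
      exact ContMDiffAt.comp_contMDiffWithinAt (g := fun y : ℝ => (Real.sqrt y)⁻¹)
        (f := fun q => S.g q (W q) (W q)) x h2.contMDiffAt h1
    have hr0 : ∀ x ∈ U, r x ≠ 0 := fun x hx => inv_ne_zero (Real.sqrt_pos.2 (hpos x hx)).ne'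
    refine ⟨Fin.snoc X (fun x => r x • W x), ?_, fun x hx => ⟨?_, ?_⟩⟩
    · intro i
      refine Fin.lastCases ?_ (fun i => ?_) i
      · simp only [Fin.snoc_last]
        simpa using! SmoothFieldOn.smul hr hW
      · simp only [Fin.snoc_castSucc]
        exact hX i
    · intro i j
      refine Fin.lastCases ?_ (fun i => ?_) i <;> refine Fin.lastCases ?_ (fun j => ?_) j
      · have : r x * (r x * S.g x (W x) (W x)) = 1 := by
          have h := (Real.sqrt_pos.2 (hpos x hx)).ne'
          have h2 := Real.mul_self_sqrt (hpos x hx).le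
          simp only [r]
          field_simp
          rw [sq, h2]
        simpa using this
      · simp [hWX x hx j, (Fin.castSucc_ne_last j).symm]
      · simp [S.symm x (X i x), hWX x hx i]
      · simp [(hX' x hx).1]
    · have e1 : (range fun i : Fin (m + 1) => (Fin.snoc X (fun x => r x • W x) :
          Fin (m + 1) → ∀ x, S.D x) i x) = insert (r x • W x) (range fun i => X i x) := by
        ext v
        simp [Fin.exists_fin_succ', or_comm, eq_comm]
      have e2 : (range fun i : Fin (m + 1) => Z i x) =
          insert (Z (Fin.last m) x) (range fun i : Fin m => Z i.castSucc x) := by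
        ext v
        simp [Fin.exists_fin_succ', or_comm, eq_comm]
      rw [e1, e2, Submodule.span_insert, Submodule.span_insert, ← (hX' x hx).2]
      have h1 := hspan x hx
      apply le_antisymm
      · refine sup_le ?_ le_sup_right
        rw [Submodule.span_singleton_le_iff_mem]
        refine Submodule.smul_mem _ _ ?_
        have : W x = Z (Fin.last m) x + (W x - Z (Fin.last m) x) := by abel
        rw [this]
        exact add_mem (Submodule.mem_sup_left (Submodule.mem_span_singleton_self _))
          (Submodule.mem_sup_right h1)
      · refine sup_le ?_ le_sup_right
        rw [Submodule.span_singleton_le_iff_mem]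
        have : Z (Fin.last m) x = (r x)⁻¹ • (r x • W x) - (W x - Z (Fin.last m) x) := by
          rw [inv_smul_smul₀ (hr0 x hx)]; abel
        rw [this]
        exact sub_mem (Submodule.mem_sup_left (Submodule.smul_mem _ _
          (Submodule.mem_span_singleton_self _))) (Submodule.mem_sup_right h1)

variable (S) in
theorem exists_isOrthoFrame (q : M) : ∃ U X, q ∈ U ∧ S.IsOrthoFrame U X := by
  classical
  obtain ⟨U, hU, hq, r, Y, hY, hYs⟩ := S.smooth_D q
  have hr : r = k := by
    rw [← S.finrank_D q, ← (hYs q hq).2, finrank_span_eq_card (hYs q hq).1, Fintype.card_fin]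
  subst hr
  have hmem : ∀ i, ∀ x ∈ U, Y i x ∈ S.D x := fun i x hx => by
    rw [← (hYs x hx).2]; exact Submodule.subset_span ⟨i, rfl⟩
  -- The spanning fields are horizontal only over `U`; the value zero elsewhere makes them sections
  -- of `D` defined everywhere, the form in which `smooth_g` takes its arguments.
  let Z : Fin r → ∀ x : M, S.D x := fun i x => if hx : x ∈ U then ⟨Y i x, hmem i x hx⟩ else 0
  have hZ : ∀ i, ∀ x ∈ U, (Z i x : TSpace n x) = Y i x := fun i x hx => by simp [Z, hx]
  obtain ⟨X, hX, hX'⟩ := exists_orth_of_linearIndependent hU r Z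
    (fun i => (hY i).congr (hZ i)) (fun x hx => by
      refine LinearIndependent.of_comp (S.D x).subtype ?_
      have : (S.D x).subtype ∘ (fun i => Z i x) = fun i => Y i x := by
        ext1 i; exact hZ i x hx
      rw [this]
      exact (hYs x hx).1)
  exact ⟨U, X, hq, hU, hX, fun x hx => (hX' x hx).1⟩

theorem IsOrthoFrame.mono {U V : Set M} {X : Fin k → ∀ x : M, S.D x} (h : S.IsOrthoFrame U X)
    (hV : IsOpen V) (hVU : V ⊆ U) : S.IsOrthoFrame V X :=
  ⟨hV, fun i => (h.smooth i).mono hVU, fun x hx => h.orth x (hVU hx)⟩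

end Structure

end Frames

/-! ### Hamilton's equations in a vector space and conservation of energy -/

section HamiltonEquations

open Metric
open scoped NNReal

variable {k : ℕ} {E : Type*} [NormedAddCommGroup E] [NormedSpace ℝ E]

/-- The Hamiltonian vector field of `H(x, p) = ½ ∑ p(F_i(x))²`. -/
def hamField (F : Fin k → E → E) (z : E × (E →L[ℝ] ℝ)) : E × (E →L[ℝ] ℝ) :=
  (∑ i, z.2 (F i z.1) • F i z.1, -∑ i, z.2 (F i z.1) • z.2.comp (fderiv ℝ (F i) z.1))

/-- The quantities `p(F_i(x))`. -/
def speed (F : Fin k → E → E) (z : E × (E →L[ℝ] ℝ)) : Eucl k :=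
  WithLp.toLp 2 fun i => z.2 (F i z.1)

@[simp] theorem speed_apply (F : Fin k → E → E) (z : E × (E →L[ℝ] ℝ)) (i : Fin k) :
    speed F z i = z.2 (F i z.1) := rfl

/-- The Hamiltonian vector field, cut off at large speeds, for momenta in units of `R`. -/
def cutoffField (χ : ContDiffBump (0 : Eucl k)) (F : Fin k → E → E) (R : ℝ)
    (z : E × (E →L[ℝ] ℝ)) : E × (E →L[ℝ] ℝ) :=
  (∑ i, (χ (R • speed F z) * (R * z.2 (F i z.1))) • F i z.1,
    -∑ i, (χ (R • speed F z) * (R * z.2 (F i z.1))) • z.2.comp (fderiv ℝ (F i) z.1))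

theorem contDiffOn_eval {F : E → E} {O : Set E} {m : WithTop ℕ∞} (hF : ContDiffOn ℝ m F O) :
    ContDiffOn ℝ m (fun z : E × (E →L[ℝ] ℝ) => z.2 (F z.1)) (O ×ˢ univ) :=
  contDiff_snd.contDiffOn.clm_apply (hF.comp contDiff_fst.contDiffOn fun _ hz => hz.1)

theorem contDiffOn_speed {F : Fin k → E → E} {O : Set E} {m : WithTop ℕ∞}
    (hF : ∀ i, ContDiffOn ℝ m (F i) O) : ContDiffOn ℝ m (speed F) (O ×ˢ univ) := by
  rw [contDiffOn_euclidean]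
  exact fun i => contDiffOn_eval (hF i)

theorem contDiffOn_comp_fderiv {F : E → E} {O : Set E} (hO : IsOpen O)
    (hF : ContDiffOn ℝ ∞ F O) :
    ContDiffOn ℝ 1 (fun z : E × (E →L[ℝ] ℝ) => z.2.comp (fderiv ℝ F z.1)) (O ×ˢ univ) :=
  contDiff_snd.contDiffOn.clm_comp
    ((hF.fderiv_of_isOpen (m := 1) hO (WithTop.coe_le_coe.2 (le_top : (1 + 1 : ℕ∞) ≤ ⊤))).comp contDiff_fst.contDiffOn
      fun _ hz => hz.1)

theorem contDiffOn_hamField {F : Fin k → E → E} {O : Set E} (hO : IsOpen O)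
    (hF : ∀ i, ContDiffOn ℝ ∞ (F i) O) : ContDiffOn ℝ 1 (hamField F) (O ×ˢ univ) := by
  have hF' : ∀ i, ContDiffOn ℝ 1 (F i) O := fun i => (hF i).of_le (by exact_mod_cast le_top)
  refine ContDiffOn.prodMk ?_ (ContDiffOn.neg ?_)
  · exact ContDiffOn.sum fun i _ => (contDiffOn_eval (hF' i)).smul
      ((hF' i).comp contDiff_fst.contDiffOn fun _ hz => hz.1)
  · exact ContDiffOn.sum fun i _ => (contDiffOn_eval (hF' i)).smul
      (contDiffOn_comp_fderiv hO (hF i))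

theorem contDiffOn_cutoffField (χ : ContDiffBump (0 : Eucl k)) {F : Fin k → E → E} {O : Set E}
    (hO : IsOpen O) (hF : ∀ i, ContDiffOn ℝ ∞ (F i) O) (R : ℝ) :
    ContDiffOn ℝ 1 (cutoffField χ F R) (O ×ˢ univ) := by
  have hF' : ∀ i, ContDiffOn ℝ 1 (F i) O := fun i => (hF i).of_le (by exact_mod_cast le_top)
  have hs : ContDiffOn ℝ 1 (fun z => R • speed F z) (O ×ˢ univ) :=
    (contDiffOn_speed hF').const_smul R
  have hχ : ContDiffOn ℝ 1 (fun z => χ (R • speed F z)) (O ×ˢ univ) :=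
    ContDiff.comp_contDiffOn (g := χ) (by exact_mod_cast χ.contDiff (n := 1)) hs
  have hc : ∀ i, ContDiffOn ℝ 1 (fun z : E × (E →L[ℝ] ℝ) =>
      χ (R • speed F z) * (R * z.2 (F i z.1))) (O ×ˢ univ) := fun i =>
    hχ.mul (contDiffOn_const.mul (contDiffOn_eval (hF' i)))
  refine ContDiffOn.prodMk ?_ (ContDiffOn.neg ?_)
  · exact ContDiffOn.sum fun i _ => (hc i).smul
      ((hF' i).comp contDiff_fst.contDiffOn fun _ hz => hz.1)
  · exact ContDiffOn.sum fun i _ => (hc i).smul (contDiffOn_comp_fderiv hO (hF i))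

/-- Either the cutoff vanishes or the rescaled speeds lie in its support, of radius `rOut`. -/
theorem abs_cutoff_mul_le (χ : ContDiffBump (0 : Eucl k)) (F : Fin k → E → E) (R : ℝ)
    (z : E × (E →L[ℝ] ℝ)) (i : Fin k) :
    |χ (R • speed F z) * (R * z.2 (F i z.1))| ≤ χ.rOut := by
  have h1 : |R * z.2 (F i z.1)| ≤ ‖R • speed F z‖ := by
    simpa using PiLp.norm_apply_le (R • speed F z) i
  by_cases h : χ.rOut ≤ ‖R • speed F z‖
  · rw [χ.zero_of_le_dist (by simpa using h)]
    simpa using χ.rOut_pos.le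
  · rw [abs_mul, abs_of_nonneg χ.nonneg]
    calc χ (R • speed F z) * |R * z.2 (F i z.1)| ≤ 1 * |R * z.2 (F i z.1)| := by
          gcongr; exact χ.le_one
      _ ≤ χ.rOut := by rw [one_mul]; exact h1.trans (not_le.1 h).le

/-- The bound does not involve `R`: the cutoff controls the speeds whatever the unit of momentum,
and the rest of the field is at most linear in the momentum. The uniform existence time rests on
this. -/
theorem norm_cutoffField_le (χ : ContDiffBump (0 : Eucl k)) {F : Fin k → E → E} (R : ℝ)
    {z : E × (E →L[ℝ] ℝ)} {C a : ℝ} (hC : 0 ≤ C) (h1 : ∀ i, ‖F i z.1‖ ≤ C)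
    (h2 : ∀ i, ‖fderiv ℝ (F i) z.1‖ ≤ C) (ha : ‖z.2‖ ≤ a) :
    ‖cutoffField χ F R z‖ ≤ k * (χ.rOut * (C * (1 + a))) := by
  have ha0 : 0 ≤ a := (norm_nonneg _).trans ha
  have hr := χ.rOut_pos.le
  refine max_le ?_ ?_
  · change ‖∑ i : Fin k, (_ • _ : E)‖ ≤ _
    refine (norm_sum_le _ _).trans ?_
    calc _ ≤ ∑ _i : Fin k, χ.rOut * (C * (1 + a)) := by
          refine Finset.sum_le_sum fun i _ => ?_
          rw [norm_smul, Real.norm_eq_abs]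
          refine mul_le_mul (abs_cutoff_mul_le χ F R z i) ((h1 i).trans ?_) (norm_nonneg _) hr
          nlinarith
      _ = _ := by simp
  · change ‖-_‖ ≤ _
    rw [norm_neg]
    refine (norm_sum_le _ _).trans ?_
    calc _ ≤ ∑ _i : Fin k, χ.rOut * (C * (1 + a)) := by
          refine Finset.sum_le_sum fun i _ => ?_
          rw [norm_smul, Real.norm_eq_abs]
          refine mul_le_mul (abs_cutoff_mul_le χ F R z i) ?_ (norm_nonneg _) hr
          refine (ContinuousLinearMap.opNorm_comp_le _ _).trans ?_
          calc ‖z.2‖ * ‖fderiv ℝ (F i) z.1‖ ≤ a * C := by gcongr; exact h2 i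
            _ ≤ C * (1 + a) := by nlinarith
      _ = _ := by simp

/-- The speeds along a curve evolve through the brackets of the fields. -/
theorem hasDerivWithinAt_speed {F : Fin k → E → E} {z : ℝ → E × (E →L[ℝ] ℝ)} {I : Set ℝ} {t : ℝ}
    {c : Fin k → ℝ} (hF : ∀ i, DifferentiableAt ℝ (F i) (z t).1)
    (hz : HasDerivWithinAt z (∑ i, c i • F i (z t).1,
      -∑ i, c i • (z t).2.comp (fderiv ℝ (F i) (z t).1)) I t) (j : Fin k) :
    HasDerivWithinAt (fun s => (z s).2 (F j (z s).1))
      (∑ i, c i * ((z t).2 (fderiv ℝ (F j) (z t).1 (F i (z t).1)) -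
        (z t).2 (fderiv ℝ (F i) (z t).1 (F j (z t).1)))) I t := by
  have h1 : HasDerivWithinAt (fun s => (z s).1) _ I t := hz.fst
  have h2 : HasDerivWithinAt (fun s => (z s).2) _ I t := hz.snd
  have h3 := (hF j).hasFDerivAt.comp_hasDerivWithinAt t h1
  refine (h2.clm_apply h3).congr_deriv ?_
  simp only [map_sum, map_smul, neg_apply, sum_apply, smul_apply,
    ContinuousLinearMap.comp_apply, smul_eq_mul, mul_sub, Finset.sum_sub_distrib,
    Function.comp_apply]
  ring

/-- The derivative of ∑ u_j² is a sum of u_j u_i times an antisymmetric bracket term. The common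
scalar factor `f` does not affect the cancellation, so the energy is conserved for the cut-off field
as well. -/
theorem sum_sq_speed_eq {F : Fin k → E → E} {z : ℝ → E × (E →L[ℝ] ℝ)} {T : ℝ} {f : ℝ → ℝ}
    (hF : ∀ t ∈ Icc 0 T, ∀ i, DifferentiableAt ℝ (F i) (z t).1)
    (hz : ∀ t ∈ Icc 0 T, HasDerivWithinAt z
      (∑ i, (f t * (z t).2 (F i (z t).1)) • F i (z t).1,
        -∑ i, (f t * (z t).2 (F i (z t).1)) • (z t).2.comp (fderiv ℝ (F i) (z t).1)) (Icc 0 T) t)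
    {t : ℝ} (ht : t ∈ Icc 0 T) :
    ∑ i, (z t).2 (F i (z t).1) ^ 2 = ∑ i, (z 0).2 (F i (z 0).1) ^ 2 := by
  have key : ∀ s ∈ Icc 0 T, HasDerivWithinAt (fun s => ∑ i, (z s).2 (F i (z s).1) ^ 2) 0
      (Icc 0 T) s := by
    intro s hs
    have h := HasDerivWithinAt.fun_sum (u := Finset.univ) fun j _ =>
      (hasDerivWithinAt_speed (hF s hs) (hz s hs) j).pow 2
    refine h.congr_deriv ?_
    set u : Fin k → ℝ := fun i => (z s).2 (F i (z s).1)
    set B : Fin k → Fin k → ℝ := fun j i => (z s).2 (fderiv ℝ (F j) (z s).1 (F i (z s).1))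
    have hA : ∑ j, ∑ i, u j * (u i * (B j i - B i j)) = 0 := by
      have h1 : ∑ j, ∑ i, u j * (u i * (B j i - B i j)) =
          ∑ j, ∑ i, u j * (u i * (B i j - B j i)) := by
        rw [Finset.sum_comm]
        refine Finset.sum_congr rfl fun j _ => Finset.sum_congr rfl fun i _ => by ring
      have h2 : ∑ j, ∑ i, u j * (u i * (B i j - B j i)) =
          -∑ j, ∑ i, u j * (u i * (B j i - B i j)) := by
        simp only [← Finset.sum_neg_distrib]
        refine Finset.sum_congr rfl fun j _ => Finset.sum_congr rfl fun i _ => by ring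
      linarith
    calc _ = 2 * f s * ∑ j, ∑ i, u j * (u i * (B j i - B i j)) := by
          simp only [Finset.mul_sum]
          refine Finset.sum_congr rfl fun j _ => Finset.sum_congr rfl fun i _ => ?_
          simp only [u, B]
          push_cast
          ring
      _ = 0 := by rw [hA, mul_zero]
  refine constant_of_derivWithin_zero (f := fun s => ∑ i, (z s).2 (F i (z s).1) ^ 2)
    (fun s hs => (key s hs).differentiableWithinAt) (fun s hs => ?_) t ht
  have hs' : s ∈ Icc 0 T := ⟨hs.1, hs.2.le⟩
  exact (key s hs').derivWithin (uniqueDiffOn_Icc (hs.1.trans_lt hs.2) s hs')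

end HamiltonEquations

/-! ### Existence of the flow up to a time independent of the momentum -/

section HamiltonFlow

open Metric
open scoped NNReal

variable {k : ℕ} {E : Type*} [NormedAddCommGroup E] [NormedSpace ℝ E] [FiniteDimensional ℝ E]

theorem exists_lipschitzOnWith_of_isCompact {E' F' : Type*} [NormedAddCommGroup E']
    [NormedSpace ℝ E'] [NormedAddCommGroup F'] [NormedSpace ℝ F'] {f : E' → F'} {s : Set E'}
    (hs : IsCompact s) (hf : ∀ x ∈ s, ContDiffAt ℝ 1 f x) : ∃ K : ℝ≥0, LipschitzOnWith K f s := by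
  refine LocallyLipschitzOn.exists_lipschitzOnWith_of_compact hs fun x hx => ?_
  obtain ⟨K, t, ht, hK⟩ := (hf x hx).exists_lipschitzOnWith
  exact ⟨K, t, mem_nhdsWithin_of_mem_nhds ht, hK⟩

/-- The local flow given by the Picard-Lindelöf theorem, with its range. -/
theorem exists_flow_mem_closedBall {E' : Type*} [NormedAddCommGroup E'] [NormedSpace ℝ E']
    [CompleteSpace E'] {f : ℝ → E' → E'} {tmin tmax : ℝ} {t₀ : Icc tmin tmax} {x₀ : E'}
    {a r L K : ℝ≥0} (hf : IsPicardLindelof f t₀ x₀ a r L K) :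
    ∃ α : E' → ℝ → E', (∀ x ∈ closedBall x₀ r, α x t₀ = x ∧ ∀ t ∈ Icc tmin tmax,
      HasDerivWithinAt (α x) (f t (α x t)) (Icc tmin tmax) t ∧ α x t ∈ closedBall x₀ a) ∧
      ∃ L' : ℝ≥0, ∀ t ∈ Icc tmin tmax, LipschitzOnWith L' (α · t) (closedBall x₀ r) := by
  classical
  -- The solutions are fixed points of the Picard operator on a space of curves in the ball of
  -- radius `a`, so the range bound comes with the construction.
  have (x) (hx : x ∈ closedBall x₀ r) := ODE.FunSpace.exists_isFixedPt_next hf hx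
  choose α hα using this
  set α' := fun (x : E') ↦ if hx : x ∈ closedBall x₀ r then
    α x hx |>.compProj else 0 with hα'
  refine ⟨α', fun x hx ↦ ⟨?_, fun t ht ↦ ⟨?_, ?_⟩⟩, ?_⟩
  · rw [hα']
    beta_reduce
    rw [dif_pos hx, ODE.FunSpace.compProj_val, ← hα, ODE.FunSpace.next_apply₀]
  · rw [hα']
    beta_reduce
    rw [dif_pos hx, ODE.FunSpace.compProj_apply]
    apply ODE.hasDerivWithinAt_picard_Icc t₀.2 hf.continuousOn_uncurry
      (α x hx |>.continuous_compProj.continuousOn)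
      (fun _ ht' ↦ α x hx |>.compProj_mem_closedBall hf.mul_max_le)
      x ht |>.congr_of_mem _ ht
    intro t' ht'
    nth_rw 1 [← hα]
    rw [ODE.FunSpace.compProj_of_mem ht', ODE.FunSpace.next_apply]
  · rw [hα']
    beta_reduce
    rw [dif_pos hx]
    exact (α x hx).compProj_mem_closedBall hf.mul_max_le
  · obtain ⟨L', h⟩ := ODE.FunSpace.exists_forall_closedBall_funSpace_dist_le_mul hf
    refine ⟨L', fun t ht ↦ LipschitzOnWith.of_dist_le_mul fun x hx y hy ↦ ?_⟩
    simp_rw [hα']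
    rw [dif_pos hx, dif_pos hy, ODE.FunSpace.compProj_apply, ODE.FunSpace.compProj_apply,
      ← ODE.FunSpace.toContinuousMap_apply_eq_apply,
      ← ODE.FunSpace.toContinuousMap_apply_eq_apply]
    have : Nonempty (Icc tmin tmax) := ⟨t₀⟩
    apply ContinuousMap.dist_le_iff_of_nonempty.mp
    exact h x y hx hy (α x hx) (α y hy) (hα x hx) (hα y hy)

/-- Hamilton's equations for `H(x, p) = ½ ∑ p(F_i(x))²` can be solved for initial momenta with
`2H = 1` up to a time that does not depend on the size of the momentum. -/
theorem exists_hamilton_flow {F : Fin k → E → E} {O : Set E} (hO : IsOpen O)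
    (hF : ∀ i, ContDiffOn ℝ ∞ (F i) O) {x₀ : E} (hx₀ : x₀ ∈ O) :
    ∃ T > 0, ∃ a > 0, closedBall x₀ a ⊆ O ∧ ∀ R > 0,
      ∃ Γ : (E →L[ℝ] ℝ) → ℝ → E × (E →L[ℝ] ℝ),
        (∀ p, ‖p‖ ≤ R → ∑ i, p (F i x₀) ^ 2 = 1 → Γ p 0 = (x₀, p) ∧ ∀ t ∈ Icc 0 T,
          HasDerivWithinAt (Γ p) (hamField F (Γ p t)) (Icc 0 T) t ∧
          (Γ p t).1 ∈ closedBall x₀ a ∧ ‖(Γ p t).2‖ ≤ 2 * R ∧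
          ∑ i, (Γ p t).2 (F i (Γ p t).1) ^ 2 = 1) ∧
        ∀ t ∈ Icc 0 T, ContinuousOn (fun p => Γ p t) {p | ‖p‖ ≤ R ∧ ∑ i, p (F i x₀) ^ 2 = 1} := by
  have := FiniteDimensional.proper_real E
  have := FiniteDimensional.proper_real (E →L[ℝ] ℝ)
  obtain ⟨a, ha, haO⟩ := nhds_basis_closedBall.mem_iff.1 (hO.mem_nhds hx₀)
  obtain ⟨C, hC⟩ : ∃ C, ∀ i, ∀ x ∈ closedBall x₀ a, ‖F i x‖ ≤ C ∧ ‖fderiv ℝ (F i) x‖ ≤ C := by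
    have h1 : ∀ i, ∃ C, ∀ x ∈ closedBall x₀ a, ‖F i x‖ ≤ C := fun i =>
      (isCompact_closedBall x₀ a).exists_bound_of_continuousOn ((hF i).continuousOn.mono haO)
    have h2 : ∀ i, ∃ C, ∀ x ∈ closedBall x₀ a, ‖fderiv ℝ (F i) x‖ ≤ C := fun i =>
      (isCompact_closedBall x₀ a).exists_bound_of_continuousOn
        (((hF i).continuousOn_fderiv_of_isOpen hO (by simp)).mono haO)
    choose C₁ hC₁ using h1
    choose C₂ hC₂ using h2
    refine ⟨∑ i, (|C₁ i| + |C₂ i|), fun i x hx => ?_⟩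
    have h3 : |C₁ i| + |C₂ i| ≤ ∑ i, (|C₁ i| + |C₂ i|) :=
      Finset.single_le_sum (f := fun i => |C₁ i| + |C₂ i|) (fun _ _ => by positivity)
        (Finset.mem_univ i)
    exact ⟨by linarith [hC₁ i x hx, le_abs_self (C₁ i), abs_nonneg (C₂ i)],
      by linarith [hC₂ i x hx, le_abs_self (C₂ i), abs_nonneg (C₁ i)]⟩
  -- The cutoff is 1 on the closed unit ball, which contains the speeds of covectors with 2H = 1. By
  -- conservation of energy it never acts on the curves of interest.
  let χ : ContDiffBump (0 : Eucl k) := ⟨1, 2, one_pos, one_lt_two⟩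
  let L : ℝ≥0 := ⟨k * (χ.rOut * (|C| * (1 + a))), by have := χ.rOut_pos; positivity⟩
  have hL1 : 0 < (L : ℝ) + 1 := by positivity
  -- A curve that starts within a/2 of the centre with velocity at most `L` stays in the ball of
  -- radius `a` up to this time, which is fixed before `R`.
  let T : ℝ := (a / 2) / (L + 1)
  have hT : 0 < T := by positivity
  refine ⟨T, hT, a, ha, haO, fun R hR => ?_⟩
  -- The unit of momentum: initial momenta of norm at most `R` become vectors of norm at most a/2,
  -- and rescaled momenta of norm at most `a` come from momenta of norm at most 2R.
  let c : ℝ := 2 * R / a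
  have hc : 0 < c := by positivity
  let A : ℝ≥0 := ⟨a, ha.le⟩
  let z₀ : E × (E →L[ℝ] ℝ) := (x₀, 0)
  have hball : ∀ z ∈ closedBall z₀ (A : ℝ), z.1 ∈ closedBall x₀ a ∧ ‖z.2‖ ≤ a := by
    intro z hz
    have : dist z z₀ ≤ a := hz
    rw [Prod.dist_eq, max_le_iff] at this
    exact ⟨this.1, by simpa [z₀] using this.2⟩
  have hsmooth := contDiffOn_cutoffField χ hO hF c
  have hOu : IsOpen (O ×ˢ (univ : Set (E →L[ℝ] ℝ))) := hO.prod isOpen_univ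
  obtain ⟨K, hK⟩ := exists_lipschitzOnWith_of_isCompact (isCompact_closedBall z₀ (A : ℝ))
    (f := cutoffField χ F c) fun z hz =>
      hsmooth.contDiffAt (hOu.mem_nhds ⟨haO (hball z hz).1, mem_univ _⟩)
  have hPL : IsPicardLindelof (fun _ => cutoffField χ F c) (tmin := 0) (tmax := T)
      ⟨0, left_mem_Icc.2 hT.le⟩ z₀ A (A / 2) L K := by
    refine IsPicardLindelof.of_time_independent (fun z hz => ?_) hK ?_
    · refine norm_cutoffField_le χ c (abs_nonneg C) (fun i => ?_) (fun i => ?_) (hball z hz).2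
      · exact ((hC i _ (hball z hz).1).1).trans (le_abs_self C)
      · exact ((hC i _ (hball z hz).1).2).trans (le_abs_self C)
    · have h1 : max (T - 0) (0 - 0) = T := by rw [sub_zero, sub_zero, max_eq_left hT.le]
      have h2 : ((A / 2 : ℝ≥0) : ℝ) = a / 2 := by rw [NNReal.coe_div]; rfl
      have h3 : (A : ℝ) = a := rfl
      simp only [h1, h2, h3]
      have : (L : ℝ) * T ≤ a / 2 := by
        simp only [T]
        rw [mul_div_assoc', div_le_iff₀ hL1]
        nlinarith
      linarith
  obtain ⟨α, hα, L', hL'⟩ := exists_flow_mem_closedBall hPL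
  have hstart : ∀ p : E →L[ℝ] ℝ, ‖p‖ ≤ R → (x₀, c⁻¹ • p) ∈ closedBall z₀ ((A / 2 : ℝ≥0) : ℝ) := by
    intro p hp
    have h2 : ((A / 2 : ℝ≥0) : ℝ) = a / 2 := by rw [NNReal.coe_div]; rfl
    rw [h2, mem_closedBall, Prod.dist_eq, max_le_iff]
    refine ⟨by simpa [z₀] using (half_pos ha).le, ?_⟩
    rw [dist_zero_right, norm_smul, norm_inv, Real.norm_of_nonneg hc.le, inv_mul_le_iff₀ hc]
    simp only [c]
    field_simp
    exact hp
  let σ : E × (E →L[ℝ] ℝ) → E × (E →L[ℝ] ℝ) := fun w => (w.1, c • w.2)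
  let Γ : (E →L[ℝ] ℝ) → ℝ → E × (E →L[ℝ] ℝ) := fun p t => σ (α (x₀, c⁻¹ • p) t)
  refine ⟨Γ, fun p hp hp1 => ?_, fun t ht => ?_⟩
  · obtain ⟨h0, h1⟩ := hα _ (hstart p hp)
    have hΓ0 : Γ p 0 = (x₀, p) := by
      have h0' : α (x₀, c⁻¹ • p) 0 = (x₀, c⁻¹ • p) := h0
      simp only [Γ, σ, h0', smul_inv_smul₀ hc.ne']
    have hd : ∀ t ∈ Icc 0 T, HasDerivWithinAt (Γ p)
        (∑ i, (χ (speed F (Γ p t)) * (Γ p t).2 (F i (Γ p t).1)) • F i (Γ p t).1,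
        -∑ i, (χ (speed F (Γ p t)) * (Γ p t).2 (F i (Γ p t).1)) •
          (Γ p t).2.comp (fderiv ℝ (F i) (Γ p t).1)) (Icc 0 T) t := by
      intro t ht
      have h2 := (h1 t ht).1
      have h3 : HasDerivWithinAt (fun s => (α (x₀, c⁻¹ • p) s).1) _ (Icc 0 T) t := h2.fst
      have h4 : HasDerivWithinAt (fun s => (α (x₀, c⁻¹ • p) s).2) _ (Icc 0 T) t := h2.snd
      have h5 : HasDerivWithinAt (Γ p) _ (Icc 0 T) t := h3.prodMk (h4.const_smul c)
      refine h5.congr_deriv ?_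
      have hs : speed F (Γ p t) = c • speed F (α (x₀, c⁻¹ • p) t) := by
        ext i; simp [Γ, σ]
      rw [hs]
      simp only [cutoffField, Γ, σ, smul_neg, Finset.smul_sum, smul_smul, smul_apply, smul_eq_mul,
        ContinuousLinearMap.smul_comp, Prod.mk.injEq, neg_inj, true_and]
      refine Finset.sum_congr rfl fun i _ => ?_
      congr 1
      ring
    have hmem : ∀ t ∈ Icc 0 T, (Γ p t).1 ∈ closedBall x₀ a ∧ ‖(Γ p t).2‖ ≤ 2 * R := by
      intro t ht
      have h2 := hball _ (h1 t ht).2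
      refine ⟨h2.1, ?_⟩
      simp only [Γ, σ]
      rw [norm_smul, Real.norm_of_nonneg hc.le]
      calc c * ‖(α (x₀, c⁻¹ • p) t).2‖ ≤ c * a := by gcongr; exact h2.2
        _ = 2 * R := by simp only [c]; field_simp
    have hsum : ∀ t ∈ Icc 0 T, ∑ i, (Γ p t).2 (F i (Γ p t).1) ^ 2 = 1 := by
      intro t ht
      rw [sum_sq_speed_eq (f := fun t => χ (speed F (Γ p t))) (fun s hs i =>
        ((hF i).contDiffAt (hO.mem_nhds (haO (hmem s hs).1))).differentiableAt (by simp)) hd ht,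
        hΓ0]
      exact hp1
    refine ⟨hΓ0, fun t ht => ⟨?_, (hmem t ht).1, (hmem t ht).2, hsum t ht⟩⟩
    have hχ : χ (speed F (Γ p t)) = 1 := by
      refine χ.one_of_mem_closedBall ?_
      have : ‖speed F (Γ p t)‖ = 1 := by
        rw [EuclideanSpace.norm_eq, Real.sqrt_eq_one]
        simpa using hsum t ht
      simp [this, χ]
    refine (hd t ht).congr_deriv ?_
    simp only [hχ, one_mul]
    rfl
  · have h1 : ContinuousOn (fun p : E →L[ℝ] ℝ => α (x₀, c⁻¹ • p) t)
        {p | ‖p‖ ≤ R ∧ ∑ i, p (F i x₀) ^ 2 = 1} :=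
      (hL' t ht).continuousOn.comp (f := fun p : E →L[ℝ] ℝ => (x₀, c⁻¹ • p)) (by fun_prop)
        (fun p hp => hstart p hp.1)
    exact h1.fst.prodMk (h1.snd.const_smul c)

end HamiltonFlow

/-! ### Invariance of Hamilton's equations under changes of coordinates -/

section ChartChange

variable {k : ℕ} {E : Type*} [NormedAddCommGroup E] [NormedSpace ℝ E]

/-- Hamilton's equations are invariant under the canonical transformation induced by a change of
coordinates `ψ` with inverse `ψ'`. -/
theorem hasDerivWithinAt_hamField_transform {F F' : Fin k → E → E} {ψ ψ' : E → E}
    {z : ℝ → E × (E →L[ℝ] ℝ)} {I : Set ℝ} {s : ℝ}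
    (hz : HasDerivWithinAt z (hamField F (z s)) I s)
    (hψ : DifferentiableAt ℝ ψ (z s).1) (hψ' : ContDiffAt ℝ ∞ ψ' (ψ (z s).1))
    (hinv : ψ' (ψ (z s).1) = (z s).1)
    (hF : ∀ i, DifferentiableAt ℝ (F i) (z s).1)
    (hF' : ∀ i, DifferentiableAt ℝ (F' i) (ψ (z s).1))
    (hrel : ∀ i, ∀ᶠ w in 𝓝 (ψ (z s).1), F i (ψ' w) = fderiv ℝ ψ' w (F' i w))
    (hrel' : ∀ i, fderiv ℝ ψ (z s).1 (F i (z s).1) = F' i (ψ (z s).1)) :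
    HasDerivWithinAt (fun t => (ψ (z t).1, (z t).2.comp (fderiv ℝ ψ' (ψ (z t).1))))
      (hamField F' (ψ (z s).1, (z s).2.comp (fderiv ℝ ψ' (ψ (z s).1)))) I s := by
  have h1 : HasDerivWithinAt (fun t => (z t).1) _ I s := hz.fst
  have h2 : HasDerivWithinAt (fun t => (z t).2) _ I s := hz.snd
  have hu : ∀ i, (z s).2 (fderiv ℝ ψ' (ψ (z s).1) (F' i (ψ (z s).1))) = (z s).2 (F i (z s).1) := by
    intro i
    rw [← (hrel i).self_of_nhds, hinv]
  have h3 : HasDerivWithinAt (fun t => ψ (z t).1)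
      (∑ i, (z s).2 (F i (z s).1) • F' i (ψ (z s).1)) I s := by
    refine (hψ.hasFDerivAt.comp_hasDerivWithinAt s h1).congr_deriv ?_
    simp [hamField, hrel']
  have hD : DifferentiableAt ℝ (fderiv ℝ ψ') (ψ (z s).1) :=
    (hψ'.fderiv_right (m := 1) (WithTop.coe_le_coe.2 (le_top : (1 + 1 : ℕ∞) ≤ ⊤))).differentiableAt
      (by simp)
  have h4 : HasDerivWithinAt (fun t => fderiv ℝ ψ' (ψ (z t).1)) _ I s :=
    hD.hasFDerivAt.comp_hasDerivWithinAt s h3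
  -- The derivative of the transformed momentum contains D²ψ' along the velocity ∑ u_i F'_i, while
  -- differentiating F_i ∘ ψ' = Dψ'(F'_i) gives D²ψ'(w, F'_i). They cancel by symmetry of the second
  -- derivative.
  have hsymm : ∀ v w, fderiv ℝ (fderiv ℝ ψ') (ψ (z s).1) v w =
      fderiv ℝ (fderiv ℝ ψ') (ψ (z s).1) w v := fun v w =>
    (hψ'.isSymmSndFDerivAt (by
      rw [minSmoothness_of_isRCLikeNormedField]
      exact WithTop.coe_le_coe.2 (le_top : (2 : ℕ∞) ≤ ⊤))).eq v w
  have hdF : ∀ i w, fderiv ℝ (F i) (z s).1 (fderiv ℝ ψ' (ψ (z s).1) w) =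
      fderiv ℝ (fderiv ℝ ψ') (ψ (z s).1) w (F' i (ψ (z s).1)) +
        fderiv ℝ ψ' (ψ (z s).1) (fderiv ℝ (F' i) (ψ (z s).1) w) := by
    intro i w
    have e1 : HasFDerivAt (fun w => F i (ψ' w))
        ((fderiv ℝ (F i) (z s).1).comp (fderiv ℝ ψ' (ψ (z s).1))) (ψ (z s).1) := by
      have := (hF i).hasFDerivAt
      rw [← hinv] at this
      have h := this.comp _ (hψ'.differentiableAt (by simp)).hasFDerivAt
      rw [hinv] at h
      exact h
    have e2 := hD.hasFDerivAt.clm_apply (hF' i).hasFDerivAt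
    have e3 := e1.unique (e2.congr_of_eventuallyEq (hrel i))
    have e4 := congrArg (fun A => A w) e3
    simp only [ContinuousLinearMap.comp_apply, add_apply, ContinuousLinearMap.flip_apply] at e4
    rw [e4, add_comm]
  have h5 := h3.prodMk (h2.clm_comp h4)
  refine h5.congr_deriv ?_
  simp only [hamField, Prod.mk.injEq]
  refine ⟨?_, ?_⟩
  · refine Finset.sum_congr rfl fun i _ => ?_
    rw [ContinuousLinearMap.comp_apply, hu]
  · ext w
    simp only [add_apply, ContinuousLinearMap.comp_apply, neg_apply, sum_apply, smul_apply,
      smul_eq_mul, hdF, hu]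
    simp only [map_sum, sum_apply, map_smul, smul_apply, smul_eq_mul, map_add, mul_add,
      Finset.sum_add_distrib, hsymm _ w]
    ring

end ChartChange

/-! ### Hamiltonian curves in a chart and a smooth frame -/

section HamiltonianCurves

open Metric

variable {n k : ℕ} {M : Type*} [TopologicalSpace M] [ChartedSpace (Eucl n) M]
  [IsManifold (𝓡 n) ∞ M]

namespace Structure

variable {S : Structure n k M}

/-- The canonical coordinates of a covector in the preferred chart at `c`. -/
def coords (c : M) (z : Cotangent n M) : Eucl n × (Eucl n →L[ℝ] ℝ) := (position c z, momentum c z)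

/-- The frame `X` in the coordinates of the preferred chart at `c`. -/
def frameRep (c : M) (X : Fin k → ∀ x : M, S.D x) (i : Fin k) : Eucl n → Eucl n :=
  fieldRep c fun x => (X i x : TSpace n x)

theorem IsOrthoFrame.contDiffOn_frameRep {U : Set M} {X : Fin k → ∀ x : M, S.D x}
    (hX : S.IsOrthoFrame U X) (c : M) (i : Fin k) :
    ContDiffOn ℝ ∞ (frameRep c X i)
      ((extChartAt (𝓡 n) c).target ∩ (extChartAt (𝓡 n) c).symm ⁻¹' U) :=
  contDiffOn_fieldRep c hX.isOpen (hX.smooth i)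

theorem IsOrthoFrame.contDiffAt_frameRep {U : Set M} {X : Fin k → ∀ x : M, S.D x}
    (hX : S.IsOrthoFrame U X) {c p : M} (hp : p ∈ U) (hc : p ∈ (extChartAt (𝓡 n) c).source)
    (i : Fin k) : ContDiffAt ℝ ∞ (frameRep c X i) (extChartAt (𝓡 n) c p) :=
  contDiffAt_fieldRep hX.isOpen (hX.smooth i) hp hc

theorem localHamiltonian_eq {U : Set M} {X : Fin k → ∀ x : M, S.D x} (hX : S.IsOrthoFrame U X)
    (c : M) {x : Eucl n} (hx : (extChartAt (𝓡 n) c).symm x ∈ U) (p : Eucl n →L[ℝ] ℝ) :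
    S.localHamiltonian c x p = (1 / 2) * ∑ i, p (frameRep c X i x) ^ 2 :=
  hamiltonian_eq_of_orth (hX.orth _ hx) _

/-- In a smooth frame the Hamiltonian is ½ ∑ p(F_i(x))², so its partial derivatives can be computed.
The velocity `v` is unique because covectors separate points. -/
theorem hasDerivWithinAt_coords_iff {U : Set M} {X : Fin k → ∀ x : M, S.D x}
    (hX : S.IsOrthoFrame U X) {z : ℝ → Cotangent n M} {I : Set ℝ} {s : ℝ} (hs : (z s).proj ∈ U) :
    (∃ v : Eucl n,
      HasDerivWithinAt (fun t => position (z s).proj (z t)) v I s ∧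
      (∀ β : Eucl n →L[ℝ] ℝ,
        fderiv ℝ (fun p => S.localHamiltonian (z s).proj (position (z s).proj (z s)) p)
          (momentum (z s).proj (z s)) β = β v) ∧
      HasDerivWithinAt (fun t => momentum (z s).proj (z t))
        (-(fderiv ℝ (fun x => S.localHamiltonian (z s).proj x (momentum (z s).proj (z s)))
          (position (z s).proj (z s)))) I s) ↔
      HasDerivWithinAt (fun t => coords (z s).proj (z t))
        (hamField (frameRep (z s).proj X) (coords (z s).proj (z s))) I s := by
  set c := (z s).proj with hc
  set x := position c (z s) with hx
  set p := momentum c (z s) with hp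
  have hxc : x = extChartAt (𝓡 n) c c := rfl
  have hxU : (extChartAt (𝓡 n) c).symm x ∈ U := by
    have : (extChartAt (𝓡 n) c).symm x = c := (extChartAt (𝓡 n) c).left_inv (mem_extChartAt_source c)
    rw [this]; exact hs
  have hF : ∀ i, DifferentiableAt ℝ (frameRep c X i) x := fun i =>
    (hX.contDiffAt_frameRep hs (mem_extChartAt_source c) i).differentiableAt (by simp)
  have h1 : ∀ β : Eucl n →L[ℝ] ℝ, fderiv ℝ (fun p => S.localHamiltonian c x p) p β =
      β (∑ i, p (frameRep c X i x) • frameRep c X i x) := by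
    intro β
    have e : (fun p => S.localHamiltonian c x p) =
        fun p => (1 / 2) * ∑ i, p (frameRep c X i x) ^ 2 :=
      funext fun p => localHamiltonian_eq hX c hxU p
    have e2 : HasFDerivAt (fun p : Eucl n →L[ℝ] ℝ => (1 / 2) * ∑ i, p (frameRep c X i x) ^ 2) _ p :=
      (HasFDerivAt.fun_sum (u := Finset.univ) fun i _ =>
        ((ContinuousLinearMap.apply ℝ ℝ (frameRep c X i x)).hasFDerivAt (x := p)).pow 2).const_mul
        (1 / 2)
    rw [e, e2.fderiv]
    simp only [smul_apply, sum_apply, smul_eq_mul, Finset.mul_sum, map_sum, map_smul,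
      ContinuousLinearMap.apply_apply]
    refine Finset.sum_congr rfl fun i _ => ?_
    simp
    ring
  have h2 : fderiv ℝ (fun x => S.localHamiltonian c x p) x =
      ∑ i, p (frameRep c X i x) • p.comp (fderiv ℝ (frameRep c X i) x) := by
    have e : (fun x => S.localHamiltonian c x p) =ᶠ[𝓝 x]
        fun x => (1 / 2) * ∑ i, p (frameRep c X i x) ^ 2 := by
      have : (extChartAt (𝓡 n) c).target ∩ (extChartAt (𝓡 n) c).symm ⁻¹' U ∈ 𝓝 x :=
        (isOpen_chart_inter c hX.isOpen).mem_nhds ⟨mem_extChartAt_target c, hxU⟩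
      filter_upwards [this] with y hy using localHamiltonian_eq hX c hy.2 p
    have e2 : HasFDerivAt (fun x => (1 / 2) * ∑ i, p (frameRep c X i x) ^ 2) _ x :=
      (HasFDerivAt.fun_sum (u := Finset.univ) fun i _ =>
        (p.hasFDerivAt.comp x (hF i).hasFDerivAt).pow 2).const_mul (1 / 2)
    rw [e.fderiv_eq, e2.fderiv]
    ext w
    simp only [smul_apply, sum_apply, smul_eq_mul, Finset.mul_sum, ContinuousLinearMap.comp_apply]
    refine Finset.sum_congr rfl fun i _ => ?_
    simp
    ring
  constructor
  · rintro ⟨v, hv1, hv2, hv3⟩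
    have hv : v = ∑ i, p (frameRep c X i x) • frameRep c X i x := by
      refine (SeparatingDual.eq_iff_forall_dual_eq (R := ℝ)).2 fun β => ?_
      rw [← h1 β, hv2 β]
    subst hv
    rw [h2] at hv3
    exact hv1.prodMk hv3
  · intro h
    have h3 : HasDerivWithinAt (fun t => position c (z t)) _ I s := h.fst
    have h4 : HasDerivWithinAt (fun t => momentum c (z t)) _ I s := h.snd
    refine ⟨_, h3, h1, ?_⟩
    rw [h2]
    exact h4

/-- `IsHamiltonianCurve` uses at each time the chart at the current point, whereas the flow lives in
one fixed chart. Transition maps carry one form to the other; continuity of the base curve keeps it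
in both chart domains near `s`. -/
theorem hasDerivWithinAt_coords_change {U : Set M} {X : Fin k → ∀ x : M, S.D x}
    (hX : S.IsOrthoFrame U X) {z : ℝ → Cotangent n M} {I : Set ℝ} {s : ℝ} {c d : M}
    (hs : (z s).proj ∈ U) (hsc : (z s).proj ∈ (extChartAt (𝓡 n) c).source)
    (hsd : (z s).proj ∈ (extChartAt (𝓡 n) d).source) (hsI : s ∈ I)
    (hcont : ContinuousWithinAt (fun t => (z t).proj) I s)
    (hz : HasDerivWithinAt (fun t => coords c (z t)) (hamField (frameRep c X) (coords c (z s))) I s) :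
    HasDerivWithinAt (fun t => coords d (z t)) (hamField (frameRep d X) (coords d (z s))) I s := by
  set W : Set M := (extChartAt (𝓡 n) c).source ∩ (extChartAt (𝓡 n) d).source with hW
  have hWo : IsOpen W := (isOpen_extChartAt_source c).inter (isOpen_extChartAt_source d)
  have hpos : ∀ {w : Cotangent n M}, w.proj ∈ W →
      transition n c d (position c w) = position d w := by
    intro w hw
    simp only [transition, position, Function.comp]
    rw [(extChartAt (𝓡 n) c).left_inv hw.1]
  have hpos' : transition n d c (position d (z s)) = position c (z s) := by
    simp only [transition, position, Function.comp]
    rw [(extChartAt (𝓡 n) d).left_inv hsd]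
  have hmom : ∀ {w : Cotangent n M}, w.proj ∈ W →
      (momentum c w).comp (fderiv ℝ (transition n d c) (position d w)) = momentum d w := by
    intro w hw
    ext v
    have h1 := dChart_eq_fderiv_transition hw.2 hw.1 (dChartInv d w.proj v)
    rw [dChart_dChartInv hw.2] at h1
    change w.snd (dChartInv c w.proj (fderiv ℝ (transition n d c) (extChartAt (𝓡 n) d w.proj) v)) =
      w.snd (dChartInv d w.proj v)
    rw [← h1, dChartInv_dChart hw.1]
  have hev : (fun t => coords d (z t)) =ᶠ[𝓝[I] s]
      fun t => (transition n c d (coords c (z t)).1,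
        (coords c (z t)).2.comp (fderiv ℝ (transition n d c)
          (transition n c d (coords c (z t)).1))) := by
    filter_upwards [hcont.preimage_mem_nhdsWithin (hWo.mem_nhds ⟨hsc, hsd⟩)] with t ht
    simp only [coords]
    rw [hpos ht, hmom ht]
  have hs0 : coords d (z s) = (transition n c d (coords c (z s)).1,
        (coords c (z s)).2.comp (fderiv ℝ (transition n d c)
          (transition n c d (coords c (z s)).1))) := hev.self_of_nhdsWithin hsI
  have hx : transition n c d (coords c (z s)).1 = extChartAt (𝓡 n) d (z s).proj :=
    hpos ⟨hsc, hsd⟩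
  have hxc : (coords c (z s)).1 = extChartAt (𝓡 n) c (z s).proj := rfl
  refine HasDerivWithinAt.congr_of_eventuallyEq ?_ hev hs0
  rw [hs0]
  refine hasDerivWithinAt_hamField_transform (ψ := transition n c d) (ψ' := transition n d c)
    (z := fun t => coords c (z t)) hz ?_ ?_ ?_ ?_ ?_ ?_ ?_
  · exact (contDiffAt_transition hsc hsd).differentiableAt (by simp)
  · rw [hx]
    exact contDiffAt_transition hsd hsc
  · rw [hx]
    exact hpos'
  · intro i
    exact (hX.contDiffAt_frameRep hs hsc i).differentiableAt (by simp)
  · intro i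
    rw [hx]
    exact (hX.contDiffAt_frameRep hs hsd i).differentiableAt (by simp)
  · intro i
    rw [hx]
    have : (extChartAt (𝓡 n) d).target ∩ (extChartAt (𝓡 n) d).symm ⁻¹' W ∈
        𝓝 (extChartAt (𝓡 n) d (z s).proj) :=
      (isOpen_chart_inter d hWo).mem_nhds ⟨(extChartAt (𝓡 n) d).map_source hsd, by
        rw [mem_preimage, (extChartAt (𝓡 n) d).left_inv hsd]; exact ⟨hsc, hsd⟩⟩
    filter_upwards [this] with y hy
    have h1 := dChart_eq_fderiv_transition hy.2.2 hy.2.1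
      (X i ((extChartAt (𝓡 n) d).symm y) : TSpace n ((extChartAt (𝓡 n) d).symm y))
    rw [(extChartAt (𝓡 n) d).right_inv hy.1] at h1
    refine Eq.trans ?_ h1
    exact fieldRep_extChartAt hy.2.1 _
  · intro i
    rw [hx, hxc]
    have h1 := dChart_eq_fderiv_transition hsc hsd (X i (z s).proj : TSpace n (z s).proj)
    simp only [frameRep]
    rw [fieldRep_extChartAt hsc, fieldRep_extChartAt hsd, h1]

end Structure

end HamiltonianCurves

/-! ### The exponential map and uniqueness of Hamiltonian curves -/

section ExponentialMap

open Metric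
open scoped NNReal

variable {n k : ℕ} {M : Type*} [TopologicalSpace M] [ChartedSpace (Eucl n) M]
  [IsManifold (𝓡 n) ∞ M]

namespace Structure

variable {S : Structure n k M}

/-- A Hamiltonian curve solves Hamilton's equations in any chart around each of its points. -/
theorem IsHamiltonianCurve.hasDerivWithinAt_coords {U : Set M} {X : Fin k → ∀ x : M, S.D x}
    (hX : S.IsOrthoFrame U X) {z : ℝ → Cotangent n M} {T : ℝ} (hz : S.IsHamiltonianCurve z T)
    {s : ℝ} (hsT : s ∈ Icc 0 T) {c : M} (hs : (z s).proj ∈ U)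
    (hc : (z s).proj ∈ (extChartAt (𝓡 n) c).source) :
    HasDerivWithinAt (fun t => coords c (z t)) (hamField (frameRep c X) (coords c (z s)))
      (Icc 0 T) s :=
  hasDerivWithinAt_coords_change hX hs (mem_extChartAt_source _) hc hsT (hz.1 s hsT)
    ((hasDerivWithinAt_coords_iff hX hs).1 (hz.2 s hsT))

variable [T2Space M]

/-- A Hamiltonian curve follows the solution of Hamilton's equations in a chart with the same
initial value, as long as the latter is defined. -/
theorem IsHamiltonianCurve.eq_of_hamField {U : Set M} {X : Fin k → ∀ x : M, S.D x}
    (hX : S.IsOrthoFrame U X) {q : M} {z : ℝ → Cotangent n M} {T : ℝ}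
    (hz : S.IsHamiltonianCurve z T)
    {ζ : ℝ → Eucl n × (Eucl n →L[ℝ] ℝ)}
    (hζ : ∀ t ∈ Icc 0 T, HasDerivWithinAt ζ (hamField (frameRep q X) (ζ t)) (Icc 0 T) t)
    (hζU : ∀ t ∈ Icc 0 T,
      (ζ t).1 ∈ (extChartAt (𝓡 n) q).target ∩ (extChartAt (𝓡 n) q).symm ⁻¹' U)
    (h0 : (z 0).proj = q) (h0' : coords q (z 0) = ζ 0) {t : ℝ} (ht : t ∈ Icc 0 T) :
    (z t).proj = (extChartAt (𝓡 n) q).symm (ζ t).1 := by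
  set e := extChartAt (𝓡 n) q with he
  set W : Set M := U ∩ e.source with hW
  have hWo : IsOpen W := hX.isOpen.inter (isOpen_extChartAt_source q)
  have hζW : ∀ s ∈ Icc 0 T, e.symm (ζ s).1 ∈ W := fun s hs =>
    ⟨(hζU s hs).2, e.map_target (hζU s hs).1⟩
  have hζc : ContinuousOn ζ (Icc 0 T) := fun s hs => (hζ s hs).continuousWithinAt
  have hbase : ContinuousOn (fun s => e.symm (ζ s).1) (Icc 0 T) :=
    (continuousOn_extChartAt_symm q).comp hζc.fst fun s hs => (hζU s hs).1
  -- Continuity argument: `A` is closed in the interval because limits are unique in a Hausdorff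
  -- space, and it extends to the right by local uniqueness for a Lipschitz field. Base points are
  -- recorded along with coordinates since the coordinates determine the covector only over the
  -- chart domain.
  let A : Set ℝ := {s | (z s).proj = e.symm (ζ s).1 ∧ coords q (z s) = ζ s}
  have hder : ∀ s ∈ Icc 0 T, (z s).proj ∈ W → HasDerivWithinAt (fun t => coords q (z t))
      (hamField (frameRep q X) (coords q (z s))) (Icc 0 T) s := fun s hs hsW =>
    hz.hasDerivWithinAt_coords hX hs hsW.1 hsW.2
  have hclosed : IsClosed (A ∩ Icc 0 T) := by
    refine isClosed_of_closure_subset fun s hs => ?_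
    have hsI : s ∈ Icc 0 T := by
      have := closure_mono (inter_subset_right (s := A) (t := Icc 0 T)) hs
      rwa [isClosed_Icc.closure_eq] at this
    have hne : (𝓝[A ∩ Icc 0 T] s).NeBot := mem_closure_iff_nhdsWithin_neBot.1 hs
    have hle : 𝓝[A ∩ Icc 0 T] s ≤ 𝓝[Icc 0 T] s := nhdsWithin_mono _ inter_subset_right
    have hb : (z s).proj = e.symm (ζ s).1 := by
      refine tendsto_nhds_unique ((hz.1 s hsI).mono_left hle) ?_
      refine ((hbase s hsI).mono_left hle).congr' ?_
      filter_upwards [self_mem_nhdsWithin] with r hr using hr.1.1.symm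
    have hsW : (z s).proj ∈ W := by rw [hb]; exact hζW s hsI
    refine ⟨⟨hb, ?_⟩, hsI⟩
    refine tendsto_nhds_unique ((hder s hsI hsW).continuousWithinAt.mono_left hle) ?_
    refine ((hζc s hsI).mono_left hle).congr' ?_
    filter_upwards [self_mem_nhdsWithin] with r hr using hr.1.2.symm
  have hzero : (0 : ℝ) ∈ Icc 0 T := ⟨le_rfl, ht.1.trans ht.2⟩
  have hA0 : (0 : ℝ) ∈ A := by
    refine ⟨?_, h0'⟩
    rw [← h0']
    simp only [coords, position, h0]
    exact (e.left_inv (mem_extChartAt_source q)).symm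
  have hO := isOpen_chart_inter (n := n) q hX.isOpen
  have hsub : Icc 0 T ⊆ A := by
    refine hclosed.Icc_subset_of_forall_mem_nhdsWithin hA0 fun s hs => ?_
    obtain ⟨⟨hs1, hs2⟩, hs0, hsT⟩ := hs
    have hsI : s ∈ Icc 0 T := ⟨hs0, hsT.le⟩
    have hsW : (z s).proj ∈ W := by rw [hs1]; exact hζW s hsI
    obtain ⟨K, B, hB, hK⟩ := ((contDiffOn_hamField hO fun i =>
      hX.contDiffOn_frameRep q i).contDiffAt ((hO.prod isOpen_univ).mem_nhds
        (x := ζ s) ⟨hζU s hsI, mem_univ _⟩)).exists_lipschitzOnWith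
    have e1 : ∀ᶠ r in 𝓝[Icc 0 T] s, (z r).proj ∈ W :=
      (hz.1 s hsI).preimage_mem_nhdsWithin (hWo.mem_nhds hsW)
    have e2 : ∀ᶠ r in 𝓝[Icc 0 T] s, coords q (z r) ∈ B := by
      refine (hder s hsI hsW).continuousWithinAt.preimage_mem_nhdsWithin ?_
      rw [hs2]; exact hB
    have e3 : ∀ᶠ r in 𝓝[Icc 0 T] s, ζ r ∈ B := (hζc s hsI).preimage_mem_nhdsWithin hB
    have hge : 𝓝[≥] s ≤ 𝓝[Icc 0 T] s := nhdsWithin_le_of_mem (Icc_mem_nhdsGE_of_mem ⟨hs0, hsT⟩)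
    have e4 : ∀ᶠ r in 𝓝[≥] s, (z r).proj ∈ W ∧ coords q (z r) ∈ B ∧ ζ r ∈ B ∧ r < T :=
      Filter.Eventually.and (hge e1) (Filter.Eventually.and (hge e2)
        (Filter.Eventually.and (hge e3) (mem_nhdsWithin_of_mem_nhds (Iio_mem_nhds hsT))))
    obtain ⟨u, hsu, hu⟩ := mem_nhdsGE_iff_exists_Icc_subset.1 e4
    have hr : ∀ r ∈ Icc s u, r ∈ Icc 0 T := fun r hr => ⟨hs0.trans hr.1, (hu hr).2.2.2.le⟩
    have hIci : ∀ r ∈ Ico s u, Icc 0 T ∈ 𝓝[≥] r := fun r hr' =>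
      Icc_mem_nhdsGE_of_mem ⟨hs0.trans hr'.1, (hu ⟨hr'.1, hr'.2.le⟩).2.2.2⟩
    have heq : EqOn (fun r => coords q (z r)) ζ (Icc s u) := by
      refine ODE_solution_unique_of_mem_Icc_right (v := fun _ => hamField (frameRep q X))
        (s := fun _ => B) (K := K) (fun _ _ => hK) ?_ ?_ ?_ ?_ ?_ ?_ hs2
      · exact fun r hr' => ((hder r (hr r hr') (hu hr').1).continuousWithinAt).mono hr
      · exact fun r hr' => (hder r (hr r ⟨hr'.1, hr'.2.le⟩) (hu ⟨hr'.1, hr'.2.le⟩).1).mono_of_mem_nhdsWithin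
          (hIci r hr')
      · exact fun r hr' => (hu ⟨hr'.1, hr'.2.le⟩).2.1
      · exact hζc.mono hr
      · exact fun r hr' => (hζ r (hr r ⟨hr'.1, hr'.2.le⟩)).mono_of_mem_nhdsWithin (hIci r hr')
      · exact fun r hr' => (hu ⟨hr'.1, hr'.2.le⟩).2.2.1
    refine mem_of_superset (Ioc_mem_nhdsGT hsu) fun r hr' => ?_
    have hr'' : r ∈ Icc s u := ⟨hr'.1.le, hr'.2⟩
    have h1 : coords q (z r) = ζ r := heq hr''
    refine ⟨?_, h1⟩
    rw [← h1]
    exact (e.left_inv (hu hr'').1.2).symm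
  exact (hsub ht).1

/-- The exponential map is read off from Hamilton's equations in a chart. -/
theorem expMap_eq_of_hamField {U : Set M} {X : Fin k → ∀ x : M, S.D x}
    (hX : S.IsOrthoFrame U X) {q : M} {T : ℝ} {ζ : ℝ → Eucl n × (Eucl n →L[ℝ] ℝ)}
    (hζ : ∀ t ∈ Icc 0 T, HasDerivWithinAt ζ (hamField (frameRep q X) (ζ t)) (Icc 0 T) t)
    (hζU : ∀ t ∈ Icc 0 T,
      (ζ t).1 ∈ (extChartAt (𝓡 n) q).target ∩ (extChartAt (𝓡 n) q).symm ⁻¹' U)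
    {α : CSpace n q} (h0 : ζ 0 = (extChartAt (𝓡 n) q q, α)) {t : ℝ} (ht : t ∈ Icc 0 T) :
    S.expMap q t α = (extChartAt (𝓡 n) q).symm (ζ t).1 := by
  classical
  set e := extChartAt (𝓡 n) q with he
  have hmono : Icc 0 t ⊆ Icc 0 T := Icc_subset_Icc_right ht.2
  have hα : coords q (⟨q, α⟩ : Cotangent n M) = (e q, α) := by
    refine Prod.ext rfl ?_
    ext v
    exact congrArg α (dChartInv_self q v)
  have hex : ∃ z : ℝ → Cotangent n M, z 0 = ⟨q, α⟩ ∧ S.IsHamiltonianCurve z t := by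
    let w : ℝ → Cotangent n M := fun s =>
      ⟨e.symm (ζ s).1, (ζ s).2.comp (dChart q (e.symm (ζ s).1))⟩
    -- At time 0 the base point of `w` equals `q` only after inverting the chart. Overriding this
    -- single value gives z 0 = ⟨q, α⟩ on the nose and leaves the coordinates unchanged.
    let z : ℝ → Cotangent n M := fun s => if s = 0 then ⟨q, α⟩ else w s
    have hz0 : z 0 = ⟨q, α⟩ := if_pos rfl
    have hproj : ∀ s, (z s).proj = e.symm (ζ s).1 := by
      intro s
      by_cases hs : s = 0
      · subst hs
        rw [hz0, h0]
        exact (e.left_inv (mem_extChartAt_source q)).symm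
      · simp only [z, if_neg hs]
        rfl
    have hw : ∀ s ∈ Icc 0 T, coords q (w s) = ζ s := by
      intro s hs
      refine Prod.ext (e.right_inv (hζU s hs).1) ?_
      ext v
      change (ζ s).2 (dChart q (e.symm (ζ s).1) (dChartInv q (e.symm (ζ s).1) v)) = _
      rw [dChart_dChartInv (e.map_target (hζU s hs).1)]
    have hzc : ∀ s ∈ Icc 0 T, coords q (z s) = ζ s := by
      intro s hs
      by_cases hs0 : s = 0
      · subst hs0
        rw [hz0, h0, hα]
      · simp only [z, if_neg hs0]
        exact hw s hs
    have hcont : ContinuousOn (fun s => (z s).proj) (Icc 0 t) := by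
      simp only [hproj]
      exact (continuousOn_extChartAt_symm q).comp
        (ContinuousOn.fst fun s hs => ((hζ s (hmono hs)).continuousWithinAt).mono hmono)
        fun s hs => (hζU s (hmono hs)).1
    refine ⟨z, hz0, hcont, fun s hs => ?_⟩
    have hsU : (z s).proj ∈ U := by rw [hproj]; exact (hζU s (hmono hs)).2
    have hsq : (z s).proj ∈ e.source := by rw [hproj]; exact e.map_target (hζU s (hmono hs)).1
    refine (hasDerivWithinAt_coords_iff hX hsU).2 ?_
    refine hasDerivWithinAt_coords_change hX hsU hsq (mem_extChartAt_source _) hs (hcont s hs) ?_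
    rw [hzc s (hmono hs)]
    exact ((hζ s (hmono hs)).mono hmono).congr (fun r hr => hzc r (hmono hr)) (hzc s (hmono hs))
  -- The curve chosen by `expMap` need not be the one just built; uniqueness shows that it has the
  -- same base points.
  rw [expMap, dif_pos hex]
  have hc := hex.choose_spec
  refine IsHamiltonianCurve.eq_of_hamField hX hc.2
    (fun s hs => (hζ s (hmono hs)).mono hmono) (fun s hs => hζU s (hmono hs)) ?_ ?_ ⟨ht.1, le_rfl⟩
  · rw [hc.1]
  · rw [hc.1, h0, hα]

end Structure

end ExponentialMap

/-! ### Second-order Taylor estimates on an interval -/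

section Taylor

/-- The mean value inequality is applied to `g1`, then to g(s) - s g1(0). This loses a factor 2
against the sharp constant B/2, which is harmless for a dominating function. -/
theorem abs_taylor_sub_le {g g1 g2 : ℝ → ℝ} {T B : ℝ}
    (hg : ∀ t ∈ Icc 0 T, HasDerivWithinAt g (g1 t) (Icc 0 T) t)
    (hg1 : ∀ t ∈ Icc 0 T, HasDerivWithinAt g1 (g2 t) (Icc 0 T) t)
    (hB : ∀ t ∈ Icc 0 T, |g2 t| ≤ B) {t : ℝ} (ht : t ∈ Icc 0 T) :
    |g t - g 0 - t * g1 0| ≤ B * t ^ 2 := by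
  have h0 : (0 : ℝ) ∈ Icc 0 T := ⟨le_rfl, ht.1.trans ht.2⟩
  have hB0 : 0 ≤ B := (abs_nonneg _).trans (hB 0 h0)
  have hsub : Icc 0 t ⊆ Icc 0 T := Icc_subset_Icc_right ht.2
  have h1 : ∀ s ∈ Icc 0 T, |g1 s - g1 0| ≤ B * s := by
    intro s hs
    have := (convex_Icc 0 T).norm_image_sub_le_of_norm_hasDerivWithin_le hg1 hB h0 hs
    simpa [abs_of_nonneg hs.1] using this
  have h2 := (convex_Icc 0 t).norm_image_sub_le_of_norm_hasDerivWithin_le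
    (f := fun s => g s - s * g1 0) (f' := fun s => g1 s - g1 0) (C := B * t)
    (fun s hs => by
      have := ((hg s (hsub hs)).mono hsub).sub
        ((hasDerivWithinAt_id s (Icc 0 t)).mul_const (g1 0))
      exact this.congr_deriv (by rw [one_mul]))
    (fun s hs => (h1 s (hsub hs)).trans (by gcongr; exact hs.2))
    (left_mem_Icc.2 ht.1) (right_mem_Icc.2 ht.1)
  simp only [zero_mul, sub_zero, Real.norm_eq_abs, abs_of_nonneg ht.1] at h2
  calc |g t - g 0 - t * g1 0| = |g t - t * g1 0 - g 0| := by ring_nf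
    _ ≤ B * t * t := h2
    _ = B * t ^ 2 := by ring

/-- After subtraction of the quadratic polynomial the derivative is o(s), so the mean value
inequality gives o(t²). Differentiability of `g1` at 0 suffices, with no continuity of a second
derivative. -/
theorem tendsto_taylor {g g1 : ℝ → ℝ} {T c : ℝ} (hT : 0 < T)
    (hg : ∀ t ∈ Icc 0 T, HasDerivWithinAt g (g1 t) (Icc 0 T) t)
    (hg1 : HasDerivWithinAt g1 c (Icc 0 T) 0) :
    Tendsto (fun t => (g t - g 0 - t * g1 0) / t ^ 2) (𝓝[>] 0) (𝓝 (c / 2)) := by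
  rw [Metric.tendsto_nhds]
  intro ε hε
  have h1 := (hasDerivWithinAt_iff_isLittleO.1 hg1).def (half_pos hε)
  have hge : 𝓝[≥] (0 : ℝ) ≤ 𝓝[Icc 0 T] 0 :=
    nhdsWithin_le_of_mem (Icc_mem_nhdsGE_of_mem ⟨le_rfl, hT⟩)
  obtain ⟨u, hu0, hu⟩ := mem_nhdsGE_iff_exists_Icc_subset.1 (hge h1)
  have hpos : 0 < min u T := lt_min hu0 hT
  filter_upwards [Ioc_mem_nhdsGT hpos] with t ht
  have ht0 : 0 < t := ht.1
  have hsub : Icc 0 t ⊆ Icc 0 T := Icc_subset_Icc_right (ht.2.trans (min_le_right _ _))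
  have h2 := (convex_Icc 0 t).norm_image_sub_le_of_norm_hasDerivWithin_le
    (f := fun s => g s - s * g1 0 - s ^ 2 * (c / 2))
    (f' := fun s => g1 s - g1 0 - s * c) (C := ε / 2 * t)
    (fun s hs => by
      have := (((hg s (hsub hs)).mono hsub).sub
        ((hasDerivWithinAt_id s (Icc 0 t)).mul_const (g1 0))).sub
        (((hasDerivWithinAt_id s (Icc 0 t)).pow 2).mul_const (c / 2))
      refine this.congr_deriv ?_
      simp
      ring)
    (fun s hs => by
      have := hu ⟨hs.1, hs.2.trans (ht.2.trans (min_le_left _ _))⟩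
      simp only [mem_ofPred_eq, sub_zero, smul_eq_mul, Real.norm_eq_abs, abs_of_nonneg hs.1] at this
      exact this.trans (by gcongr; exact hs.2))
    (left_mem_Icc.2 ht0.le) (right_mem_Icc.2 ht0.le)
  simp only [zero_mul, sub_zero, Real.norm_eq_abs, abs_of_nonneg ht0.le, ne_eq, OfNat.ofNat_ne_zero,
    not_false_eq_true, zero_pow] at h2
  rw [Real.dist_eq]
  have h3 : (g t - g 0 - t * g1 0) / t ^ 2 - c / 2 =
      (g t - t * g1 0 - t ^ 2 * (c / 2) - g 0) / t ^ 2 := by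
    field_simp
    ring
  rw [h3, abs_div, abs_of_pos (by positivity : 0 < t ^ 2), div_lt_iff₀ (by positivity)]
  refine h2.trans_lt ?_
  nlinarith [mul_pos hε (mul_pos ht0 ht0)]

end Taylor

/-! ### Derivatives of a function along the Hamiltonian flow -/

section Expansion

open Metric

variable {k : ℕ} {E : Type*} [NormedAddCommGroup E] [NormedSpace ℝ E]

/-- The Lie bracket of two of the fields, at a point. -/
def bracketAt (F : Fin k → E → E) (x : E) (i j : Fin k) : E :=
  fderiv ℝ (F j) x (F i x) - fderiv ℝ (F i) x (F j x)

/-- The second derivative of a function along the solutions of Hamilton's equations; the `h i` are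
the derivatives of the function along the fields. -/
def secondDerivAlong (F : Fin k → E → E) (h : Fin k → E → ℝ) (z : E × (E →L[ℝ] ℝ)) : ℝ :=
  ∑ i, ∑ j, (z.2 (F j z.1) * z.2 (bracketAt F z.1 j i) * h i z.1 +
    z.2 (F i z.1) * z.2 (F j z.1) * fderiv ℝ (h i) z.1 (F j z.1))

theorem hasDerivWithinAt_along {F : Fin k → E → E} {f : E → ℝ} {z : ℝ → E × (E →L[ℝ] ℝ)}
    {I : Set ℝ} {t : ℝ} (hz : HasDerivWithinAt z (hamField F (z t)) I t)
    (hf : DifferentiableAt ℝ f (z t).1) :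
    HasDerivWithinAt (fun s => f (z s).1)
      (∑ i, (z t).2 (F i (z t).1) * fderiv ℝ f (z t).1 (F i (z t).1)) I t := by
  have h1 : HasDerivWithinAt (fun t => (z t).1) _ I t := hz.fst
  refine (hf.hasFDerivAt.comp_hasDerivWithinAt t h1).congr_deriv ?_
  simp [hamField]

theorem hasDerivWithinAt_along_second {F : Fin k → E → E} {h : Fin k → E → ℝ}
    {z : ℝ → E × (E →L[ℝ] ℝ)} {I : Set ℝ} {t : ℝ}
    (hz : HasDerivWithinAt z (hamField F (z t)) I t)
    (hF : ∀ i, DifferentiableAt ℝ (F i) (z t).1) (hh : ∀ i, DifferentiableAt ℝ (h i) (z t).1) :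
    HasDerivWithinAt (fun s => ∑ i, (z s).2 (F i (z s).1) * h i (z s).1)
      (secondDerivAlong F h (z t)) I t := by
  have h1 := HasDerivWithinAt.fun_sum (u := Finset.univ) fun i _ =>
    (hasDerivWithinAt_speed hF hz i).mul (hasDerivWithinAt_along hz (hh i))
  refine h1.congr_deriv ?_
  simp only [secondDerivAlong, bracketAt]
  refine Finset.sum_congr rfl fun i _ => ?_
  rw [Finset.sum_mul, Finset.mul_sum, ← Finset.sum_add_distrib]
  refine Finset.sum_congr rfl fun j _ => ?_
  rw [map_sub]
  ring

/-- With speeds bounded by 1, the momentum enters only through one factor p([F_j, F_i]); hence the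
growth is linear in ‖p‖. This is what makes the remainder integrable for a measure with finite
second moments. -/
theorem abs_secondDerivAlong_le {F : Fin k → E → E} {h : Fin k → E → ℝ} {z : E × (E →L[ℝ] ℝ)}
    {C : ℝ} (hC : 0 ≤ C) (h1 : ∀ i, ‖F i z.1‖ ≤ C) (h2 : ∀ i, ‖fderiv ℝ (F i) z.1‖ ≤ C)
    (h3 : ∀ i, |h i z.1| ≤ C) (h4 : ∀ i, ‖fderiv ℝ (h i) z.1‖ ≤ C)
    (hu : ∀ i, |z.2 (F i z.1)| ≤ 1) :
    |secondDerivAlong F h z| ≤ k * (k * (2 * C ^ 3 * ‖z.2‖ + C ^ 2)) := by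
  have hterm : ∀ i j, |z.2 (F j z.1) * z.2 (bracketAt F z.1 j i) * h i z.1 +
      z.2 (F i z.1) * z.2 (F j z.1) * fderiv ℝ (h i) z.1 (F j z.1)| ≤
        2 * C ^ 3 * ‖z.2‖ + C ^ 2 := by
    intro i j
    have hd : ∀ i j, ‖fderiv ℝ (F i) z.1 (F j z.1)‖ ≤ C * C := fun i j =>
      (ContinuousLinearMap.le_opNorm _ _).trans
        (mul_le_mul (h2 i) (h1 j) (norm_nonneg _) hC)
    have hb : |z.2 (bracketAt F z.1 j i)| ≤ ‖z.2‖ * (C * C + C * C) := by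
      refine (ContinuousLinearMap.le_opNorm z.2 _).trans ?_
      gcongr
      exact (norm_sub_le _ _).trans (add_le_add (hd _ _) (hd _ _))
    have hh : |fderiv ℝ (h i) z.1 (F j z.1)| ≤ C * C :=
      (ContinuousLinearMap.le_opNorm _ _).trans (mul_le_mul (h4 i) (h1 j) (norm_nonneg _) hC)
    refine (abs_add_le _ _).trans ?_
    rw [abs_mul, abs_mul, abs_mul, abs_mul]
    have e1 : |z.2 (F j z.1)| * |z.2 (bracketAt F z.1 j i)| * |h i z.1| ≤
        1 * (‖z.2‖ * (C * C + C * C)) * C := by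
      gcongr
      exacts [hu j, h3 i]
    have e2 : |z.2 (F i z.1)| * |z.2 (F j z.1)| * |fderiv ℝ (h i) z.1 (F j z.1)| ≤
        1 * 1 * (C * C) := by
      gcongr
      exacts [hu i, hu j]
    linarith
  refine (Finset.abs_sum_le_sum_abs _ _).trans ?_
  calc _ ≤ ∑ _i : Fin k, ((k : ℝ) * (2 * C ^ 3 * ‖z.2‖ + C ^ 2)) := by
        refine Finset.sum_le_sum fun i _ => (Finset.abs_sum_le_sum_abs _ _).trans ?_
        calc _ ≤ ∑ _j : Fin k, (2 * C ^ 3 * ‖z.2‖ + C ^ 2) :=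
              Finset.sum_le_sum fun j _ => hterm i j
          _ = _ := by rw [Finset.sum_const, Finset.card_univ, Fintype.card_fin, nsmul_eq_mul]
    _ = _ := by rw [Finset.sum_const, Finset.card_univ, Fintype.card_fin, nsmul_eq_mul]

theorem abs_le_one_of_sum_sq {u : Fin k → ℝ} (hu : ∑ i, u i ^ 2 = 1) (i : Fin k) : |u i| ≤ 1 := by
  rw [← sq_le_one_iff_abs_le_one, ← hu]
  exact Finset.single_le_sum (f := fun i => u i ^ 2) (fun _ _ => sq_nonneg _) (Finset.mem_univ i)

theorem exists_uniform_bound {ι : Type*} [Finite ι] {α β : Type*} [TopologicalSpace α]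
    [SeminormedAddCommGroup β] {K : Set α} (hK : IsCompact K) {f : ι → α → β}
    (hf : ∀ i, ContinuousOn (f i) K) : ∃ C, ∀ i, ∀ x ∈ K, ‖f i x‖ ≤ C := by
  choose C hC using fun i => hK.exists_bound_of_continuousOn (hf i)
  obtain ⟨B, hB⟩ := (finite_range C).bddAbove
  exact ⟨B, fun i x hx => (hC i x hx).trans (hB ⟨i, rfl⟩)⟩

end Expansion

/-! ### Expansion of the exponential map on the cylinder -/

section ExpExpansion

open Metric

variable {n k : ℕ} {M : Type*} [TopologicalSpace M] [ChartedSpace (Eucl n) M]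
  [IsManifold (𝓡 n) ∞ M] {S : Structure n k M}

/-- The derivatives of the function `φ` along the frame `X`, in the preferred chart at `c`. -/
def frameDeriv (c : M) (X : Fin k → ∀ x : M, S.D x) (φ : M → ℝ) (i : Fin k) (x : Eucl n) : ℝ :=
  fderiv ℝ (φ ∘ (extChartAt (𝓡 n) c).symm) x (Structure.frameRep c X i x)

theorem contDiffOn_comp_chart_symm {φ : M → ℝ} (hφ : ContMDiff (𝓡 n) 𝓘(ℝ, ℝ) ∞ φ) (c : M) :
    ContDiffOn ℝ ∞ (φ ∘ (extChartAt (𝓡 n) c).symm) (extChartAt (𝓡 n) c).target := by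
  rw [← contMDiffOn_iff_contDiffOn]
  exact hφ.comp_contMDiffOn (contMDiffOn_extChartAt_symm c)

namespace Structure

theorem IsOrthoFrame.contDiffOn_frameDeriv {U : Set M} {X : Fin k → ∀ x : M, S.D x}
    (hX : S.IsOrthoFrame U X) {φ : M → ℝ} (hφ : ContMDiff (𝓡 n) 𝓘(ℝ, ℝ) ∞ φ) (c : M) (i : Fin k) :
    ContDiffOn ℝ ∞ (frameDeriv c X φ i)
      ((extChartAt (𝓡 n) c).target ∩ (extChartAt (𝓡 n) c).symm ⁻¹' U) :=
  (((contDiffOn_comp_chart_symm hφ c).fderiv_of_isOpen (isOpen_extChartAt_target c)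
    (by simp)).mono inter_subset_left).clm_apply (hX.contDiffOn_frameRep c i)

variable [T2Space M]

/-- The second order expansion of the exponential map on the cylinder of covectors with `2H = 1`,
with a bound of the remainder that is linear in the covector. -/
theorem exists_expMap_expansion {U : Set M} {X : Fin k → ∀ x : M, S.D x} (hX : S.IsOrthoFrame U X)
    {q : M} (hq : q ∈ U) {φ : M → ℝ} (hφ : ContMDiff (𝓡 n) 𝓘(ℝ, ℝ) ∞ φ) :
    ∃ T > 0, ∃ C ≥ 0, (∀ t ∈ Icc 0 T, ContinuousOn
        (fun p : Eucl n →L[ℝ] ℝ => φ (S.expMap q t p))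
        {p | ∑ i, p (X i q : TSpace n q) ^ 2 = 1}) ∧
      ∀ p : Eucl n →L[ℝ] ℝ, ∑ i, p (X i q : TSpace n q) ^ 2 = 1 →
        (∀ t ∈ Icc 0 T, |φ (S.expMap q t p) - φ q -
          t * ∑ i, p (X i q : TSpace n q) * frameDeriv q X φ i (extChartAt (𝓡 n) q q)| ≤
            C * (1 + ‖p‖) * t ^ 2) ∧
        Tendsto (fun t => (φ (S.expMap q t p) - φ q -
          t * ∑ i, p (X i q : TSpace n q) * frameDeriv q X φ i (extChartAt (𝓡 n) q q)) / t ^ 2)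
          (𝓝[>] 0) (𝓝 (secondDerivAlong (frameRep q X) (frameDeriv q X φ)
            (extChartAt (𝓡 n) q q, p) / 2)) := by
  set e := extChartAt (𝓡 n) q with he
  set F := frameRep q X with hF
  set h := frameDeriv q X φ with hh
  set O := e.target ∩ e.symm ⁻¹' U with hO
  have hOo : IsOpen O := isOpen_chart_inter q hX.isOpen
  have hsymm0 : e.symm (e q) = q := e.left_inv (mem_extChartAt_source q)
  have hx₀ : e q ∈ O := ⟨mem_extChartAt_target q, by rw [mem_preimage, hsymm0]; exact hq⟩
  have hF0 : ∀ i, F i (e q) = (X i q : TSpace n q) := fun i => fieldRep_self q _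
  have hFs : ∀ i, ContDiffOn ℝ ∞ (F i) O := hX.contDiffOn_frameRep q
  have hhs : ∀ i, ContDiffOn ℝ ∞ (h i) O := hX.contDiffOn_frameDeriv hφ q
  have hfs := (contDiffOn_comp_chart_symm (n := n) hφ q).mono (inter_subset_left (t := e.symm ⁻¹' U))
  obtain ⟨T, hT, a, ha, haO, hflow⟩ := exists_hamilton_flow hOo hFs hx₀
  have hK := isCompact_closedBall (e q) a
  obtain ⟨C₁, hC₁⟩ := exists_uniform_bound hK fun i => (hFs i).continuousOn.mono haO
  obtain ⟨C₂, hC₂⟩ := exists_uniform_bound hK fun i =>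
    ((hFs i).continuousOn_fderiv_of_isOpen hOo (by simp)).mono haO
  obtain ⟨C₃, hC₃⟩ := exists_uniform_bound hK fun i => (hhs i).continuousOn.mono haO
  obtain ⟨C₄, hC₄⟩ := exists_uniform_bound hK fun i =>
    ((hhs i).continuousOn_fderiv_of_isOpen hOo (by simp)).mono haO
  let C := max 0 (max (max C₁ C₂) (max C₃ C₄))
  have hC0 : 0 ≤ C := le_max_left _ _
  have hC1 : C₁ ≤ C := ((le_max_left _ _).trans (le_max_left _ _)).trans (le_max_right _ _)
  have hC2 : C₂ ≤ C := ((le_max_right _ _).trans (le_max_left _ _)).trans (le_max_right _ _)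
  have hC3 : C₃ ≤ C := ((le_max_left _ _).trans (le_max_right _ _)).trans (le_max_right _ _)
  have hC4 : C₄ ≤ C := ((le_max_right _ _).trans (le_max_right _ _)).trans (le_max_right _ _)
  have hunit : ∀ p : Eucl n →L[ℝ] ℝ, ∑ i, p (X i q : TSpace n q) ^ 2 = 1 →
      ∑ i, p (F i (e q)) ^ 2 = 1 := fun p hp => by simpa only [hF0] using hp
  have hexp : ∀ {Γ : ℝ → Eucl n × (Eucl n →L[ℝ] ℝ)} {p : Eucl n →L[ℝ] ℝ}, Γ 0 = (e q, p) →
      (∀ t ∈ Icc 0 T, HasDerivWithinAt Γ (hamField F (Γ t)) (Icc 0 T) t ∧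
        (Γ t).1 ∈ closedBall (e q) a) → ∀ t ∈ Icc 0 T, S.expMap q t p = e.symm (Γ t).1 :=
    fun h0 h1 t ht => expMap_eq_of_hamField hX (fun t ht => (h1 t ht).1)
      (fun t ht => haO (h1 t ht).2) h0 ht
  have hdiff : ∀ x ∈ closedBall (e q) a, DifferentiableAt ℝ (φ ∘ e.symm) x ∧
      (∀ i, DifferentiableAt ℝ (F i) x) ∧ ∀ i, DifferentiableAt ℝ (h i) x := fun x hx =>
    have hn := hOo.mem_nhds (haO hx)
    ⟨(hfs.contDiffAt hn).differentiableAt (by simp),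
      fun i => ((hFs i).contDiffAt hn).differentiableAt (by simp),
      fun i => ((hhs i).contDiffAt hn).differentiableAt (by simp)⟩
  refine ⟨T, hT, k * (k * (2 * C ^ 3 * 2 + C ^ 2)), by positivity, fun t ht => ?_,
    fun p hp => ?_⟩
  · have hcomp : ∀ R > 0, ContinuousOn (fun p : Eucl n →L[ℝ] ℝ => φ (S.expMap q t p))
        {p | ‖p‖ ≤ R ∧ ∑ i, p (F i (e q)) ^ 2 = 1} := by
      intro R hR
      obtain ⟨Γ, hΓ, hΓc⟩ := hflow R hR
      have h1 : ContinuousOn (fun p => (φ ∘ e.symm) (Γ p t).1)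
          {p | ‖p‖ ≤ R ∧ ∑ i, p (F i (e q)) ^ 2 = 1} :=
        hfs.continuousOn.comp (hΓc t ht).fst fun p hp =>
          haO ((hΓ p hp.1 hp.2).2 t ht).2.1
      refine h1.congr fun p hp => ?_
      have h2 := hΓ p hp.1 hp.2
      simp only [Function.comp]
      rw [hexp h2.1 (fun s hs => ⟨(h2.2 s hs).1, (h2.2 s hs).2.1⟩) t ht]
    -- The flow depends on the bound `R`, so continuity is checked locally, near `p` with R = ‖p‖ +
    -- 1. The time `T` is the same for every `R`.
    intro p hp
    have hR : 0 < ‖p‖ + 1 := by positivity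
    have h1 := hcomp _ hR p ⟨by linarith, hunit p hp⟩
    refine h1.mono_of_mem_nhdsWithin ?_
    have h2 : {p' : Eucl n →L[ℝ] ℝ | ‖p'‖ < ‖p‖ + 1} ∈ 𝓝 p :=
      (isOpen_lt continuous_norm continuous_const).mem_nhds (by simp)
    filter_upwards [self_mem_nhdsWithin, mem_nhdsWithin_of_mem_nhds h2] with p' h3 h4
    exact ⟨le_of_lt h4, hunit p' h3⟩
  -- With R = 1 + ‖p‖, which is positive even for p = 0, the momentum stays below 2(1 + ‖p‖). This
  -- is the factor 2 in the constant and the source of the factor 1 + ‖p‖.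
  · have hR : 0 < 1 + ‖p‖ := by positivity
    obtain ⟨Γ, hΓ, -⟩ := hflow _ hR
    obtain ⟨h0, h1⟩ := hΓ p (by linarith) (hunit p hp)
    have hexp' := hexp h0 (fun s hs => ⟨(h1 s hs).1, (h1 s hs).2.1⟩)
    have hg : ∀ t ∈ Icc 0 T, HasDerivWithinAt (fun s => (φ ∘ e.symm) (Γ p s).1)
        (∑ i, (Γ p t).2 (F i (Γ p t).1) * h i (Γ p t).1) (Icc 0 T) t := fun t ht =>
      hasDerivWithinAt_along (h1 t ht).1 (hdiff _ (h1 t ht).2.1).1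
    have hg1 : ∀ t ∈ Icc 0 T, HasDerivWithinAt
        (fun t => ∑ i, (Γ p t).2 (F i (Γ p t).1) * h i (Γ p t).1)
        (secondDerivAlong F h (Γ p t)) (Icc 0 T) t := fun t ht =>
      hasDerivWithinAt_along_second (h1 t ht).1 (hdiff _ (h1 t ht).2.1).2.1
        (hdiff _ (h1 t ht).2.1).2.2
    have hB : ∀ t ∈ Icc 0 T, |secondDerivAlong F h (Γ p t)| ≤
        k * (k * (2 * C ^ 3 * 2 + C ^ 2)) * (1 + ‖p‖) := by
      intro t ht
      have hm := (h1 t ht).2.1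
      refine (abs_secondDerivAlong_le hC0 (fun i => (hC₁ i _ hm).trans hC1)
        (fun i => (hC₂ i _ hm).trans hC2) (fun i => (hC₃ i _ hm).trans hC3)
        (fun i => (hC₄ i _ hm).trans hC4) (abs_le_one_of_sum_sq (h1 t ht).2.2.2)).trans ?_
      have e1 : 2 * C ^ 3 * ‖(Γ p t).2‖ + C ^ 2 ≤ (2 * C ^ 3 * 2 + C ^ 2) * (1 + ‖p‖) := by
        have e2 : 2 * C ^ 3 * ‖(Γ p t).2‖ ≤ 2 * C ^ 3 * (2 * (1 + ‖p‖)) := by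
          gcongr; exact (h1 t ht).2.2.1
        nlinarith [norm_nonneg p, sq_nonneg C, mul_nonneg (sq_nonneg C) (norm_nonneg p)]
      calc (k : ℝ) * (k * (2 * C ^ 3 * ‖(Γ p t).2‖ + C ^ 2)) ≤
            k * (k * ((2 * C ^ 3 * 2 + C ^ 2) * (1 + ‖p‖))) := by gcongr
        _ = _ := by ring
    have hval : ∀ t ∈ Icc 0 T, φ (S.expMap q t p) - φ q -
        t * ∑ i, p (X i q : TSpace n q) * h i (e q) =
        (φ ∘ e.symm) (Γ p t).1 - (φ ∘ e.symm) (Γ p 0).1 -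
          t * ∑ i, (Γ p 0).2 (F i (Γ p 0).1) * h i (Γ p 0).1 := by
      intro t ht
      rw [hexp' t ht, h0]
      simp only [Function.comp, hsymm0, hF0]
    refine ⟨fun t ht => ?_, ?_⟩
    · rw [hval t ht]
      exact abs_taylor_sub_le hg hg1 hB ht
    · have h2 := tendsto_taylor hT hg (hg1 0 (left_mem_Icc.2 hT.le))
      rw [h0] at h2
      refine h2.congr' ?_
      filter_upwards [Ioc_mem_nhdsGT hT] with t ht
      rw [hval t ⟨ht.1.le, ht.2⟩, h0]

end Structure

end ExpExpansion

/-! ### First and second moments of the uniform measure on the sphere -/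

section SphereMoments

open Metric
open scoped Pointwise

variable {k : ℕ}

/-- The action of a linear isometry on the unit sphere. -/
def sphereMap (e : Eucl k ≃ₗᵢ[ℝ] Eucl k) (y : sphere (0 : Eucl k) 1) : sphere (0 : Eucl k) 1 :=
  ⟨e y, by simp⟩

theorem measurable_sphereMap (e : Eucl k ≃ₗᵢ[ℝ] Eucl k) : Measurable (sphereMap e) :=
  (e.continuous.comp continuous_subtype_val).measurable.subtype_mk

/-- `toSphere` measures a set by the volume of the cone over it, up to a dimensional factor. A
linear isometry carries cones to cones and preserves volume. -/
theorem map_sphereMap_toSphere (e : Eucl k ≃ₗᵢ[ℝ] Eucl k) :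
    (volume : Measure (Eucl k)).toSphere.map (sphereMap e) =
      (volume : Measure (Eucl k)).toSphere := by
  ext s hs
  rw [Measure.map_apply (measurable_sphereMap e) hs, Measure.toSphere_apply' _ hs,
    Measure.toSphere_apply' _ (measurable_sphereMap e hs)]
  congr 1
  have : Ioo (0 : ℝ) 1 • ((↑) '' (sphereMap e ⁻¹' s) : Set (Eucl k)) =
      e ⁻¹' (Ioo (0 : ℝ) 1 • ((↑) '' s : Set (Eucl k))) := by
    ext x
    simp only [Set.mem_smul, mem_preimage, mem_image]
    constructor
    · rintro ⟨r, hr, _, ⟨y, hy, rfl⟩, rfl⟩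
      exact ⟨r, hr, _, ⟨_, hy, rfl⟩, by simp [sphereMap]⟩
    · rintro ⟨r, hr, _, ⟨y, hy, rfl⟩, h⟩
      refine ⟨r, hr, _, ⟨sphereMap e.symm y, ?_, rfl⟩, ?_⟩
      · have : sphereMap e (sphereMap e.symm y) = y := by ext1; simp [sphereMap]
        change sphereMap e (sphereMap e.symm y) ∈ s
        rwa [this]
      · apply e.injective
        simp [sphereMap, h]
  rw [this]
  exact (e.measurePreserving.measure_preimage_equiv (f := e.toMeasurableEquiv) _)

theorem map_sphereMap_uniformSphere (e : Eucl k ≃ₗᵢ[ℝ] Eucl k) :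
    (uniformSphere k).map (sphereMap e) = uniformSphere k := by
  rw [uniformSphere, Measure.map_smul, map_sphereMap_toSphere]

instance isProbabilityMeasure_uniformSphere [NeZero k] : IsProbabilityMeasure (uniformSphere k) := by
  have : Nonempty (Fin k) := ⟨0⟩
  have h0 : (volume : Measure (Eucl k)).toSphere univ ≠ 0 := by
    rw [Ne, Measure.measure_univ_eq_zero]
    exact Measure.toSphere_ne_zero _
  refine ⟨?_⟩
  rw [uniformSphere, Measure.smul_apply, smul_eq_mul]
  exact ENNReal.inv_mul_cancel h0 (measure_ne_top _ _)

theorem integral_comp_sphereMap (e : Eucl k ≃ₗᵢ[ℝ] Eucl k) {f : Eucl k → ℝ} (hf : Continuous f) :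
    ∫ y, f (e y) ∂(uniformSphere k) = ∫ y, f y ∂(uniformSphere k) := by
  conv_rhs => rw [← map_sphereMap_uniformSphere e]
  rw [integral_map (f := fun y : sphere (0 : Eucl k) 1 => f y)
    (measurable_sphereMap e).aemeasurable
    (hf.comp continuous_subtype_val).aestronglyMeasurable]
  rfl

/-- The antipodal map changes the sign of the integrand. -/
theorem integral_sphere_coord (i : Fin k) :
    ∫ y, (y : Eucl k) i ∂(uniformSphere k) = 0 := by
  have h := integral_comp_sphereMap (LinearIsometryEquiv.neg ℝ) (f := fun y : Eucl k => y i)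
    (by fun_prop)
  simp only [LinearIsometryEquiv.coe_neg, PiLp.neg_apply, integral_neg] at h
  linarith

/-- The reflection of a coordinate. -/
def flipCoord (i : Fin k) : Eucl k ≃ₗᵢ[ℝ] Eucl k :=
  LinearIsometryEquiv.piLpCongrRight 2 fun j =>
    if j = i then LinearIsometryEquiv.neg ℝ else LinearIsometryEquiv.refl ℝ ℝ

/-- Off the diagonal, reflecting one coordinate changes the sign. On the diagonal, swapping
coordinates makes all k integrals equal, and they add up to 1 because |y|² = 1. -/
theorem integral_sphere_coord_mul_coord [NeZero k] (i j : Fin k) :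
    ∫ y, (y : Eucl k) i * (y : Eucl k) j ∂(uniformSphere k) = if i = j then (k : ℝ)⁻¹ else 0 := by
  split_ifs with hij
  · subst hij
    have h1 : ∀ j, ∫ y, (y : Eucl k) j * (y : Eucl k) j ∂(uniformSphere k) =
        ∫ y, (y : Eucl k) i * (y : Eucl k) i ∂(uniformSphere k) := by
      intro j
      have h := integral_comp_sphereMap
        (LinearIsometryEquiv.piLpCongrLeft 2 ℝ ℝ (Equiv.swap i j))
        (f := fun y : Eucl k => y i * y i) (by fun_prop)
      rw [← h]
      simp
    have hint : ∀ j, Integrable (fun y : sphere (0 : Eucl k) 1 => (y : Eucl k) j * (y : Eucl k) j)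
        (uniformSphere k) := by
      intro j
      have hc : Continuous fun y : sphere (0 : Eucl k) 1 => (y : Eucl k) j * (y : Eucl k) j := by
        fun_prop
      exact hc.integrable_of_hasCompactSupport (HasCompactSupport.of_compactSpace _)
    have h2 : ∑ j, ∫ y, (y : Eucl k) j * (y : Eucl k) j ∂(uniformSphere k) = 1 := by
      rw [← integral_finsetSum _ fun j _ => hint j]
      have : ∀ y : sphere (0 : Eucl k) 1, ∑ j, (y : Eucl k) j * (y : Eucl k) j = 1 := by
        intro y
        have := EuclideanSpace.norm_sq_eq (y : Eucl k)
        simp only [norm_eq_of_mem_sphere, Real.norm_eq_abs, sq_abs] at this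
        simp only [← sq]
        linarith
      simp [this]
    simp only [h1, Finset.sum_const, Finset.card_univ, Fintype.card_fin, nsmul_eq_mul] at h2
    exact eq_inv_of_mul_eq_one_right h2
  · have h := integral_comp_sphereMap (flipCoord i) (f := fun y : Eucl k => y i * y j)
      (by fun_prop)
    have e1 : ∀ y : Eucl k, flipCoord i y i = -y i := by intro y; simp [flipCoord]
    have e2 : ∀ y : Eucl k, flipCoord i y j = y j := by
      intro y; simp [flipCoord, Ne.symm hij]
    simp only [e1, e2, neg_mul, integral_neg] at h
    linarith

end SphereMoments

/-! ### Moments of adapted measures -/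

section CylinderMoments

open Metric

variable {n k : ℕ} {M : Type*} [TopologicalSpace M] [ChartedSpace (Eucl n) M]

instance instBorelSpaceCSpace (q : M) : BorelSpace (CSpace n q) := ⟨rfl⟩

instance instSecondCountableTopologyCSpace (q : M) : SecondCountableTopology (CSpace n q) :=
  inferInstanceAs (SecondCountableTopology (Eucl n →L[ℝ] ℝ))

theorem continuous_apply_CSpace {q : M} (w : TSpace n q) : Continuous fun α : CSpace n q => α w :=
  (ContinuousLinearMap.apply ℝ ℝ (show Eucl n from w)).continuous

variable [IsManifold (𝓡 n) ∞ M] {S : Structure n k M}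

namespace Structure.Complement

variable (V : S.Complement)

theorem continuous_horizontalCovector (q : M) : Continuous (V.horizontalCovector q) := by
  have h : ∀ y : Eucl k, V.horizontalCovector q y = ∑ i, y i •
      LinearMap.toContinuousLinearMap (S.g q (S.onb q i) ∘ₗ V.proj q) := by
    intro y
    ext w
    simp [horizontalCovector, sum_apply]
  rw [funext h]
  fun_prop

theorem horizontalCovector_apply (q : M) (y : Eucl k) (w : TSpace n q) :
    V.horizontalCovector q y w = ∑ i, y i * S.g q (S.onb q i) (V.proj q w) := by
  simp [horizontalCovector]

theorem proj_of_mem (q : M) (v : S.D q) : V.proj q (v : TSpace n q) = v :=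
  Submodule.projectionOnto_apply_left (V.isCompl q) v

/-- The sum of the horizontal covector of a point of the sphere and of a vertical covector. -/
def cylinderMap (q : M) (p : sphere (0 : Eucl k) 1 × CSpace n q) : CSpace n q :=
  V.horizontalCovector q (p.1 : Eucl k) + p.2

theorem continuous_cylinderMap (q : M) : Continuous (V.cylinderMap q) :=
  ((V.continuous_horizontalCovector q).comp (continuous_subtype_val.comp continuous_fst)).add
    continuous_snd

variable {V}

/-- Integrals over the cylinder become integrals over sphere × vertical covectors for a product
measure, where independence of the two factors can be used. -/
theorem AdaptedMeasure.cylinderMeasure_eq_map [NeZero k] (μ : V.AdaptedMeasure) (q : M) :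
    V.cylinderMeasure q (μ.vert q) =
      ((uniformSphere k).prod (μ.vert q)).map (V.cylinderMap q) := by
  have := μ.isProbability q
  have hm : Measurable fun y : sphere (0 : Eucl k) 1 => V.horizontalCovector q (y : Eucl k) :=
    ((V.continuous_horizontalCovector q).comp continuous_subtype_val).measurable
  have h1 : ((uniformSphere k).map fun y : sphere (0 : Eucl k) 1 =>
      V.horizontalCovector q (y : Eucl k)).prod (μ.vert q) =
      ((uniformSphere k).prod (μ.vert q)).map
        (Prod.map (fun y : sphere (0 : Eucl k) 1 => V.horizontalCovector q (y : Eucl k)) id) := by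
    conv_lhs => rw [← Measure.map_id (μ := μ.vert q)]
    exact Measure.map_prod_map _ _ hm measurable_id
  rw [cylinderMeasure, sphereMeasure, h1, Measure.map_map continuous_add.measurable
    (hm.prodMap measurable_id)]
  rfl

theorem AdaptedMeasure.isProbabilityMeasure_cylinderMeasure [NeZero k] (μ : V.AdaptedMeasure)
    (q : M) : IsProbabilityMeasure (V.cylinderMeasure q (μ.vert q)) := by
  have := μ.isProbability q
  rw [μ.cylinderMeasure_eq_map]
  exact Measure.isProbabilityMeasure_map (V.continuous_cylinderMap q).measurable.aemeasurable

theorem AdaptedMeasure.ae_vert_snd [NeZero k] (μ : V.AdaptedMeasure) (q : M) :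
    ∀ᵐ p ∂((uniformSphere k).prod (μ.vert q)), ∀ v ∈ S.D q, p.2 v = 0 := by
  have := μ.isProbability q
  exact Measure.quasiMeasurePreserving_snd.ae (μ.vertical q)

/-- The measure is concentrated on the cylinder of covectors with `2H = 1`. -/
theorem AdaptedMeasure.ae_sum_sq [NeZero k] (μ : V.AdaptedMeasure) {q : M} {b : Fin k → S.D q}
    (hb : ∀ i j, S.g q (b i) (b j) = if i = j then 1 else 0) :
    ∀ᵐ α ∂(V.cylinderMeasure q (μ.vert q)), ∑ i, α (b i : TSpace n q) ^ 2 = 1 := by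
  have hc : Continuous fun α : CSpace n q => ∑ i, α (b i : TSpace n q) ^ 2 := by
    refine continuous_finsetSum _ fun i _ => Continuous.pow ?_ 2
    exact continuous_apply_CSpace _
  have hs : MeasurableSet {α : CSpace n q | ∑ i, α (b i : TSpace n q) ^ 2 = 1} :=
    hc.measurable (measurableSet_singleton 1)
  rw [μ.cylinderMeasure_eq_map, ae_map_iff (V.continuous_cylinderMap q).measurable.aemeasurable hs]
  filter_upwards [μ.ae_vert_snd q] with p hp
  set u : S.D q := ∑ i, (p.1 : Eucl k) i • S.onb q i with hu
  have h1 : ∀ i, V.cylinderMap q p (b i : TSpace n q) = S.g q u (b i) := by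
    intro i
    simp only [cylinderMap, add_apply, hp _ (b i).2, add_zero]
    rw [horizontalCovector_apply, V.proj_of_mem]
    simp [hu]
  simp only [h1]
  have h2 : ∑ i, S.g q u (b i) ^ 2 = S.g q u u := by
    rw [g_eq_sum_of_orth hb]
    exact Finset.sum_congr rfl fun i _ => by rw [S.symm, sq]
  rw [h2, hu]
  simp only [map_sum, map_smul, LinearMap.sum_apply, LinearMap.smul_apply, S.onb_spec, smul_eq_mul]
  have := EuclideanSpace.norm_sq_eq (p.1 : Eucl k)
  simp only [norm_eq_of_mem_sphere, Real.norm_eq_abs, sq_abs] at this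
  simp only [mul_ite, mul_one, mul_zero, Finset.sum_ite_eq', Finset.mem_univ, if_true, ← sq]
  linarith

theorem AdaptedMeasure.memLp_apply [NeZero k] (μ : V.AdaptedMeasure) (q : M) (w : TSpace n q) :
    MemLp (fun α : CSpace n q => α w) 2 (V.cylinderMeasure q (μ.vert q)) := by
  have := μ.isProbability q
  have hw : Continuous fun α : CSpace n q => α w :=
    continuous_apply_CSpace w
  rw [μ.cylinderMeasure_eq_map, memLp_map_measure_iff hw.aestronglyMeasurable
    (V.continuous_cylinderMap q).measurable.aemeasurable]
  have h1 : MemLp (fun p : sphere (0 : Eucl k) 1 × CSpace n q =>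
      V.horizontalCovector q (p.1 : Eucl k) w) 2 ((uniformSphere k).prod (μ.vert q)) := by
    have hc : Continuous fun y : sphere (0 : Eucl k) 1 => V.horizontalCovector q (y : Eucl k) w :=
      hw.comp ((V.continuous_horizontalCovector q).comp continuous_subtype_val)
    have : MemLp (fun y : sphere (0 : Eucl k) 1 => V.horizontalCovector q (y : Eucl k) w) 2
        (uniformSphere k) := hc.memLp_of_hasCompactSupport (HasCompactSupport.of_compactSpace _)
    exact this.comp_measurePreserving measurePreserving_fst
  exact h1.add ((μ.twoDecreasing q w).comp_measurePreserving measurePreserving_snd)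

/-- Horizontal second moments of an adapted measure. -/
theorem AdaptedMeasure.integral_mul [NeZero k] (μ : V.AdaptedMeasure) {q : M} (v : S.D q)
    (w : TSpace n q) :
    ∫ α : CSpace n q, α (v : TSpace n q) * α w ∂(V.cylinderMeasure q (μ.vert q)) =
      (k : ℝ)⁻¹ * S.g q v (V.proj q w) := by
  have := μ.isProbability q
  have hw : ∀ w : TSpace n q, Continuous fun α : CSpace n q => α w := fun w =>
    continuous_apply_CSpace w
  let L : TSpace n q → sphere (0 : Eucl k) 1 → ℝ := fun w y =>
    V.horizontalCovector q (y : Eucl k) w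
  have hL : ∀ w, Continuous (L w) := fun w =>
    (hw w).comp ((V.continuous_horizontalCovector q).comp continuous_subtype_val)
  have hLi : ∀ {f : sphere (0 : Eucl k) 1 → ℝ}, Continuous f → Integrable f (uniformSphere k) :=
    fun hf => hf.integrable_of_hasCompactSupport (HasCompactSupport.of_compactSpace _)
  rw [μ.cylinderMeasure_eq_map, integral_map
    (f := fun α : CSpace n q => α (v : TSpace n q) * α w)
    (V.continuous_cylinderMap q).measurable.aemeasurable
    ((hw _).mul (hw w)).aestronglyMeasurable]
  -- Since `v` is horizontal, its factor sees only the sphere variable. The vertical contribution of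
  -- `w` is then multiplied by the mean of `L v`, which is zero, so no moment of the vertical factor
  -- survives.
  have h1 : (fun p => V.cylinderMap q p (v : TSpace n q) * V.cylinderMap q p w) =ᵐ[
      (uniformSphere k).prod (μ.vert q)]
      fun p => L v p.1 * L w p.1 + L v p.1 * p.2 w := by
    filter_upwards [μ.ae_vert_snd q] with p hp
    simp only [cylinderMap, add_apply, hp _ v.2, add_zero, L]
    ring
  have hint : Integrable (fun α : CSpace n q => α w) (μ.vert q) :=
    (μ.twoDecreasing q w).integrable (by norm_num)
  have i1 : Integrable (fun p : sphere (0 : Eucl k) 1 × CSpace n q => L v p.1 * L w p.1)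
      ((uniformSphere k).prod (μ.vert q)) :=
    (measurePreserving_fst.integrable_comp_of_integrable (hLi ((hL v).mul (hL w))))
  have i2 : Integrable (fun p : sphere (0 : Eucl k) 1 × CSpace n q => L v p.1 * p.2 w)
      ((uniformSphere k).prod (μ.vert q)) := (hLi (hL v)).mul_prod hint
  rw [integral_congr_ae h1, integral_add i1 i2, integral_prod_mul (L v) fun α : CSpace n q => α w]
  have hLv : ∫ y, L v y ∂(uniformSphere k) = 0 := by
    simp only [L, horizontalCovector_apply]
    rw [integral_finsetSum _ fun i _ => hLi (by fun_prop)]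
    simp only [integral_mul_const, integral_sphere_coord, zero_mul, Finset.sum_const_zero]
  have hLL : ∫ p : sphere (0 : Eucl k) 1 × CSpace n q, L v p.1 * L w p.1
      ∂((uniformSphere k).prod (μ.vert q)) = ∫ y, L v y * L w y ∂(uniformSphere k) := by
    rw [integral_fun_fst (fun y => L v y * L w y)]
    simp
  rw [hLv, zero_mul, add_zero, hLL]
  simp only [L, horizontalCovector_apply, V.proj_of_mem, Finset.sum_mul_sum]
  rw [integral_finsetSum _ fun i _ => hLi (by fun_prop)]
  have h3 : ∀ i, ∫ y, ∑ j, (y : Eucl k) i * S.g q (S.onb q i) v *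
      ((y : Eucl k) j * S.g q (S.onb q j) (V.proj q w)) ∂(uniformSphere k) =
      (k : ℝ)⁻¹ * (S.g q (S.onb q i) v * S.g q (S.onb q i) (V.proj q w)) := by
    intro i
    rw [integral_finsetSum _ fun i _ => hLi (by fun_prop)]
    have h4 : ∀ j, ∫ y, (y : Eucl k) i * S.g q (S.onb q i) v *
        ((y : Eucl k) j * S.g q (S.onb q j) (V.proj q w)) ∂(uniformSphere k) =
        (if i = j then (k : ℝ)⁻¹ else 0) *
          (S.g q (S.onb q i) v * S.g q (S.onb q j) (V.proj q w)) := by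
      intro j
      rw [← integral_sphere_coord_mul_coord, ← integral_mul_const]
      congr 1 with y
      ring
    simp only [h4, ite_mul, zero_mul, Finset.sum_ite_eq, Finset.mem_univ, if_true]
  simp only [h3]
  rw [← Finset.mul_sum]
  rw [g_eq_sum_of_orth (S.onb_spec q)]

/-- Horizontal first moments of an adapted measure vanish. -/
theorem AdaptedMeasure.integral_horizontal [NeZero k] (μ : V.AdaptedMeasure) {q : M} (v : S.D q) :
    ∫ α : CSpace n q, α (v : TSpace n q) ∂(V.cylinderMeasure q (μ.vert q)) = 0 := by
  have := μ.isProbability q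
  have hw : ∀ w : TSpace n q, Continuous fun α : CSpace n q => α w := fun w =>
    continuous_apply_CSpace w
  have hLi : ∀ {f : sphere (0 : Eucl k) 1 → ℝ}, Continuous f → Integrable f (uniformSphere k) :=
    fun hf => hf.integrable_of_hasCompactSupport (HasCompactSupport.of_compactSpace _)
  rw [μ.cylinderMeasure_eq_map, integral_map
    (f := fun α : CSpace n q => α (v : TSpace n q))
    (V.continuous_cylinderMap q).measurable.aemeasurable (hw _).aestronglyMeasurable]
  have h1 : (fun p => V.cylinderMap q p (v : TSpace n q)) =ᵐ[
      (uniformSphere k).prod (μ.vert q)]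
      fun p => ∑ i, (p.1 : Eucl k) i * S.g q (S.onb q i) v := by
    filter_upwards [μ.ae_vert_snd q] with p hp
    simp only [cylinderMap, add_apply, hp _ v.2, add_zero, horizontalCovector_apply, V.proj_of_mem]
  rw [integral_congr_ae h1, integral_fun_fst
    (fun y : sphere (0 : Eucl k) 1 => ∑ i, (y : Eucl k) i * S.g q (S.onb q i) v),
    integral_finsetSum _ fun i _ => hLi (by fun_prop)]
  simp only [integral_mul_const, integral_sphere_coord, zero_mul, Finset.sum_const_zero, smul_zero]

end Structure.Complement

end CylinderMoments

/-! ### The limit defining the microscopic Laplacian -/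

section MicroscopicLimit

variable {n k : ℕ} {M : Type*} [TopologicalSpace M] [ChartedSpace (Eucl n) M]
  [IsManifold (𝓡 n) ∞ M] {S : Structure n k M}

/-- Reduces integrability of ‖λ‖ to that of finitely many evaluations, which square integrability of
linear functions controls. -/
theorem norm_le_sum_abs_apply_single (p : Eucl n →L[ℝ] ℝ) :
    ‖p‖ ≤ ∑ i, |p (EuclideanSpace.single i (1 : ℝ))| := by
  refine p.opNorm_le_bound (Finset.sum_nonneg fun _ _ => abs_nonneg _) fun v => ?_
  have hv : v = ∑ i, v i • EuclideanSpace.single i (1 : ℝ) := by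
    simpa using ((EuclideanSpace.basisFun (Fin n) ℝ).sum_repr v).symm
  calc ‖p v‖ = ‖∑ i, v i * p (EuclideanSpace.single i (1 : ℝ))‖ := by
        conv_lhs => rw [hv]
        simp
    _ ≤ ∑ i, ‖v i * p (EuclideanSpace.single i (1 : ℝ))‖ := norm_sum_le _ _
    _ ≤ ∑ i, |p (EuclideanSpace.single i (1 : ℝ))| * ‖v‖ := by
        refine Finset.sum_le_sum fun i _ => ?_
        rw [norm_mul, mul_comm, Real.norm_eq_abs]
        exact mul_le_mul_of_nonneg_left (PiLp.norm_apply_le v i) (abs_nonneg _)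
    _ = _ := by rw [Finset.sum_mul]

namespace Structure.Complement

variable {V : S.Complement}

theorem AdaptedMeasure.integrable_norm [NeZero k] (μ : V.AdaptedMeasure) (q : M) :
    Integrable (fun α : CSpace n q => ‖(show Eucl n →L[ℝ] ℝ from α)‖)
      (V.cylinderMeasure q (μ.vert q)) := by
  have := μ.isProbabilityMeasure_cylinderMeasure q
  have hc : Continuous fun α : CSpace n q => ‖(show Eucl n →L[ℝ] ℝ from α)‖ :=
    continuous_norm (E := Eucl n →L[ℝ] ℝ)
  refine Integrable.mono' (g := fun α : CSpace n q =>
    ∑ i, |α (show TSpace n q from EuclideanSpace.single i (1 : ℝ))|) ?_ hc.aestronglyMeasurable ?_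
  · exact integrable_finsetSum _ fun i _ => ((μ.memLp_apply q _).integrable (by norm_num)).abs
  · refine Eventually.of_forall fun α => ?_
    rw [norm_norm]
    exact norm_le_sum_abs_apply_single _

theorem AdaptedMeasure.integrable_apply [NeZero k] (μ : V.AdaptedMeasure) (q : M)
    (w : TSpace n q) :
    Integrable (fun α : CSpace n q => α w) (V.cylinderMeasure q (μ.vert q)) := by
  have := μ.isProbabilityMeasure_cylinderMeasure q
  exact (μ.memLp_apply q w).integrable (by norm_num)

/-- Each quadratic term has at least one horizontal factor, so `integral_mul` evaluates all of them.
Therefore the result depends on the complement through its projection and not on the vertical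
factor. -/
theorem AdaptedMeasure.integral_secondDerivAlong [NeZero k] (μ : V.AdaptedMeasure) {U : Set M}
    {X : Fin k → ∀ x : M, S.D x} (hX : S.IsOrthoFrame U X) {q : M} (hq : q ∈ U)
    (h : Fin k → Eucl n → ℝ) :
    ∫ α, (secondDerivAlong (frameRep q X) h (extChartAt (𝓡 n) q q, α))
        ∂(V.cylinderMeasure q (μ.vert q)) =
      (k : ℝ)⁻¹ * (∑ i, fderiv ℝ (h i) (extChartAt (𝓡 n) q q) (X i q : TSpace n q) +
        ∑ i, (∑ j, S.g q (X j q) (V.proj q (VectorField.mlieBracket (𝓡 n)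
          (fun x => (X j x : TSpace n x)) (fun x => (X i x : TSpace n x)) q))) *
          h i (extChartAt (𝓡 n) q q)) := by
  have hF : ∀ i, frameRep q X i (extChartAt (𝓡 n) q q) = (X i q : TSpace n q) := fun i =>
    fieldRep_self q _
  have hb : ∀ i j, bracketAt (frameRep q X) (extChartAt (𝓡 n) q q) j i =
      VectorField.mlieBracket (𝓡 n) (fun x => (X j x : TSpace n x))
        (fun x => (X i x : TSpace n x)) q := by
    intro i j
    rw [mlieBracket_eq, bracketAt, hF, hF]
    rfl
  have hint : ∀ i (w : TSpace n q), Integrable (fun α : CSpace n q => α (X i q : TSpace n q) * α w)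
      (V.cylinderMeasure q (μ.vert q)) := fun i w =>
    (μ.memLp_apply q (X i q : TSpace n q)).integrable_mul (μ.memLp_apply q w)
  have e : ∀ α : CSpace n q, secondDerivAlong (frameRep q X) h (extChartAt (𝓡 n) q q, α) =
      ∑ i, ∑ j, (α (X j q : TSpace n q) * α (VectorField.mlieBracket (𝓡 n)
          (fun x => (X j x : TSpace n x)) (fun x => (X i x : TSpace n x)) q) *
            h i (extChartAt (𝓡 n) q q) +
        α (X i q : TSpace n q) * α (X j q : TSpace n q) *
          fderiv ℝ (h i) (extChartAt (𝓡 n) q q) (X j q : TSpace n q)) := by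
    intro α
    simp only [secondDerivAlong, hb, hF]
    rfl
  simp only [e]
  rw [integral_finsetSum _ fun i _ => ?_]
  swap
  · exact integrable_finsetSum _ fun j _ => ((hint j _).mul_const _).add ((hint i _).mul_const _)
  have e2 : ∀ i, ∫ α : CSpace n q, ∑ j, (α (X j q : TSpace n q) * α (VectorField.mlieBracket (𝓡 n)
          (fun x => (X j x : TSpace n x)) (fun x => (X i x : TSpace n x)) q) *
            h i (extChartAt (𝓡 n) q q) +
        α (X i q : TSpace n q) * α (X j q : TSpace n q) *
          fderiv ℝ (h i) (extChartAt (𝓡 n) q q) (X j q : TSpace n q))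
          ∂(V.cylinderMeasure q (μ.vert q)) =
      (k : ℝ)⁻¹ * (fderiv ℝ (h i) (extChartAt (𝓡 n) q q) (X i q : TSpace n q) +
        (∑ j, S.g q (X j q) (V.proj q (VectorField.mlieBracket (𝓡 n)
          (fun x => (X j x : TSpace n x)) (fun x => (X i x : TSpace n x)) q))) *
          h i (extChartAt (𝓡 n) q q)) := by
    intro i
    rw [integral_finsetSum _ fun j _ => ?_]
    swap
    · exact ((hint j _).mul_const _).add ((hint i _).mul_const _)
    have e3 : ∀ j, ∫ α : CSpace n q, (α (X j q : TSpace n q) * α (VectorField.mlieBracket (𝓡 n)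
          (fun x => (X j x : TSpace n x)) (fun x => (X i x : TSpace n x)) q) *
            h i (extChartAt (𝓡 n) q q) +
        α (X i q : TSpace n q) * α (X j q : TSpace n q) *
          fderiv ℝ (h i) (extChartAt (𝓡 n) q q) (X j q : TSpace n q))
          ∂(V.cylinderMeasure q (μ.vert q)) =
        (k : ℝ)⁻¹ * S.g q (X j q) (V.proj q (VectorField.mlieBracket (𝓡 n)
          (fun x => (X j x : TSpace n x)) (fun x => (X i x : TSpace n x)) q)) *
          h i (extChartAt (𝓡 n) q q) +
        (k : ℝ)⁻¹ * (if i = j then 1 else 0) *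
          fderiv ℝ (h i) (extChartAt (𝓡 n) q q) (X j q : TSpace n q) := by
      intro j
      rw [integral_add ((hint j _).mul_const _) ((hint i _).mul_const _), integral_mul_const,
        integral_mul_const, μ.integral_mul, μ.integral_mul, V.proj_of_mem, hX.orth q hq]
    simp only [e3, Finset.sum_add_distrib, mul_ite, mul_one, mul_zero, ite_mul, zero_mul,
      Finset.sum_ite_eq, Finset.mem_univ, if_true]
    rw [mul_add, add_comm, Finset.sum_mul, Finset.mul_sum]
    simp only [mul_assoc]
  rw [Finset.sum_congr rfl fun i _ => e2 i, ← Finset.mul_sum, Finset.sum_add_distrib]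

/-- The limit that defines the microscopic Laplacian exists; its value in terms of an orthonormal
frame of the distribution. -/
theorem AdaptedMeasure.tendsto_quotient [NeZero k] [T2Space M] (μ : V.AdaptedMeasure) {U : Set M}
    {X : Fin k → ∀ x : M, S.D x} (hX : S.IsOrthoFrame U X) {q : M} (hq : q ∈ U)
    {φ : M → ℝ} (hφ : ContMDiff (𝓡 n) 𝓘(ℝ, ℝ) ∞ φ) :
    Tendsto (μ.quotient φ q) (𝓝[>] 0)
      (𝓝 (∑ i, fderiv ℝ (frameDeriv q X φ i) (extChartAt (𝓡 n) q q) (X i q : TSpace n q) +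
        ∑ i, (∑ j, S.g q (X j q) (V.proj q (VectorField.mlieBracket (𝓡 n)
          (fun x => (X j x : TSpace n x)) (fun x => (X i x : TSpace n x)) q))) *
          frameDeriv q X φ i (extChartAt (𝓡 n) q q))) := by
  have := μ.isProbabilityMeasure_cylinderMeasure q
  obtain ⟨T, hT, C, hC, hcont, hexp⟩ := exists_expMap_expansion hX hq hφ
  set m := V.cylinderMeasure q (μ.vert q)
  let ℓ : CSpace n q → ℝ := fun α =>
    ∑ i, α (X i q : TSpace n q) * frameDeriv q X φ i (extChartAt (𝓡 n) q q)
  let R : ℝ → CSpace n q → ℝ := fun t α => φ (S.expMap q t α) - φ q - t * ℓ α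
  have hℓc : Continuous ℓ := continuous_finsetSum _ fun i _ =>
    (continuous_apply_CSpace (X i q : TSpace n q)).mul_const _
  have hℓi : Integrable ℓ m :=
    integrable_finsetSum _ fun i _ => (μ.integrable_apply q _).mul_const _
  -- Without this cancellation the quotient would contain a term of order 1/t.
  have hℓ0 : ∫ α, ℓ α ∂m = 0 := by
    simp only [ℓ]
    rw [integral_finsetSum _ fun i _ => (μ.integrable_apply q _).mul_const _]
    simp [integral_mul_const, μ.integral_horizontal]
  have hae := μ.ae_sum_sq (hX.orth q hq)
  have hs : MeasurableSet {α : CSpace n q | ∑ i, α (X i q : TSpace n q) ^ 2 = 1} := by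
    have hc : Continuous fun α : CSpace n q => ∑ i, α (X i q : TSpace n q) ^ 2 :=
      continuous_finsetSum _ fun i _ => (continuous_apply_CSpace (X i q : TSpace n q)).pow 2
    exact hc.measurable (measurableSet_singleton 1)
  -- Continuity of the exponential map in the covector is known only on the cylinder; it has full
  -- measure, so this gives almost everywhere strong measurability.
  have hmeas : ∀ t ∈ Icc 0 T, AEStronglyMeasurable (R t) m := by
    intro t ht
    have h1 : ContinuousOn (R t) {α : CSpace n q | ∑ i, α (X i q : TSpace n q) ^ 2 = 1} :=
      ((hcont t ht).sub continuousOn_const).sub (continuousOn_const.mul hℓc.continuousOn)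
    have h2 := h1.aestronglyMeasurable (μ := m) hs
    rwa [Measure.restrict_eq_self_of_ae_mem (by exact hae)] at h2
  have hbi : Integrable (fun α : CSpace n q => C * (1 + ‖(show Eucl n →L[ℝ] ℝ from α)‖)) m :=
    ((integrable_const 1).add (μ.integrable_norm q)).const_mul C
  have hRi : ∀ t ∈ Icc 0 T, Integrable (R t) m := by
    intro t ht
    refine Integrable.mono' (hbi.mul_const (t ^ 2)) (hmeas t ht) ?_
    filter_upwards [hae] with α hα
    exact (hexp α hα).1 t ht
  have hq1 : ∀ t ∈ Ioc 0 T, μ.quotient φ q t = 2 * k * ∫ α, R t α / t ^ 2 ∂m := by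
    intro t ht
    have ht' : t ∈ Icc 0 T := ⟨ht.1.le, ht.2⟩
    have e : ∀ α : CSpace n q, φ (S.expMap q t α) - φ q = R t α + t * ℓ α := fun α => by
      simp only [R]; ring
    rw [quotient]
    simp only [e]
    rw [integral_add (hRi t ht') (hℓi.const_mul t), integral_const_mul, hℓ0, integral_div]
    ring
  have hlim : Tendsto (fun t => ∫ α, R t α / t ^ 2 ∂m) (𝓝[>] 0)
      (𝓝 (∫ α, (secondDerivAlong (frameRep q X) (frameDeriv q X φ)
        (extChartAt (𝓡 n) q q, α) / 2) ∂m)) := by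
    refine tendsto_integral_filter_of_dominated_convergence
      (fun α : CSpace n q => C * (1 + ‖(show Eucl n →L[ℝ] ℝ from α)‖)) ?_ ?_ hbi ?_
    · filter_upwards [Ioc_mem_nhdsGT hT] with t ht
      simp only [div_eq_mul_inv]
      exact (hmeas t ⟨ht.1.le, ht.2⟩).mul_const _
    · filter_upwards [Ioc_mem_nhdsGT hT] with t ht
      filter_upwards [hae] with α hα
      have ht2 : 0 < t ^ 2 := pow_pos ht.1 2
      rw [norm_div, Real.norm_of_nonneg ht2.le, div_le_iff₀ ht2]
      exact (hexp α hα).1 t ⟨ht.1.le, ht.2⟩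
    · filter_upwards [hae] with α hα
      exact (hexp α hα).2
  rw [integral_div, μ.integral_secondDerivAlong hX hq] at hlim
  have hk : (k : ℝ) ≠ 0 := Nat.cast_ne_zero.2 (NeZero.ne k)
  refine ((hlim.const_mul (2 * (k : ℝ))).congr' ?_).trans_eq ?_
  · filter_upwards [Ioc_mem_nhdsGT hT] with t ht
    exact (hq1 t ht).symm
  · congr 1
    field_simp

end Structure.Complement

end MicroscopicLimit

/-! ### Trace and alternating forms of top degree -/

section LinearDerivation

variable {R V ι : Type*} [CommRing R] [AddCommGroup V] [Module R V] [Fintype ι] [DecidableEq ι]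

/-- The action of an endomorphism on an alternating form by derivations. -/
def alternatingDerivation (A : V →ₗ[R] V) (θ : V [⋀^ι]→ₗ[R] R) : V [⋀^ι]→ₗ[R] R :=
  { ∑ j, (θ : MultilinearMap R (fun _ : ι => V) R).compLinearMap
      (Function.update (fun _ => LinearMap.id) j A) with
    map_eq_zero_of_eq' := by
      intro v a b hab hne
      have hu : ∀ j, (fun i => (Function.update (fun _ : ι => (LinearMap.id : V →ₗ[R] V)) j A) i
          (v i)) = Function.update v j (A (v j)) := by
        intro j
        ext i
        by_cases h : i = j
        · subst h; simp
        · simp [h]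
      simp only [MultilinearMap.toFun_eq_coe, sum_apply,
        MultilinearMap.compLinearMap_apply, hu, AlternatingMap.coe_multilinearMap]
      -- Every term except those of index `a` and `b` still has two equal arguments. The remaining
      -- two differ by a transposition and cancel.
      rw [Finset.sum_eq_add a b hne]
      · have h1 : Function.update v b (A (v b)) =
            (Function.update v a (A (v a))) ∘ Equiv.swap a b := by
          ext i
          by_cases hia : i = a
          · subst hia; simp [hne, hne.symm, hab]
          · by_cases hib : i = b
            · subst hib; simp [hab]
            · simp [hia, hib, Equiv.swap_apply_of_ne_of_ne hia hib]
        rw [h1, AlternatingMap.map_swap _ _ hne]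
        simp
      · rintro c - ⟨hca, hcb⟩
        exact θ.map_eq_zero_of_eq _ (by simp [hca.symm, hcb.symm, hab]) hne
      · simp
      · simp }

theorem alternatingDerivation_apply (A : V →ₗ[R] V) (θ : V [⋀^ι]→ₗ[R] R) (v : ι → V) :
    alternatingDerivation A θ v = ∑ j, θ (Function.update v j (A (v j))) := by
  have hu : ∀ j, (fun i => (Function.update (fun _ : ι => (LinearMap.id : V →ₗ[R] V)) j A) i
      (v i)) = Function.update v j (A (v j)) := by
    intro j
    ext i
    by_cases h : i = j
    · subst h; simp
    · simp [h]
  change (∑ j, (θ : MultilinearMap R (fun _ : ι => V) R).compLinearMap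
      (Function.update (fun _ => LinearMap.id) j A)) v = _
  simp [hu]

/-- Both sides are alternating of top degree in `v`, hence multiples of the determinant, and it
suffices to compare them on a basis. There only the diagonal entries of the matrix of `A`
contribute. -/
theorem sum_apply_update_eq_trace_mul (e : Module.Basis ι R V) (A : V →ₗ[R] V)
    (θ : V [⋀^ι]→ₗ[R] R) (v : ι → V) :
    ∑ j, θ (Function.update v j (A (v j))) = LinearMap.trace R V A * θ v := by
  have h : alternatingDerivation A θ e = LinearMap.trace R V A * θ e := by
    rw [alternatingDerivation_apply, LinearMap.trace_eq_matrix_trace R e, Matrix.trace,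
      Finset.sum_mul]
    refine Finset.sum_congr rfl fun j _ => ?_
    conv_lhs => rw [← e.sum_repr (A (e j))]
    rw [AlternatingMap.map_update_sum]
    simp only [AlternatingMap.map_update_smul]
    rw [Finset.sum_eq_single j]
    · simp [LinearMap.toMatrix_apply]
    · intro l _ hl
      rw [θ.map_eq_zero_of_eq _ (i := j) (j := l) (by simp [hl]) hl.symm, smul_zero]
    · simp
  rw [← alternatingDerivation_apply, (alternatingDerivation A θ).eq_smul_basis_det e, h]
  conv_rhs => rw [θ.eq_smul_basis_det e]
  simp [mul_assoc]

end LinearDerivation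

/-! ### The divergence in coordinates -/

section Divergence

variable {n k : ℕ} {M : Type*} [TopologicalSpace M] [ChartedSpace (Eucl n) M]
  [IsManifold (𝓡 n) ∞ M]

/-- The determinant, as a continuous alternating form. -/
def detForm (n : ℕ) : Eucl n [⋀^Fin n]→L[ℝ] ℝ :=
  { (EuclideanSpace.basisFun (Fin n) ℝ).toBasis.det with
    cont := by
      change Continuous fun v : Fin n → Eucl n =>
        ((EuclideanSpace.basisFun (Fin n) ℝ).toBasis.toMatrix v).det
      refine Continuous.matrix_det (continuous_matrix fun i j => ?_)
      have : ∀ v : Fin n → Eucl n,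
          (EuclideanSpace.basisFun (Fin n) ℝ).toBasis.toMatrix v i j = v j i := by
        intro v; simp [Module.Basis.toMatrix_apply]
      simp only [this]
      fun_prop }

theorem detForm_apply (v : Fin n → Eucl n) :
    detForm n v = (EuclideanSpace.basisFun (Fin n) ℝ).toBasis.det v := rfl

namespace VolumeForm

variable (Ω : VolumeForm n M)

/-- The density of a volume form in the preferred chart at `c`. -/
def density (c : M) (x : Eucl n) : ℝ :=
  Ω.toFun ((extChartAt (𝓡 n) c).symm x) fun i =>
    dChartInv c ((extChartAt (𝓡 n) c).symm x) (EuclideanSpace.basisFun (Fin n) ℝ i)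

theorem apply_eq_density_mul {c p : M} (hp : p ∈ (extChartAt (𝓡 n) c).source)
    (Y : Fin n → TSpace n p) :
    Ω.toFun p Y = Ω.density c (extChartAt (𝓡 n) c p) * detForm n fun i => dChart c p (Y i) := by
  have hl : (extChartAt (𝓡 n) c).symm (extChartAt (𝓡 n) c p) = p := (extChartAt (𝓡 n) c).left_inv hp
  have h := AlternatingMap.eq_smul_basis_det (EuclideanSpace.basisFun (Fin n) ℝ).toBasis
    ((Ω.toFun p).compLinearMap (dChartInv (n := n) c p).toLinearMap)
  have h2 := congrArg (fun f => f fun i => dChart c p (Y i)) h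
  simp only [AlternatingMap.compLinearMap_apply, ContinuousLinearMap.coe_coe,
    AlternatingMap.smul_apply, smul_eq_mul] at h2
  have h3 : (fun i => dChartInv c p (dChart c p (Y i))) = Y := by
    ext1 i; exact dChartInv_dChart hp _
  have h4 : ∀ p', p' = p → Ω.toFun p' (fun i => dChartInv c p' (EuclideanSpace.basisFun (Fin n) ℝ i))
      = Ω.toFun p (fun i => dChartInv c p (EuclideanSpace.basisFun (Fin n) ℝ i)) := by
    rintro _ rfl; rfl
  rw [density, h4 _ hl, detForm_apply]
  simp only [OrthonormalBasis.coe_toBasis] at h2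
  rw [← h2]
  exact congrArg _ h3.symm

theorem smoothFieldOn_dChartInv (c : M) (v : Eucl n) :
    SmoothFieldOn (fun p : M => dChartInv c p v) (extChartAt (𝓡 n) c).source := by
  refine smoothFieldOn_of_forall_contDiffAt (isOpen_extChartAt_source c) c le_rfl ?_
  refine (contDiffOn_const (c := v)).congr fun x hx => ?_
  exact dChart_dChartInv ((extChartAt (𝓡 n) c).map_target hx.1) v

theorem contDiffOn_density (c : M) : ContDiffOn ℝ ∞ (Ω.density c) (extChartAt (𝓡 n) c).target := by
  rw [← contMDiffOn_iff_contDiffOn]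
  exact (Ω.smooth _ (isOpen_extChartAt_source c) _
    (fun i => smoothFieldOn_dChartInv c (EuclideanSpace.basisFun (Fin n) ℝ i))).comp
    (contMDiffOn_extChartAt_symm c) fun x hx => (extChartAt (𝓡 n) c).map_target hx

theorem contDiffAt_density (q : M) : ContDiffAt ℝ ∞ (Ω.density q) (extChartAt (𝓡 n) q q) :=
  (Ω.contDiffOn_density q).contDiffAt
    ((isOpen_extChartAt_target q).mem_nhds (mem_extChartAt_target q))

theorem density_ne_zero (q : M) : Ω.density q (extChartAt (𝓡 n) q q) ≠ 0 := by
  intro h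
  apply Ω.ne_zero q
  ext Y
  rw [Ω.apply_eq_density_mul (mem_extChartAt_source q), h, zero_mul]
  rfl

/-- The divergence at `q` in the preferred chart at `q`. -/
def coordDivergence (Z : ∀ q : M, TSpace n q) (q : M) : ℝ :=
  fderiv ℝ (Ω.density q) (extChartAt (𝓡 n) q q) (Z q) / Ω.density q (extChartAt (𝓡 n) q q) +
    LinearMap.trace ℝ (Eucl n)
      (fderiv ℝ (fieldRep q Z) (extChartAt (𝓡 n) q q) : Eucl n →ₗ[ℝ] Eucl n)

/-- With Ω = w · det in the chart, the product rule for w · det(Y_1, …, Y_n) produces the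
derivatives of the Y_i along Z, which cancel against the brackets. What remains is dw(Z) det(Y) and
w ∑ det(…, DZ(Y_i), …), that is, the trace of DZ. Both sides use the same `fderiv` of the
representative of `Z`, so `Z` need not be differentiable. -/
theorem lieDerivative_eq (Z : ∀ q : M, TSpace n q) {U : Set M} (hU : IsOpen U) {q : M} (hq : q ∈ U)
    {Y : Fin n → ∀ x : M, TSpace n x} (hY : ∀ i, SmoothFieldOn (Y i) U) :
    Ω.lieDerivative Z Y q = Ω.coordDivergence Z q * Ω.toFun q fun i => Y i q := by
  set x := extChartAt (𝓡 n) q q with hx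
  set w := Ω.density q x with hw
  have hw0 : w ≠ 0 := Ω.density_ne_zero q
  have hs := mem_extChartAt_source (I := 𝓡 n) q
  let y : Fin n → Eucl n := fun i => Y i q
  have hΩ : ∀ Y' : Fin n → TSpace n q, Ω.toFun q Y' = w * detForm n Y' := by
    intro Y'
    rw [Ω.apply_eq_density_mul hs]
    congr 2
    ext1 i
    exact dChart_self q _
  have hmd : MDifferentiableAt (𝓡 n) 𝓘(ℝ, ℝ) (fun x => Ω.toFun x fun i => Y i x) q :=
    ((Ω.smooth U hU Y hY).contMDiffAt (hU.mem_nhds hq)).mdifferentiableAt (by simp)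
  have hloc : ((fun x => Ω.toFun x fun i => Y i x) ∘ (extChartAt (𝓡 n) q).symm) =ᶠ[𝓝 x]
      fun x => Ω.density q x * detForm n fun i => fieldRep q (Y i) x := by
    filter_upwards [(isOpen_extChartAt_target (I := 𝓡 n) q).mem_nhds (mem_extChartAt_target q)]
      with x' hx'
    have hr : extChartAt (𝓡 n) q ((extChartAt (𝓡 n) q).symm x') = x' :=
      (extChartAt (𝓡 n) q).right_inv hx'
    change Ω.toFun _ _ = _
    rw [Ω.apply_eq_density_mul ((extChartAt (𝓡 n) q).map_target hx'), hr]
    rfl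
  have hYd : ∀ i, HasFDerivAt (fieldRep q (Y i)) (fderiv ℝ (fieldRep q (Y i)) x) x := fun i =>
    ((contDiffAt_fieldRep hU (hY i) hq hs).differentiableAt (by simp)).hasFDerivAt
  have hdet := (hasFDerivAt_const (detForm n) x).continuousAlternatingMap_apply hYd
  have hden : HasFDerivAt (fun x => Ω.density q x * detForm n fun i => fieldRep q (Y i) x) _ x :=
    (show HasFDerivAt (Ω.density q) (fderiv ℝ (Ω.density q) x) x from
      ((Ω.contDiffAt_density q).differentiableAt (by simp)).hasFDerivAt).mul hdet
  have hself : ∀ i, fieldRep q (Y i) x = y i := fun i => fieldRep_self q _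
  have hden' : ∀ z : Eucl n,
      fderiv ℝ (fun x => Ω.density q x * detForm n fun i => fieldRep q (Y i) x) x z =
        w * ∑ i, detForm n (Function.update y i (fderiv ℝ (fieldRep q (Y i)) x z)) +
          detForm n y * fderiv ℝ (Ω.density q) x z := by
    intro z
    rw [hden.fderiv]
    simp only [hself]
    simp [hw, sum_apply]
  have h1 : dFun (fun x => Ω.toFun x fun i => Y i x) q (Z q) =
      w * ∑ i, detForm n (Function.update y i (fderiv ℝ (fieldRep q (Y i)) x (Z q))) +
        detForm n y * fderiv ℝ (Ω.density q) x (Z q) := by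
    rw [dFun_eq hmd hs, dChart_self, hloc.fderiv_eq]
    exact hden' _
  have h2 : ∀ i, Ω.toFun q (Function.update (fun j => Y j q) i
      (VectorField.mlieBracket (𝓡 n) Z (Y i) q)) =
      w * detForm n (Function.update y i (fderiv ℝ (fieldRep q (Y i)) x (Z q))) -
      w * detForm n (Function.update y i (fderiv ℝ (fieldRep q Z) x (y i))) := by
    intro i
    rw [hΩ, mlieBracket_eq, ← mul_sub]
    congr 1
    exact (detForm n).map_update_sub y i _ _
  have h3 := sum_apply_update_eq_trace_mul (EuclideanSpace.basisFun (Fin n) ℝ).toBasis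
    (fderiv ℝ (fieldRep q Z) x : Eucl n →ₗ[ℝ] Eucl n)
    (EuclideanSpace.basisFun (Fin n) ℝ).toBasis.det y
  simp only [← detForm_apply, ContinuousLinearMap.coe_coe] at h3
  rw [lieDerivative, h1, Finset.sum_congr rfl fun i _ => h2 i, Finset.sum_sub_distrib,
    ← Finset.mul_sum, ← Finset.mul_sum, h3, coordDivergence, hΩ]
  change w * _ + detForm n y * _ - _ = (_ / w + _) * (w * detForm n y)
  field_simp
  ring

/-- `divergence` is tested on globally defined fields only. Cut-off coordinate fields show that this
still determines the number. -/
theorem exists_global_frame [T2Space M] (q : M) :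
    ∃ Y : Fin n → ∀ x : M, TSpace n x, (∀ i, SmoothFieldOn (Y i) univ) ∧
      Ω.toFun q (fun i => Y i q) ≠ 0 := by
  obtain ⟨f⟩ : Nonempty (SmoothBumpFunction (𝓡 n) q) := inferInstance
  refine ⟨fun i x => f x • dChartInv q x (EuclideanSpace.basisFun (Fin n) ℝ i), fun i => ?_, ?_⟩
  · have h := smoothFieldOn_dChartInv q (EuclideanSpace.basisFun (Fin n) ℝ i)
    intro x _
    by_cases hx : x ∈ (extChartAt (𝓡 n) q).source
    · have hn := (isOpen_extChartAt_source (I := 𝓡 n) q).mem_nhds hx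
      exact ((SmoothFieldOn.smul (f.contMDiff.contMDiffOn) h).contMDiffAt hn).contMDiffWithinAt
    · have hx' : x ∈ (tsupport f)ᶜ := fun h' => hx (f.tsupport_subset_extChartAt_source h')
      have hn : (tsupport f)ᶜ ∈ 𝓝 x := (isClosed_tsupport f).isOpen_compl.mem_nhds hx'
      have h0 : SmoothFieldOn (fun x : M => (0 : TSpace n x)) univ :=
        contMDiff_zeroSection ℝ (fun x : M => TangentSpace (𝓡 n) x) |>.contMDiffOn
      refine ((h0.contMDiffAt univ_mem).congr_of_eventuallyEq ?_).contMDiffWithinAt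
      filter_upwards [hn] with z hz
      rw [image_eq_zero_of_notMem_tsupport hz, zero_smul]
  · have h : ∀ i, f q • dChartInv q q (EuclideanSpace.basisFun (Fin n) ℝ i) =
        dChartInv q q (EuclideanSpace.basisFun (Fin n) ℝ i) := fun i => by
      rw [f.eq_one, one_smul]
    simp only [h]
    have := Ω.density_ne_zero q
    rw [density] at this
    have e : ∀ p, p = q → Ω.toFun p (fun i => dChartInv q p (EuclideanSpace.basisFun (Fin n) ℝ i))
        ≠ 0 → Ω.toFun q (fun i => dChartInv q q (EuclideanSpace.basisFun (Fin n) ℝ i)) ≠ 0 := by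
      rintro _ rfl h; exact h
    exact e _ ((extChartAt (𝓡 n) q).left_inv (mem_extChartAt_source q)) this

theorem divergence_eq [T2Space M] (Z : ∀ q : M, TSpace n q) (q : M) :
    Ω.divergence Z q = Ω.coordDivergence Z q := by
  have h := Classical.epsilon_spec (p := fun c : ℝ => ∀ Y : Fin n → ∀ x : M, TSpace n x,
    (∀ i, SmoothFieldOn (Y i) univ) → Ω.lieDerivative Z Y q = c * Ω.toFun q (fun i => Y i q))
    ⟨_, fun Y hY => Ω.lieDerivative_eq Z isOpen_univ (mem_univ q) hY⟩
  obtain ⟨Y, hY, h0⟩ := Ω.exists_global_frame q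
  have h1 := h Y hY
  rw [Ω.lieDerivative_eq Z isOpen_univ (mem_univ q) hY] at h1
  exact (mul_right_cancel₀ h0 h1).symm

end VolumeForm

end Divergence

/-! ### The pointwise equations equivalent to equality of the Laplacians -/

section Criterion

variable {n k : ℕ} {M : Type*} [TopologicalSpace M] [ChartedSpace (Eucl n) M]
  [IsManifold (𝓡 n) ∞ M] {S : Structure n k M}

namespace Structure

theorem fieldRep_grad_eventuallyEq {U : Set M} {X : Fin k → ∀ x : M, S.D x}
    (hX : S.IsOrthoFrame U X) {q : M} (hq : q ∈ U) {φ : M → ℝ}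
    (hφ : ContMDiff (𝓡 n) 𝓘(ℝ, ℝ) ∞ φ) :
    fieldRep q (S.grad φ) =ᶠ[𝓝 (extChartAt (𝓡 n) q q)]
      fun x => ∑ i, frameDeriv q X φ i x • frameRep q X i x := by
  have hmem : extChartAt (𝓡 n) q q ∈
      (extChartAt (𝓡 n) q).target ∩ (extChartAt (𝓡 n) q).symm ⁻¹' U :=
    ⟨mem_extChartAt_target q, by
      rw [mem_preimage, (extChartAt (𝓡 n) q).left_inv (mem_extChartAt_source q)]; exact hq⟩
  filter_upwards [(isOpen_chart_inter (n := n) q hX.isOpen).mem_nhds hmem] with x hx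
  set p := (extChartAt (𝓡 n) q).symm x with hp
  have hs : p ∈ (extChartAt (𝓡 n) q).source := (extChartAt (𝓡 n) q).map_target hx.1
  have hr : extChartAt (𝓡 n) q p = x := (extChartAt (𝓡 n) q).right_inv hx.1
  have hmd : MDifferentiableAt (𝓡 n) 𝓘(ℝ, ℝ) φ p := hφ.mdifferentiableAt (by simp)
  have h1 : ∀ i, dFun φ p (X i p : TSpace n p) = frameDeriv q X φ i x := by
    intro i
    rw [dFun_eq hmd hs, hr]
    rfl
  change dChart q p (S.sharp p (dFun φ p) : TSpace n p) = _
  rw [sharp_eq_of_orth (hX.orth p hx.2)]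
  simp only [h1, Submodule.coe_sum, Submodule.coe_smul, map_sum, map_smul]
  rfl

/-- Near q the gradient is ∑ (X_iφ) X_i, and div(hX) = h div X + Xh, where Xh is the trace of the
rank-one map v ↦ dh(v) X. -/
theorem macroLaplacian_eq [T2Space M] (Ω : VolumeForm n M) {U : Set M}
    {X : Fin k → ∀ x : M, S.D x} (hX : S.IsOrthoFrame U X) {q : M} (hq : q ∈ U) {φ : M → ℝ}
    (hφ : ContMDiff (𝓡 n) 𝓘(ℝ, ℝ) ∞ φ) :
    S.macroLaplacian Ω φ q =
      ∑ i, fderiv ℝ (frameDeriv q X φ i) (extChartAt (𝓡 n) q q) (X i q : TSpace n q) +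
        ∑ i, Ω.coordDivergence (fun x => (X i x : TSpace n x)) q *
          frameDeriv q X φ i (extChartAt (𝓡 n) q q) := by
  have hs := mem_extChartAt_source (I := 𝓡 n) q
  set x := extChartAt (𝓡 n) q q with hx
  have hmem : x ∈ (extChartAt (𝓡 n) q).target ∩ (extChartAt (𝓡 n) q).symm ⁻¹' U :=
    ⟨mem_extChartAt_target q, by
      rw [mem_preimage, (extChartAt (𝓡 n) q).left_inv hs]; exact hq⟩
  have hF : ∀ i, HasFDerivAt (frameRep q X i) (fderiv ℝ (frameRep q X i) x) x := fun i =>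
    ((hX.contDiffAt_frameRep hq hs i).differentiableAt (by simp)).hasFDerivAt
  have hh : ∀ i, HasFDerivAt (frameDeriv q X φ i) (fderiv ℝ (frameDeriv q X φ i) x) x := fun i =>
    (((hX.contDiffOn_frameDeriv hφ q i).contDiffAt
      ((isOpen_chart_inter (n := n) q hX.isOpen).mem_nhds hmem)).differentiableAt
        (by simp)).hasFDerivAt
  have hd : HasFDerivAt (fun x => ∑ i, frameDeriv q X φ i x • frameRep q X i x) _ x :=
    HasFDerivAt.fun_sum fun i _ => (hh i).smul (hF i)
  have hself : ∀ i, frameRep q X i x = (X i q : TSpace n q) := fun i => fieldRep_self q _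
  have hfd := (fieldRep_grad_eventuallyEq hX hq hφ).fderiv_eq.trans hd.fderiv
  have hgrad : (show Eucl n from S.grad φ q) = ∑ i, frameDeriv q X φ i x • frameRep q X i x :=
    (fieldRep_self q (S.grad φ)).symm.trans (fieldRep_grad_eventuallyEq hX hq hφ).self_of_nhds
  rw [macroLaplacian, Ω.divergence_eq]
  simp only [VolumeForm.coordDivergence]
  change fderiv ℝ (Ω.density q) x (show Eucl n from S.grad φ q) / _ + LinearMap.trace ℝ (Eucl n)
    (fderiv ℝ (fieldRep q (S.grad φ)) x : Eucl n →ₗ[ℝ] Eucl n) = _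
  have htr : LinearMap.trace ℝ (Eucl n)
      (fderiv ℝ (fieldRep q (S.grad φ)) x : Eucl n →ₗ[ℝ] Eucl n) =
      ∑ i, (frameDeriv q X φ i x * LinearMap.trace ℝ (Eucl n)
        (fderiv ℝ (frameRep q X i) x : Eucl n →ₗ[ℝ] Eucl n) +
          fderiv ℝ (frameDeriv q X φ i) x (frameRep q X i x)) := by
    have e : (fderiv ℝ (fieldRep q (S.grad φ)) x : Eucl n →ₗ[ℝ] Eucl n) =
        ∑ i, (frameDeriv q X φ i x • (fderiv ℝ (frameRep q X i) x : Eucl n →ₗ[ℝ] Eucl n) +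
          (fderiv ℝ (frameDeriv q X φ i) x : Eucl n →ₗ[ℝ] ℝ).smulRight (frameRep q X i x)) := by
      rw [hfd]
      ext v : 1
      simp
    rw [e]
    simp only [map_sum, map_add, map_smul, LinearMap.trace_smulRight, smul_eq_mul,
      ContinuousLinearMap.coe_coe]
  rw [htr, hgrad, map_sum, Finset.sum_div, ← Finset.sum_add_distrib, ← Finset.sum_add_distrib]
  refine Finset.sum_congr rfl fun i _ => ?_
  rw [map_smul, smul_eq_mul, hself]
  change _ = fderiv ℝ (frameDeriv q X φ i) x (X i q : TSpace n q) +
    (fderiv ℝ (Ω.density q) x (X i q : TSpace n q) / Ω.density q x + LinearMap.trace ℝ (Eucl n)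
      (fderiv ℝ (frameRep q X i) x : Eucl n →ₗ[ℝ] Eucl n)) * frameDeriv q X φ i x
  ring

variable (S) in
/-- The equations for a projection on the distribution at `q`, in a frame, that characterize the
equality of the microscopic and the macroscopic Laplacian. -/
def SolvesAt (Ω : VolumeForm n M) (X : Fin k → ∀ x : M, S.D x) (q : M)
    (ρ : TSpace n q →ₗ[ℝ] S.D q) : Prop :=
  ∀ i, Ω.coordDivergence (fun x => (X i x : TSpace n x)) q =
    ∑ j, S.g q (X j q) (ρ (VectorField.mlieBracket (𝓡 n)
      (fun x => (X j x : TSpace n x)) (fun x => (X i x : TSpace n x)) q))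

variable (S) in
/-- The value at `q` of the microscopic Laplacian in a frame. -/
def frameOperator (X : Fin k → ∀ x : M, S.D x) (q : M) (ρ : TSpace n q →ₗ[ℝ] S.D q) (φ : M → ℝ) :
    ℝ :=
  ∑ i, fderiv ℝ (frameDeriv q X φ i) (extChartAt (𝓡 n) q q) (X i q : TSpace n q) +
    ∑ i, (∑ j, S.g q (X j q) (ρ (VectorField.mlieBracket (𝓡 n)
      (fun x => (X j x : TSpace n x)) (fun x => (X i x : TSpace n x)) q))) *
      frameDeriv q X φ i (extChartAt (𝓡 n) q q)

/-- The k covectors g(b_a, ρ ·) replace the average over the cylinder: their second moments are the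
same as those of k times an adapted measure whenever one factor is horizontal. -/
theorem frameOperator_eq_sum_secondDerivAlong {U : Set M} {X : Fin k → ∀ x : M, S.D x}
    (hX : S.IsOrthoFrame U X) {q : M} (hq : q ∈ U) {ρ : TSpace n q →ₗ[ℝ] S.D q}
    (hρ : ∀ v : S.D q, ρ (v : TSpace n q) = v) (φ : M → ℝ) {b : Fin k → S.D q}
    (hb : ∀ i j, S.g q (b i) (b j) = if i = j then 1 else 0) :
    S.frameOperator X q ρ φ = ∑ a, secondDerivAlong (frameRep q X) (frameDeriv q X φ)
      (extChartAt (𝓡 n) q q, LinearMap.toContinuousLinearMap (S.g q (b a) ∘ₗ ρ)) := by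
  have hF : ∀ i, frameRep q X i (extChartAt (𝓡 n) q q) = (X i q : TSpace n q) := fun i =>
    fieldRep_self q _
  have hbr : ∀ i j, bracketAt (frameRep q X) (extChartAt (𝓡 n) q q) j i =
      VectorField.mlieBracket (𝓡 n) (fun x => (X j x : TSpace n x))
        (fun x => (X i x : TSpace n x)) q := by
    intro i j
    rw [mlieBracket_eq, bracketAt, hF, hF]
    rfl
  have h1 : ∀ a, secondDerivAlong (frameRep q X) (frameDeriv q X φ)
      (extChartAt (𝓡 n) q q, LinearMap.toContinuousLinearMap (S.g q (b a) ∘ₗ ρ)) =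
      ∑ i, ∑ j, (S.g q (b a) (X j q) * S.g q (b a) (ρ (VectorField.mlieBracket (𝓡 n)
        (fun x => (X j x : TSpace n x)) (fun x => (X i x : TSpace n x)) q)) *
          frameDeriv q X φ i (extChartAt (𝓡 n) q q) +
        S.g q (b a) (X i q) * S.g q (b a) (X j q) *
          fderiv ℝ (frameDeriv q X φ i) (extChartAt (𝓡 n) q q) (X j q : TSpace n q)) := by
    intro a
    have hv : ∀ i, S.g q (b a) (X i q) = (S.g q (b a) ∘ₗ ρ) (X i q : TSpace n q) := fun i => by
      rw [LinearMap.comp_apply, hρ]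
    simp only [secondDerivAlong, hbr, hF, hv]
    rfl
  rw [Finset.sum_congr rfl fun a _ => h1 a, Finset.sum_comm]
  rw [frameOperator, ← Finset.sum_add_distrib]
  refine Finset.sum_congr rfl fun i _ => ?_
  rw [Finset.sum_comm]
  simp only [Finset.sum_add_distrib, ← Finset.sum_mul, ← g_eq_sum_of_orth hb, hX.orth q hq]
  rw [add_comm]
  congr 1
  rw [Finset.sum_eq_single i]
  · rw [if_pos rfl, one_mul]
  · intro j _ hj
    rw [if_neg hj.symm, zero_mul]
  · simp

/-- Each summand of the previous formula is twice the limit of a Taylor quotient of φ ∘ exp_q, an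
expression that involves no frame. Independence of the frame follows from uniqueness of limits,
without transformation rules for brackets. -/
theorem frameOperator_congr [T2Space M] {U U' : Set M} {X X' : Fin k → ∀ x : M, S.D x}
    (hX : S.IsOrthoFrame U X) (hX' : S.IsOrthoFrame U' X') {q : M} (hq : q ∈ U) (hq' : q ∈ U')
    {ρ : TSpace n q →ₗ[ℝ] S.D q} (hρ : ∀ v : S.D q, ρ (v : TSpace n q) = v) {φ : M → ℝ}
    (hφ : ContMDiff (𝓡 n) 𝓘(ℝ, ℝ) ∞ φ) :
    S.frameOperator X q ρ φ = S.frameOperator X' q ρ φ := by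
  have hb := S.onb_spec q
  rw [frameOperator_eq_sum_secondDerivAlong hX hq hρ φ hb,
    frameOperator_eq_sum_secondDerivAlong hX' hq' hρ φ hb]
  refine Finset.sum_congr rfl fun a _ => ?_
  set p : Eucl n →L[ℝ] ℝ := LinearMap.toContinuousLinearMap (S.g q (S.onb q a) ∘ₗ ρ)
  have hs := mem_extChartAt_source (I := 𝓡 n) q
  have hmd : MDifferentiableAt (𝓡 n) 𝓘(ℝ, ℝ) φ q := hφ.mdifferentiableAt (by simp)
  have key : ∀ {U : Set M} {X : Fin k → ∀ x : M, S.D x}, S.IsOrthoFrame U X → q ∈ U →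
      ∑ i, p (X i q : TSpace n q) ^ 2 = 1 ∧
      ∑ i, p (X i q : TSpace n q) * frameDeriv q X φ i (extChartAt (𝓡 n) q q) =
        dFun φ q (S.onb q a : TSpace n q) := by
    intro U X hX hq
    have hp : ∀ i, p (X i q : TSpace n q) = S.g q (X i q) (S.onb q a) := by
      intro i
      change S.g q (S.onb q a) (ρ (X i q : TSpace n q)) = _
      rw [hρ, S.symm]
    simp only [hp]
    constructor
    · simp only [sq]
      rw [← g_eq_sum_of_orth (hX.orth q hq), hb, if_pos rfl]
    · have h1 : ∀ i, frameDeriv q X φ i (extChartAt (𝓡 n) q q) =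
          dFun φ q (X i q : TSpace n q) := by
        intro i
        rw [dFun_eq hmd hs, dChart_self, frameDeriv]
        congr 1
        exact fieldRep_self q _
      simp only [h1]
      conv_rhs => rw [eq_sum_of_orth (hX.orth q hq) (S.onb q a)]
      simp
  obtain ⟨T, -, C, -, -, h⟩ := exists_expMap_expansion hX hq hφ
  obtain ⟨T', -, C', -, -, h'⟩ := exists_expMap_expansion hX' hq' hφ
  have l := (h p (key hX hq).1).2
  have l' := (h' p (key hX' hq').1).2
  rw [(key hX hq).2] at l
  rw [(key hX' hq').2] at l'
  have := tendsto_nhds_unique l l'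
  linarith

/-- The two operators have the same second-order part, so their equality is an equality of
first-order coefficients, which suitable test functions separate. -/
theorem solvesAt_iff [T2Space M] {Ω : VolumeForm n M} {U : Set M} {X : Fin k → ∀ x : M, S.D x}
    (hX : S.IsOrthoFrame U X) {q : M} (hq : q ∈ U) {ρ : TSpace n q →ₗ[ℝ] S.D q}
    (hρ : ∀ v : S.D q, ρ (v : TSpace n q) = v) :
    S.SolvesAt Ω X q ρ ↔ ∀ φ : M → ℝ, ContMDiff (𝓡 n) 𝓘(ℝ, ℝ) ∞ φ → HasCompactSupport φ →
      S.macroLaplacian Ω φ q = S.frameOperator X q ρ φ := by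
  constructor
  · intro h φ hφ _
    rw [macroLaplacian_eq Ω hX hq hφ, frameOperator]
    simp only [h _]
  intro h i
  obtain ⟨f⟩ : Nonempty (SmoothBumpFunction (𝓡 n) q) := inferInstance
  let ℓ : Eucl n →L[ℝ] ℝ := LinearMap.toContinuousLinearMap (S.g q (X i q) ∘ₗ ρ)
  -- A compactly supported function that is the linear form g(X_i, ρ ·) in the chart near `q`, so
  -- that X_jφ(q) = δ_ij selects the i-th equation.
  let φ : M → ℝ := fun p => f p • ℓ (extChartAt (𝓡 n) q p)
  have hφ : ContMDiff (𝓡 n) 𝓘(ℝ, ℝ) ∞ φ :=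
    f.contMDiff_smul (ℓ.contDiff.contMDiff.comp_contMDiffOn (contMDiffOn_extChartAt (x := q)))
  have hφc : HasCompactSupport φ := f.hasCompactSupport.smul_right
  have hloc : φ ∘ (extChartAt (𝓡 n) q).symm =ᶠ[𝓝 (extChartAt (𝓡 n) q q)] ℓ := by
    have h1 : Tendsto (extChartAt (𝓡 n) q).symm (𝓝 (extChartAt (𝓡 n) q q)) (𝓝 q) := by
      have := continuousAt_extChartAt_symm (I := 𝓡 n) q
      rwa [ContinuousAt, (extChartAt (𝓡 n) q).left_inv (mem_extChartAt_source q)] at this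
    filter_upwards [h1.eventually f.eventuallyEq_one,
      (isOpen_extChartAt_target (I := 𝓡 n) q).mem_nhds (mem_extChartAt_target q)] with x hx hx'
    have hr : extChartAt (𝓡 n) q ((extChartAt (𝓡 n) q).symm x) = x :=
      (extChartAt (𝓡 n) q).right_inv hx'
    change f _ • ℓ (extChartAt (𝓡 n) q ((extChartAt (𝓡 n) q).symm x)) = ℓ x
    rw [hr, hx, Pi.one_apply, one_smul]
  have hd : ∀ j, frameDeriv q X φ j (extChartAt (𝓡 n) q q) = if i = j then 1 else 0 := by
    intro j
    have hself : frameRep q X j (extChartAt (𝓡 n) q q) = (X j q : TSpace n q) := fieldRep_self q _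
    rw [frameDeriv, hloc.fderiv_eq, ContinuousLinearMap.fderiv, hself, ← hX.orth q hq]
    change S.g q (X i q) (ρ (X j q : TSpace n q)) = _
    rw [hρ]
  have := h φ hφ hφc
  rw [macroLaplacian_eq Ω hX hq hφ, frameOperator] at this
  simpa only [hd, mul_ite, mul_one, mul_zero, Finset.sum_ite_eq, Finset.mem_univ, if_true,
    add_right_inj] using this

theorem SolvesAt.congr [T2Space M] {Ω : VolumeForm n M} {U U' : Set M}
    {X X' : Fin k → ∀ x : M, S.D x} {q : M} {ρ : TSpace n q →ₗ[ℝ] S.D q}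
    (h : S.SolvesAt Ω X q ρ) (hX : S.IsOrthoFrame U X) (hX' : S.IsOrthoFrame U' X') (hq : q ∈ U)
    (hq' : q ∈ U') (hρ : ∀ v : S.D q, ρ (v : TSpace n q) = v) : S.SolvesAt Ω X' q ρ :=
  (solvesAt_iff hX' hq' hρ).2 fun φ hφ hφc => by
    rw [(solvesAt_iff hX hq hρ).1 h φ hφ hφc, frameOperator_congr hX hX' hq hq' hρ hφ]

/-- The equations characterize the complements for which the two Laplacians agree. -/
theorem Complement.AdaptedMeasure.compatible_iff [NeZero k] [T2Space M] {V : S.Complement}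
    {Ω : VolumeForm n M} (μ : V.AdaptedMeasure) :
    μ.Compatible Ω ↔
      ∀ q U X, S.IsOrthoFrame U X → q ∈ U → S.SolvesAt Ω X q (V.proj q) := by
  constructor
  · intro h q U X hX hq
    rw [solvesAt_iff hX hq (V.proj_of_mem q)]
    intro φ hφ hφc
    exact tendsto_nhds_unique (h φ hφ hφc q) (μ.tendsto_quotient hX hq hφ)
  · intro h φ hφ hφc q
    obtain ⟨U, X, hq, hX⟩ := S.exists_isOrthoFrame q
    rw [(solvesAt_iff hX hq (V.proj_of_mem q)).1 (h q U X hX hq) φ hφ hφc]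
    exact μ.tendsto_quotient hX hq hφ

end Structure

end Criterion

/-! ### Smooth one-forms and the exterior derivative -/

section Forms

variable {n : ℕ} {M : Type*} [TopologicalSpace M] [ChartedSpace (Eucl n) M]
  [IsManifold (𝓡 n) ∞ M]

theorem SmoothFormOn.apply {η : ∀ q : M, CSpace n q} {U : Set M} (hη : SmoothFormOn η U)
    {Y : ∀ q : M, TSpace n q} (hY : SmoothFieldOn Y U) :
    ContMDiffOn (𝓡 n) 𝓘(ℝ, ℝ) ∞ (fun q => η q (Y q)) U := by
  have h : ContMDiffOn (𝓡 n) ((𝓡 n).prod 𝓘(ℝ, ℝ)) ∞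
      (fun q => TotalSpace.mk' ℝ (E := Bundle.Trivial M ℝ) q (η q (Y q))) U :=
    ContMDiffOn.clm_bundle_apply (E₂ := Bundle.Trivial M ℝ) (F₂ := ℝ) hη hY
  intro x hx
  exact (contMDiffWithinAt_totalSpace.1 (h x hx)).2

theorem eq_sum_smulRight_basisFun {F : Type*} [NormedAddCommGroup F] [NormedSpace ℝ F]
    (L : Eucl n →L[ℝ] F) :
    L = ∑ i, (ContinuousLinearMap.smulRightL ℝ (Eucl n) F (EuclideanSpace.proj i)
      (L (EuclideanSpace.basisFun (Fin n) ℝ i))) := by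
  ext v
  conv_lhs => rw [← (EuclideanSpace.basisFun (Fin n) ℝ).sum_repr v]
  simp [sum_apply]

theorem SmoothFormOn.contDiffOn_coord {η : ∀ q : M, CSpace n q} {U : Set M}
    (hη : SmoothFormOn η U) (c : M) :
    ContDiffOn ℝ ∞ (fun x : Eucl n =>
      ((η ((extChartAt (𝓡 n) c).symm x)).comp (dChartInv c ((extChartAt (𝓡 n) c).symm x)) :
        Eucl n →L[ℝ] ℝ)) ((extChartAt (𝓡 n) c).target ∩ (extChartAt (𝓡 n) c).symm ⁻¹' U) := by
  have h : ∀ i, ContDiffOn ℝ ∞ (fun x : Eucl n => η ((extChartAt (𝓡 n) c).symm x)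
      (dChartInv c ((extChartAt (𝓡 n) c).symm x) (EuclideanSpace.basisFun (Fin n) ℝ i)))
      ((extChartAt (𝓡 n) c).target ∩ (extChartAt (𝓡 n) c).symm ⁻¹' U) := by
    intro i
    rw [← contMDiffOn_iff_contDiffOn]
    have h1 : ContMDiffOn (𝓡 n) 𝓘(ℝ, ℝ) ∞ (fun q => η q
        (dChartInv c q (EuclideanSpace.basisFun (Fin n) ℝ i)))
        (U ∩ (extChartAt (𝓡 n) c).source) :=
      SmoothFormOn.apply (hη.mono inter_subset_left)
        (SmoothFieldOn.mono (VolumeForm.smoothFieldOn_dChartInv c _) inter_subset_right)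
    exact h1.comp ((contMDiffOn_extChartAt_symm c).mono inter_subset_left)
      fun x hx => ⟨hx.2, (extChartAt (𝓡 n) c).map_target hx.1⟩
  have h2 := ContDiffOn.sum (s := Finset.univ) fun i _ =>
    ((ContinuousLinearMap.smulRightL ℝ (Eucl n) ℝ (EuclideanSpace.proj i)).contDiff (n := ∞)).comp_contDiffOn (h i)
  refine h2.congr fun x _ => ?_
  exact eq_sum_smulRight_basisFun _

/-- For vector fields in the kernel of a one-form, its exterior derivative is given by their
bracket. -/
theorem extDer_apply_of_eq_zero {η : ∀ q : M, CSpace n q} {U : Set M} (hU : IsOpen U)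
    (hη : SmoothFormOn η U) {X Y : ∀ q : M, TSpace n q} (hX : SmoothFieldOn X U)
    (hY : SmoothFieldOn Y U) (hηX : ∀ x ∈ U, η x (X x) = 0) (hηY : ∀ x ∈ U, η x (Y x) = 0)
    {q : M} (hq : q ∈ U) :
    extDer η q (X q) (Y q) = -η q (VectorField.mlieBracket (𝓡 n) X Y q) := by
  have hs := mem_extChartAt_source (I := 𝓡 n) q
  have hl : (extChartAt (𝓡 n) q).symm (extChartAt (𝓡 n) q q) = q := (extChartAt (𝓡 n) q).left_inv hs
  set x := extChartAt (𝓡 n) q q with hx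
  let a : Eucl n → Eucl n →L[ℝ] ℝ := fun x =>
    (η ((extChartAt (𝓡 n) q).symm x)).comp (dChartInv q ((extChartAt (𝓡 n) q).symm x))
  have hN := (isOpen_chart_inter (n := n) q hU).mem_nhds
    (show x ∈ _ from ⟨mem_extChartAt_target q, by rw [mem_preimage, hl]; exact hq⟩)
  have ha : DifferentiableAt ℝ a x :=
    ((SmoothFormOn.contDiffOn_coord hη q).contDiffAt hN).differentiableAt (by simp)
  have hax : ∀ v : TSpace n q, a x v = η q v := by
    intro v
    have e : ∀ p, p = q → η p (dChartInv q p v) = η q (dChartInv q q v) := by rintro _ rfl; rfl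
    change η _ (dChartInv q _ v) = _
    rw [e _ hl]
    exact congrArg (η q) (dChartInv_self q v)
  -- Differentiating η(Z) = 0 trades derivatives of η for derivatives of Z; the two terms of dη then
  -- assemble into a bracket.
  have key : ∀ {Z : ∀ q : M, TSpace n q}, SmoothFieldOn Z U → (∀ x ∈ U, η x (Z x) = 0) →
      ∀ v : Eucl n, fderiv ℝ a x v (fieldRep q Z x) = -a x (fderiv ℝ (fieldRep q Z) x v) := by
    intro Z hZ hηZ v
    have h0 : (fun x => a x (fieldRep q Z x)) =ᶠ[𝓝 x] fun _ => 0 := by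
      filter_upwards [hN] with y hy
      change η _ (dChartInv q _ (dChart q _ _)) = 0
      rw [dChartInv_dChart ((extChartAt (𝓡 n) q).map_target hy.1)]
      exact hηZ _ hy.2
    have hZd := (contDiffAt_fieldRep hU hZ hq hs).differentiableAt (by simp)
    have h1 := ha.hasFDerivAt.clm_apply hZd.hasFDerivAt
    have h2 := congrArg (fun L => L v) (h1.fderiv.symm.trans h0.fderiv_eq)
    simp only [fderiv_fun_const] at h2
    have h3 : a x (fderiv ℝ (fieldRep q Z) x v) + fderiv ℝ a x v (fieldRep q Z x) = 0 := h2
    linarith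
  have hXs : fieldRep q X x = X q := fieldRep_self q X
  have hYs : fieldRep q Y x = Y q := fieldRep_self q Y
  have kX := key hX hηX (fieldRep q Y x)
  have kY := key hY hηY (fieldRep q X x)
  have e1 : extDer η q (X q) (Y q) =
      fderiv ℝ a x (fieldRep q X x) (fieldRep q Y x) -
        fderiv ℝ a x (fieldRep q Y x) (fieldRep q X x) := by
    rw [hXs, hYs]
    change fderiv ℝ a x (dChart q q (X q)) (dChart q q (Y q)) -
      fderiv ℝ a x (dChart q q (Y q)) (dChart q q (X q)) = _
    rw [dChart_self, dChart_self]
  rw [e1, kX, kY, hXs, hYs]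
  refine Eq.trans ?_ (congrArg (fun w => -η q w) (mlieBracket_eq X Y q)).symm
  refine Eq.trans ?_ (congrArg Neg.neg (hax _))
  have := map_sub (a x) (fderiv ℝ (fieldRep q Y) x (show Eucl n from X q))
    (fderiv ℝ (fieldRep q X) x (show Eucl n from Y q))
  refine Eq.trans ?_ (congrArg Neg.neg this).symm
  ring

theorem inCoordinates_form (c p : M) (L : CSpace n p) (v : Eucl n) :
    ContinuousLinearMap.inCoordinates (Eucl n) (fun x : M => TangentSpace (𝓡 n) x) ℝ
      (fun _ : M => ℝ) c p c p L v = L (dChartInv c p v) := by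
  have h : (trivializationAt ℝ (Bundle.Trivial M ℝ) c).continuousLinearMapAt ℝ p =
      ContinuousLinearMap.id ℝ ℝ := Bundle.Trivial.continuousLinearMapAt_trivialization ℝ M ℝ p
  change (trivializationAt ℝ (Bundle.Trivial M ℝ) c).continuousLinearMapAt ℝ p
    (L (dChartInv c p v)) = _
  rw [h]
  rfl

/-- A one-form is smooth if its values on smooth vector fields are. -/
theorem smoothFormOn_of_forall {η : ∀ q : M, CSpace n q} {U : Set M} (hU : IsOpen U)
    (h : ∀ V ⊆ U, IsOpen V → ∀ Y : ∀ q : M, TSpace n q, SmoothFieldOn Y V →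
      ContMDiffOn (𝓡 n) 𝓘(ℝ, ℝ) ∞ (fun q => η q (Y q)) V) : SmoothFormOn η U := by
  intro c hc
  refine (contMDiffWithinAt_hom_bundle _).2 ⟨contMDiffWithinAt_id, ?_⟩
  have h1 : ∀ i, ContMDiffWithinAt (𝓡 n) 𝓘(ℝ, ℝ) ∞
      (fun q => η q (dChartInv c q (EuclideanSpace.basisFun (Fin n) ℝ i))) U c := by
    intro i
    have := h (U ∩ (extChartAt (𝓡 n) c).source) inter_subset_left
      (hU.inter (isOpen_extChartAt_source c)) _
      (SmoothFieldOn.mono (VolumeForm.smoothFieldOn_dChartInv c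
        (EuclideanSpace.basisFun (Fin n) ℝ i)) inter_subset_right)
    exact (this.contMDiffAt ((hU.inter (isOpen_extChartAt_source c)).mem_nhds
      ⟨hc, mem_extChartAt_source c⟩)).contMDiffWithinAt
  have h2 := ContMDiffWithinAt.sum (t := Finset.univ) fun i _ =>
    (((ContinuousLinearMap.smulRightL ℝ (Eucl n) ℝ (EuclideanSpace.proj i)).contMDiff
      (n := ∞)).contMDiffAt (x := η c (dChartInv c c
        (EuclideanSpace.basisFun (Fin n) ℝ i)))).comp_contMDiffWithinAt c (h1 i)
  refine h2.congr_of_eventuallyEq ?_ ?_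
  · filter_upwards with p
    refine (eq_sum_smulRight_basisFun _).trans (Finset.sum_congr rfl fun i _ => ?_)
    exact congrArg _ (inCoordinates_form c p (η p) _)
  · refine (eq_sum_smulRight_basisFun _).trans (Finset.sum_congr rfl fun i _ => ?_)
    exact congrArg _ (inCoordinates_form c c (η c) _)

/-- An endomorphism of the tangent bundle is smooth if its values on smooth vector fields are. -/
theorem contMDiff_hom_of_forall {B : ∀ q : M, TSpace n q →L[ℝ] TSpace n q}
    (h : ∀ c : M, ∃ U : Set M, IsOpen U ∧ c ∈ U ∧ ∀ V ⊆ U, IsOpen V →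
      ∀ Y : ∀ q : M, TSpace n q, SmoothFieldOn Y V → SmoothFieldOn (fun q => B q (Y q)) V) :
    ContMDiff (𝓡 n) ((𝓡 n).prod 𝓘(ℝ, Eucl n →L[ℝ] Eucl n)) ∞
      (fun q => TotalSpace.mk' (Eucl n →L[ℝ] Eucl n)
        (E := fun q : M => TangentSpace (𝓡 n) q →L[ℝ] TangentSpace (𝓡 n) q) q (B q)) := by
  intro c
  refine (contMDiffAt_hom_bundle _).2 ⟨contMDiffAt_id, ?_⟩
  obtain ⟨U, hU, hc, h⟩ := h c
  have h1 : ∀ i, ContMDiffAt (𝓡 n) 𝓘(ℝ, Eucl n) ∞ (fun q => dChart c q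
      (B q (dChartInv c q (EuclideanSpace.basisFun (Fin n) ℝ i)))) c := by
    intro i
    have hN := (hU.inter (isOpen_extChartAt_source (I := 𝓡 n) c)).mem_nhds
      ⟨hc, mem_extChartAt_source c⟩
    have h2 := (h (U ∩ (extChartAt (𝓡 n) c).source) inter_subset_left
      (hU.inter (isOpen_extChartAt_source c)) _
      (SmoothFieldOn.mono (VolumeForm.smoothFieldOn_dChartInv c
        (EuclideanSpace.basisFun (Fin n) ℝ i)) inter_subset_right)).contMDiffAt hN
    refine (contMDiffAt_totalSpace.1 h2).2.congr_of_eventuallyEq ?_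
    filter_upwards [hN] with p hp
    have hp' : p ∈ (trivializationAt (Eucl n) (fun x : M => TangentSpace (𝓡 n) x) c).baseSet := by
      simpa using hp.2
    simp only [dChart]
    rw [Trivialization.continuousLinearMapAt_apply, Trivialization.coe_linearMapAt_of_mem _ hp']
  have h2 := ContMDiffAt.sum (t := Finset.univ) fun i _ =>
    ((ContinuousLinearMap.smulRightL ℝ (Eucl n) (Eucl n) (EuclideanSpace.proj i)).contMDiff
      (n := ∞)).contMDiffAt.comp c (h1 i)
  refine h2.congr_of_eventuallyEq ?_
  filter_upwards with p
  refine (eq_sum_smulRight_basisFun _).trans ?_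
  rfl

end Forms

/-! ### Corank one: conormal forms, ker J and the homogeneous equations -/

section Corank

variable {k : ℕ} {M : Type*} [TopologicalSpace M] [ChartedSpace (Eucl (k + 1)) M]
  [IsManifold (𝓡 (k + 1)) ∞ M] {S : Structure (k + 1) k M}

/-- The family `X_1, …, X_k, Z`. -/
def extendFrame (X : Fin k → ∀ x : M, S.D x) (Z : ∀ x : M, TSpace (k + 1) x) (i : Fin (k + 1))
    (x : M) : TSpace (k + 1) x :=
  Fin.snoc (α := fun _ => TSpace (k + 1) x) (fun i => (X i x : TSpace (k + 1) x)) (Z x) i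

theorem extendFrame_castSucc (X : Fin k → ∀ x : M, S.D x) (Z : ∀ x : M, TSpace (k + 1) x)
    (i : Fin k) (x : M) : extendFrame X Z i.castSucc x = X i x := by
  simp [extendFrame]

theorem extendFrame_last (X : Fin k → ∀ x : M, S.D x) (Z : ∀ x : M, TSpace (k + 1) x)
    (x : M) : extendFrame X Z (Fin.last k) x = Z x := by
  simp [extendFrame]

/-- The one-form `Ω(X_1, …, X_k, ·)`. -/
def conormal (Ω : VolumeForm (k + 1) M) (X : Fin k → ∀ x : M, S.D x) (x : M) : CSpace (k + 1) x :=
  LinearMap.toContinuousLinearMap ((Ω.toFun x).toMultilinearMap.toLinearMap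
    (fun i => extendFrame X (fun _ => 0) i x) (Fin.last k))

theorem conormal_apply (Ω : VolumeForm (k + 1) M) (X : Fin k → ∀ x : M, S.D x)
    (Z : ∀ x : M, TSpace (k + 1) x) (x : M) :
    conormal Ω X x (Z x) = Ω.toFun x fun i => extendFrame X Z i x := by
  change Ω.toFun x (Function.update _ _ _) = _
  congr 1
  ext1 i
  refine Fin.lastCases ?_ (fun i => ?_) i
  · rw [Function.update_self, extendFrame_last]
  · rw [Function.update_of_ne (Fin.castSucc_ne_last i), extendFrame_castSucc, extendFrame_castSucc]

namespace Structure

theorem exists_notMem_D (q : M) : ∃ w : TSpace (k + 1) q, w ∉ S.D q := by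
  by_contra! h
  have h1 : S.D q = ⊤ := (Submodule.eq_top_iff').2 h
  have h2 := S.finrank_D q
  have h3 : Module.finrank ℝ (TSpace (k + 1) q) = k + 1 := by
    change Module.finrank ℝ (Eucl (k + 1)) = k + 1
    simp
  rw [h1, finrank_top, h3] at h2
  omega

theorem IsOrthoFrame.smooth_extendFrame {U : Set M} {X : Fin k → ∀ x : M, S.D x}
    (hX : S.IsOrthoFrame U X) {V : Set M} (hV : V ⊆ U) {Z : ∀ x : M, TSpace (k + 1) x}
    (hZ : SmoothFieldOn Z V) (i : Fin (k + 1)) : SmoothFieldOn (extendFrame X Z i) V := by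
  refine Fin.lastCases ?_ (fun i => ?_) i
  · exact hZ.congr fun q _ => extendFrame_last X Z q
  · exact ((hX.smooth i).mono hV).congr fun q _ => extendFrame_castSucc X Z i q

theorem linearIndependent_extendFrame {X : Fin k → ∀ x : M, S.D x} {q : M}
    (hX : ∀ i j, S.g q (X i q) (X j q) = if i = j then 1 else 0) {Z : ∀ x : M, TSpace (k + 1) x}
    (hZ : Z q ∉ S.D q) : LinearIndependent ℝ fun i => extendFrame X Z i q := by
  rw [linearIndependent_finSucc']
  have h1 : Fin.init (fun i => extendFrame X Z i q) = fun i => (X i q : TSpace (k + 1) q) := by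
    ext1 i
    exact extendFrame_castSucc X Z i q
  rw [h1, extendFrame_last]
  refine ⟨(linearIndependent_of_orth hX).map' (S.D q).subtype (by simp), fun h => hZ ?_⟩
  refine (Submodule.span_le.2 ?_) h
  rintro _ ⟨i, rfl⟩
  exact (X i q).2

/-- The basis given by an orthonormal basis of the distribution and a transversal vector. -/
def basisOfExtendFrame {X : Fin k → ∀ x : M, S.D x} {q : M}
    (hX : ∀ i j, S.g q (X i q) (X j q) = if i = j then 1 else 0) {Z : ∀ x : M, TSpace (k + 1) x}
    (hZ : Z q ∉ S.D q) : Module.Basis (Fin (k + 1)) ℝ (TSpace (k + 1) q) :=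
  basisOfLinearIndependentOfCardEqFinrank (linearIndependent_extendFrame hX hZ) (by
    change _ = Module.finrank ℝ (Eucl (k + 1))
    simp)

theorem basisOfExtendFrame_apply {X : Fin k → ∀ x : M, S.D x} {q : M}
    (hX : ∀ i j, S.g q (X i q) (X j q) = if i = j then 1 else 0) {Z : ∀ x : M, TSpace (k + 1) x}
    (hZ : Z q ∉ S.D q) : ⇑(basisOfExtendFrame hX hZ) = fun i => extendFrame X Z i q := by
  simp [basisOfExtendFrame]

theorem apply_extendFrame_ne_zero (Ω : VolumeForm (k + 1) M) {X : Fin k → ∀ x : M, S.D x} {q : M}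
    (hX : ∀ i j, S.g q (X i q) (X j q) = if i = j then 1 else 0) {Z : ∀ x : M, TSpace (k + 1) x}
    (hZ : Z q ∉ S.D q) : Ω.toFun q (fun i => extendFrame X Z i q) ≠ 0 := by
  rw [← basisOfExtendFrame_apply hX hZ, AlternatingMap.map_basis_ne_zero_iff]
  exact Ω.ne_zero q

theorem conormal_eq_zero_iff (Ω : VolumeForm (k + 1) M) {X : Fin k → ∀ x : M, S.D x} {q : M}
    (hX : ∀ i j, S.g q (X i q) (X j q) = if i = j then 1 else 0) (w : TSpace (k + 1) q) :
    conormal Ω X q w = 0 ↔ w ∈ S.D q := by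
  classical
  -- `conormal_apply` is stated for fields; only the value at `q` matters, so any extension of `w`
  -- will do.
  let Z : ∀ x : M, TSpace (k + 1) x := fun x => if h : x = q then h ▸ w else 0
  have hZ : Z q = w := by simp [Z]
  constructor
  · intro h
    by_contra hw
    rw [← hZ] at hw h
    rw [conormal_apply] at h
    exact apply_extendFrame_ne_zero Ω hX hw h
  · intro hw
    have h1 : ∀ i, conormal Ω X q (X i q : TSpace (k + 1) q) = 0 := by
      intro i
      rw [conormal_apply Ω X (fun x => (X i x : TSpace (k + 1) x))]
      refine (Ω.toFun q).map_eq_zero_of_eq _ (i := i.castSucc) (j := Fin.last k) ?_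
        (Fin.castSucc_ne_last i)
      rw [extendFrame_castSucc, extendFrame_last]
    have h2 := eq_sum_of_orth hX ⟨w, hw⟩
    have h3 : w = ∑ i, S.g q (X i q) ⟨w, hw⟩ • (X i q : TSpace (k + 1) q) := by
      simpa using congrArg (S.D q).subtype h2
    rw [h3, map_sum]
    simp [h1]

theorem IsOrthoFrame.smoothFormOn_conormal {U : Set M} {X : Fin k → ∀ x : M, S.D x}
    (hX : S.IsOrthoFrame U X) (Ω : VolumeForm (k + 1) M) : SmoothFormOn (conormal Ω X) U := by
  refine smoothFormOn_of_forall hX.isOpen fun V hV hVo Y hY => ?_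
  simp only [conormal_apply]
  exact Ω.smooth V hVo _ fun i => hX.smooth_extendFrame hV hY i

theorem IsOrthoFrame.isLocalDefiningForm {U : Set M} {X : Fin k → ∀ x : M, S.D x}
    (hX : S.IsOrthoFrame U X) (Ω : VolumeForm (k + 1) M) {q : M} (hq : q ∈ U) :
    S.IsLocalDefiningForm (conormal Ω X) q :=
  ⟨U, hX.isOpen, hq, hX.smoothFormOn_conormal Ω, fun x hx => by
    ext w
    exact conormal_eq_zero_iff Ω (hX.orth x hx) w⟩

/-- Jv = 0 means dη(X_i, v) = 0 for all i. Expanding v in the frame and using dη(X_i, X_j) =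
-η([X_i, X_j]) turns this into a condition on brackets modulo D, in which η no longer appears. -/
theorem J_eq_zero_iff {U : Set M} {X : Fin k → ∀ x : M, S.D x} (hX : S.IsOrthoFrame U X) {q : M}
    (hq : q ∈ U) {η : ∀ x : M, CSpace (k + 1) x} (hη : S.IsLocalDefiningForm η q) (v : S.D q) :
    S.J η q v = 0 ↔ ∀ i, ∑ j, S.g q (X j q) v • VectorField.mlieBracket (𝓡 (k + 1))
      (fun x => (X i x : TSpace (k + 1) x)) (fun x => (X j x : TSpace (k + 1) x)) q ∈ S.D q := by
  obtain ⟨W, hW, hqW, hηs, hker'⟩ := hη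
  have hker : ∀ x ∈ W, ∀ w, η x w = 0 ↔ w ∈ S.D x := fun x hx w => by
    rw [← hker' x hx]
    rfl
  have h0 : ∀ i, ∀ x ∈ U ∩ W, η x (X i x : TSpace (k + 1) x) = 0 := by
    intro i x hx
    exact (hker x hx.2 _).2 (X i x).2
  have h1 : ∀ i, S.g q (X i q) (S.J η q v) = -η q (∑ j, S.g q (X j q) v •
      VectorField.mlieBracket (𝓡 (k + 1)) (fun x => (X i x : TSpace (k + 1) x))
        (fun x => (X j x : TSpace (k + 1) x)) q) := by
    intro i
    have h3 : (v : TSpace (k + 1) q) = ∑ j, S.g q (X j q) v • (X j q : TSpace (k + 1) q) := by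
      simpa using congrArg (S.D q).subtype (eq_sum_of_orth (hX.orth q hq) v)
    rw [S.J_spec]
    conv_lhs => rw [h3]
    have h4 : ∀ j, extDer η q (X i q : TSpace (k + 1) q) (X j q : TSpace (k + 1) q) =
        -η q (VectorField.mlieBracket (𝓡 (k + 1)) (fun x => (X i x : TSpace (k + 1) x))
        (fun x => (X j x : TSpace (k + 1) x)) q) := fun j =>
      extDer_apply_of_eq_zero (hX.isOpen.inter hW) (hηs.mono inter_subset_right)
        ((hX.smooth i).mono inter_subset_left) ((hX.smooth j).mono inter_subset_left)
        (h0 i) (h0 j) ⟨hq, hqW⟩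
    simp only [map_sum, map_smul, h4, smul_eq_mul, mul_neg, Finset.sum_neg_distrib]
  have h2 : S.J η q v = 0 ↔ ∀ i, S.g q (X i q) (S.J η q v) = 0 := by
    constructor
    · intro h i
      rw [h, map_zero]
    · intro h
      rw [eq_sum_of_orth (hX.orth q hq) (S.J η q v)]
      simp [h]
  rw [h2]
  refine forall_congr' fun i => ?_
  rw [h1, neg_eq_zero, hker q hqW]

/-- The criterion is the same for every defining form, so the intersection in `kerJ` is the kernel
for any one of them. The conormal form of Ω shows that the intersection is not over an empty family.
-/
theorem mem_kerJ_iff (Ω : VolumeForm (k + 1) M) {U : Set M} {X : Fin k → ∀ x : M, S.D x}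
    (hX : S.IsOrthoFrame U X) {q : M} (hq : q ∈ U) (v : S.D q) :
    (v : TSpace (k + 1) q) ∈ S.kerJ q ↔
      ∀ i, ∑ j, S.g q (X j q) v • VectorField.mlieBracket (𝓡 (k + 1))
        (fun x => (X i x : TSpace (k + 1) x)) (fun x => (X j x : TSpace (k + 1) x)) q ∈ S.D q := by
  have h1 : (v : TSpace (k + 1) q) ∈ S.kerJ q ↔
      ∀ η : ∀ x : M, CSpace (k + 1) x, S.IsLocalDefiningForm η q → S.J η q v = 0 := by
    rw [kerJ]
    have : (v : TSpace (k + 1) q) ∈ (⨅ (η : ∀ x : M, CSpace (k + 1) x)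
        (_ : S.IsLocalDefiningForm η q), LinearMap.ker (S.J η q)).map (S.D q).subtype ↔
        v ∈ ⨅ (η : ∀ x : M, CSpace (k + 1) x) (_ : S.IsLocalDefiningForm η q),
          LinearMap.ker (S.J η q) :=
      ⟨fun ⟨y, hy, e⟩ => by rwa [← Subtype.ext (show (y : TSpace (k + 1) q) = v from e)],
        fun h => ⟨v, h, rfl⟩⟩
    rw [this]
    simp only [Submodule.mem_iInf, LinearMap.mem_ker]
  rw [h1]
  constructor
  · intro h
    exact (J_eq_zero_iff hX hq (hX.isLocalDefiningForm Ω hq) v).1 (h _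
      (hX.isLocalDefiningForm Ω hq))
  · intro h η hη
    exact (J_eq_zero_iff hX hq hη v).2 h

theorem kerJ_le_D (q : M) : S.kerJ q ≤ S.D q := by
  rintro _ ⟨v, -, rfl⟩
  exact v.2

/-- The distribution is the kernel of a linear form that takes the value `1` at some vector. -/
theorem exists_normalized_form (Ω : VolumeForm (k + 1) M) (q : M) :
    ∃ (θ : TSpace (k + 1) q →ₗ[ℝ] ℝ) (e : TSpace (k + 1) q),
      (∀ w, θ w = 0 ↔ w ∈ S.D q) ∧ θ e = 1 := by
  obtain ⟨U, X, hq, hX⟩ := S.exists_isOrthoFrame q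
  obtain ⟨w, hw⟩ := S.exists_notMem_D q
  have h := conormal_eq_zero_iff Ω (hX.orth q hq)
  refine ⟨(conormal Ω X q : TSpace (k + 1) q →ₗ[ℝ] ℝ), (conormal Ω X q w)⁻¹ • w, h, ?_⟩
  have h0 : conormal Ω X q w ≠ 0 := fun h' => hw ((h w).1 h')
  simp [h0]

/-- Both projections are the identity on D, so ρ - ρ' = θ ⊗ δ with δ = ρ(e) - ρ'(e). Subtracting the
i-th equations leaves θ(∑_j g(X_j, δ)[X_i, X_j]) up to sign, and its vanishing for all i is the
bracket criterion for δ ∈ ker J. -/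
theorem SolvesAt.iff_sub_mem_kerJ {Ω : VolumeForm (k + 1) M} {U : Set M}
    {X : Fin k → ∀ x : M, S.D x} (hX : S.IsOrthoFrame U X) {q : M} (hq : q ∈ U)
    {ρ ρ' : TSpace (k + 1) q →ₗ[ℝ] S.D q} (hρ : ∀ v : S.D q, ρ (v : TSpace (k + 1) q) = v)
    (hρ' : ∀ v : S.D q, ρ' (v : TSpace (k + 1) q) = v) (h : S.SolvesAt Ω X q ρ) :
    S.SolvesAt Ω X q ρ' ↔ ∀ w, ((ρ w - ρ' w : S.D q) : TSpace (k + 1) q) ∈ S.kerJ q := by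
  obtain ⟨θ, e, hθ, he⟩ := S.exists_normalized_form Ω q
  have hδ : ∀ w, ρ w - ρ' w = θ w • (ρ e - ρ' e) := by
    intro w
    have h1 : w - θ w • e ∈ S.D q := by
      rw [← hθ]; simp [he]
    have h2 := (hρ ⟨_, h1⟩).trans (hρ' ⟨_, h1⟩).symm
    simp only [map_sub, map_smul] at h2
    rw [smul_sub]
    exact sub_eq_sub_iff_sub_eq_sub.1 h2
  have h1 : S.SolvesAt Ω X q ρ' ↔
      ((ρ e - ρ' e : S.D q) : TSpace (k + 1) q) ∈ S.kerJ q := by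
    rw [mem_kerJ_iff Ω hX hq]
    refine forall_congr' fun i => ?_
    rw [h i, ← hθ, ← sub_eq_zero, ← Finset.sum_sub_distrib, ← neg_eq_zero]
    have h2 : -∑ j, (S.g q (X j q) (ρ (VectorField.mlieBracket (𝓡 (k + 1))
          (fun x => (X j x : TSpace (k + 1) x)) (fun x => (X i x : TSpace (k + 1) x)) q)) -
        S.g q (X j q) (ρ' (VectorField.mlieBracket (𝓡 (k + 1))
          (fun x => (X j x : TSpace (k + 1) x)) (fun x => (X i x : TSpace (k + 1) x)) q))) =
        θ (∑ j, S.g q (X j q) (ρ e - ρ' e) • VectorField.mlieBracket (𝓡 (k + 1))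
          (fun x => (X i x : TSpace (k + 1) x)) (fun x => (X j x : TSpace (k + 1) x)) q) := by
      rw [map_sum, ← Finset.sum_neg_distrib]
      refine Finset.sum_congr rfl fun j _ => ?_
      rw [VectorField.mlieBracket_swap_apply (V := fun x => (X i x : TSpace (k + 1) x)),
        ← map_sub, hδ]
      simp only [map_smul, map_neg, smul_eq_mul]
      ring
    rw [h2]
  rw [h1]
  constructor
  · intro h w
    rw [hδ]
    exact (S.kerJ q).smul_mem _ h
  · intro h
    exact h e

end Structure

end Corank

/-! ### Shears id + B with B zero on D and values in D -/

section ShearLinearAlgebra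

variable {R E : Type*} [Ring R] [AddCommGroup E] [Module R E] {D V : Submodule R E} {B : E →ₗ[R] E}

/-- The hypotheses give B² = 0, so id + B is unipotent. -/
theorem ker_id_add_eq_bot (h0 : ∀ v ∈ D, B v = 0) (h1 : ∀ v, B v ∈ D) :
    LinearMap.ker (LinearMap.id + B) = ⊥ := by
  rw [LinearMap.ker_eq_bot']
  intro v hv
  have hv' : v + B v = 0 := hv
  have h2 : v ∈ D := by
    rw [eq_neg_of_add_eq_zero_left hv']
    exact neg_mem (h1 v)
  rwa [h0 v h2, add_zero] at hv'

/-- Since B takes values in D, id + B does not change vectors modulo D. -/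
theorem isCompl_map_id_add (h : IsCompl D V) (h1 : ∀ v, B v ∈ D) :
    IsCompl D (V.map (LinearMap.id + B)) := by
  constructor
  · rw [Submodule.disjoint_def]
    rintro _ h2 ⟨v, hv, rfl⟩
    have h3 : v + B v ∈ D := h2
    have h4 : v ∈ D := by simpa using sub_mem h3 (h1 v)
    rw [Submodule.disjoint_def.1 h.disjoint v h4 hv, map_zero]
  · rw [codisjoint_iff, Submodule.eq_top_iff']
    intro w
    obtain ⟨d, hd, v, hv, rfl⟩ := Submodule.mem_sup.1
      (show w ∈ D ⊔ V by rw [h.sup_eq_top]; exact Submodule.mem_top)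
    have e : d + v = (d - B v) + (v + B v) := by abel
    rw [e]
    exact Submodule.add_mem_sup (sub_mem hd (h1 v)) ⟨v, hv, rfl⟩

theorem linearIndependent_add_apply {ι : Type*} {v : ι → E} (hv : LinearIndependent R v)
    (h0 : ∀ v ∈ D, B v = 0) (h1 : ∀ v, B v ∈ D) : LinearIndependent R fun i => v i + B (v i) :=
  hv.map' (LinearMap.id + B) (ker_id_add_eq_bot h0 h1)

theorem span_range_add_apply {ι : Type*} (v : ι → E) :
    Submodule.span R (range fun i => v i + B (v i)) =
      (Submodule.span R (range v)).map (LinearMap.id + B) := by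
  rw [Submodule.map_span, ← range_comp]
  rfl

end ShearLinearAlgebra

/-! ### Action of Hom(TM/D, ker J) on the compatible complements -/

section Complements

variable {k : ℕ} {M : Type*} [TopologicalSpace M] [ChartedSpace (Eucl (k + 1)) M]
  [IsManifold (𝓡 (k + 1)) ∞ M] {S : Structure (k + 1) k M}

namespace Structure.Complement

theorem proj_eq_zero_iff (V : S.Complement) {q : M} {w : TSpace (k + 1) q} :
    V.proj q w = 0 ↔ w ∈ V.fiber q :=
  Submodule.projectionOnto_apply_eq_zero_iff (V.isCompl q)

theorem eq_of_proj_eq {V W : S.Complement}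
    (h : ∀ q w, V.proj q w = W.proj q w) : V = W := by
  ext q w
  rw [← V.proj_eq_zero_iff, h, W.proj_eq_zero_iff]

theorem proj_eq_of_sub_mem (V : S.Complement) {q : M} {w : TSpace (k + 1) q} {d : S.D q}
    (h : w - d ∈ V.fiber q) : V.proj q w = d := by
  rw [← V.proj_eq_zero_iff, map_sub, V.proj_of_mem, sub_eq_zero] at h
  exact h

theorem sub_proj_mem (V : S.Complement) {q : M} (w : TSpace (k + 1) q) :
    w - V.proj q w ∈ V.fiber q := by
  rw [← V.proj_eq_zero_iff, map_sub, V.proj_of_mem, sub_self]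

theorem finrank_fiber (V : S.Complement) (q : M) : Module.finrank ℝ (V.fiber q) = 1 := by
  have h1 := Submodule.finrank_add_eq_of_isCompl (V.isCompl q)
  have h2 := S.finrank_D q
  have h3 : Module.finrank ℝ (TSpace (k + 1) q) = k + 1 := by
    change Module.finrank ℝ (Eucl (k + 1)) = k + 1
    simp
  omega

theorem exists_local_section (V : S.Complement) (c : M) :
    ∃ (U : Set M) (Z : ∀ x : M, TSpace (k + 1) x), IsOpen U ∧ c ∈ U ∧ SmoothFieldOn Z U ∧
      ∀ x ∈ U, Z x ∉ S.D x ∧ Z x ∈ V.fiber x := by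
  obtain ⟨U, hU, hc, r, Z, hZ, h⟩ := V.smooth c
  have hr : r = 1 := by
    rw [← V.finrank_fiber c, ← (h c hc).2, finrank_span_eq_card (h c hc).1, Fintype.card_fin]
  subst hr
  refine ⟨U, Z 0, hU, hc, hZ 0, fun x hx => ?_⟩
  have h1 : Z 0 x ∈ V.fiber x := by
    rw [← (h x hx).2]
    exact Submodule.subset_span ⟨0, rfl⟩
  exact ⟨fun h2 => (h x hx).1.ne_zero 0 (Submodule.disjoint_def.1 (V.isCompl x).disjoint _ h2 h1),
    h1⟩

/-- The projection along a complement is smooth. -/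
theorem exists_smoothFieldOn_proj (Ω : VolumeForm (k + 1) M) (V : S.Complement) (c : M) :
    ∃ U : Set M, IsOpen U ∧ c ∈ U ∧ ∀ W ⊆ U, ∀ Y : ∀ x : M, TSpace (k + 1) x,
      SmoothFieldOn Y W → SmoothFieldOn (fun x => (V.proj x (Y x) : TSpace (k + 1) x)) W := by
  obtain ⟨U₁, X, hc₁, hX⟩ := S.exists_isOrthoFrame c
  obtain ⟨U₂, Z, hU₂, hc₂, hZ, hZD⟩ := V.exists_local_section c
  refine ⟨U₁ ∩ U₂, hX.isOpen.inter hU₂, ⟨hc₁, hc₂⟩, fun W hW Y hY => ?_⟩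
  have hη : SmoothFormOn (conormal Ω X) W :=
    (hX.smoothFormOn_conormal Ω).mono (hW.trans inter_subset_left)
  have hZ' := SmoothFieldOn.mono hZ (hW.trans inter_subset_right)
  have h0 : ∀ x ∈ W, conormal Ω X x (Z x) ≠ 0 := fun x hx h =>
    (hZD x (hW hx).2).1 ((conormal_eq_zero_iff Ω (hX.orth x (hW hx).1) _).1 h)
  refine SmoothFieldOn.congr (X := fun x => Y x -
    (conormal Ω X x (Y x) / conormal Ω X x (Z x)) • Z x) ?_ fun x hx => ?_
  · exact SmoothFieldOn.sub hY (SmoothFieldOn.smul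
      ((SmoothFormOn.apply hη hY).div₀ (SmoothFormOn.apply hη hZ') h0) hZ')
  · have h1 : Y x - (conormal Ω X x (Y x) / conormal Ω X x (Z x)) • Z x ∈ S.D x := by
      rw [← conormal_eq_zero_iff Ω (hX.orth x (hW hx).1)]
      have := h0 x hx
      simp only [map_sub, map_smul, smul_eq_mul]
      field_simp
      ring
    have h2 : V.proj x (Y x) = ⟨_, h1⟩ := by
      refine V.proj_eq_of_sub_mem ?_
      simp only [sub_sub_cancel]
      exact (V.fiber x).smul_mem _ (hZD x (hW hx).2).2
    rw [h2]

/-- A smooth family of endomorphisms of the tangent spaces that vanish on horizontal vectors and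
take horizontal values. -/
structure _root_.SubRiem.Structure.IsShear (S : Structure (k + 1) k M)
    (B : ∀ q : M, TSpace (k + 1) q →ₗ[ℝ] TSpace (k + 1) q) : Prop where
  smooth : ∀ (U : Set M) (Y : ∀ q : M, TSpace (k + 1) q), SmoothFieldOn Y U →
    SmoothFieldOn (fun q => B q (Y q)) U
  zero : ∀ q, ∀ v ∈ S.D q, B q v = 0
  mem : ∀ q v, B q v ∈ S.D q

/-- The image of a complement under `id + B`. -/
def shear (V : S.Complement) {B : ∀ q : M, TSpace (k + 1) q →ₗ[ℝ] TSpace (k + 1) q}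
    (hB : S.IsShear B) : S.Complement where
  fiber q := (V.fiber q).map (LinearMap.id + B q)
  smooth c := by
    obtain ⟨U, hU, hc, r, Z, hZ, h⟩ := V.smooth c
    refine ⟨U, hU, hc, r, fun i x => Z i x + B x (Z i x), fun i =>
      SmoothFieldOn.add (hZ i) (hB.smooth U _ (hZ i)), fun x hx => ⟨?_, ?_⟩⟩
    · exact linearIndependent_add_apply (h x hx).1 (hB.zero x) (hB.mem x)
    · exact (span_range_add_apply (B := B x) fun i => Z i x).trans (congrArg _ (h x hx).2)
  isCompl q := isCompl_map_id_add (V.isCompl q) (hB.mem q)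

/-- Since B kills D, (id + B)(w - πw) = w - (πw - Bw). Hence shearing the fibres by +B changes the
projection by -B, which fixes the signs below. -/
theorem proj_shear (V : S.Complement) {B : ∀ q : M, TSpace (k + 1) q →ₗ[ℝ] TSpace (k + 1) q}
    (hB : S.IsShear B) (q : M) (w : TSpace (k + 1) q) :
    (V.shear hB).proj q w = V.proj q w - ⟨B q w, hB.mem q w⟩ := by
  refine (V.shear hB).proj_eq_of_sub_mem ⟨w - V.proj q w, V.sub_proj_mem w, ?_⟩
  change (w - V.proj q w) + B q (w - V.proj q w) = _
  have h : B q (V.proj q w : TSpace (k + 1) q) = 0 := hB.zero q _ (V.proj q w).2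
  rw [map_sub, h, sub_zero, Submodule.coe_sub]
  abel

end Structure.Complement

namespace Structure

theorem isShear_of_kerJHoms (B : S.kerJHoms) :
    S.IsShear fun q => (B.1 q : TSpace (k + 1) q →ₗ[ℝ] TSpace (k + 1) q) where
  smooth _ _ hY := ContMDiffOn.clm_bundle_apply B.1.contMDiff.contMDiffOn hY
  zero q := (B.2 q).1
  mem q v := kerJ_le_D q ((B.2 q).2 v)

variable {Ω : VolumeForm (k + 1) M} {μ : ∀ V : S.Complement, V.AdaptedMeasure}

theorem compatible_ext {V W : S.compatible Ω μ}
    (h : ∀ q w, (V.1.proj q w : TSpace (k + 1) q) = W.1.proj q w) : V = W :=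
  Subtype.ext (Complement.eq_of_proj_eq fun q w => Subtype.ext (h q w))

variable {η : ∀ q : M, CSpace (k + 1) q}

theorem IsDefiningForm.eq_zero_iff (hη : S.IsDefiningForm η) {q : M} (w : TSpace (k + 1) q) :
    η q w = 0 ↔ w ∈ S.D q := by
  rw [← hη.2 q]
  rfl

theorem IsDefiningForm.exists_eq_one (hη : S.IsDefiningForm η) (q : M) :
    ∃ e : TSpace (k + 1) q, η q e = 1 := by
  obtain ⟨w, hw⟩ := S.exists_notMem_D q
  have h : η q w ≠ 0 := fun h => hw ((hη.eq_zero_iff w).1 h)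
  exact ⟨(η q w)⁻¹ • w, by simp [h]⟩

/-- A field that is constant in the chart and transversal at `c` stays so nearby, because
transversality is nonvanishing of the continuous function conormal(Z). -/
theorem exists_smooth_notMem_D (Ω : VolumeForm (k + 1) M) (c : M) :
    ∃ (U : Set M) (X : Fin k → ∀ x : M, S.D x) (Z : ∀ x : M, TSpace (k + 1) x),
      c ∈ U ∧ S.IsOrthoFrame U X ∧ SmoothFieldOn Z U ∧ ∀ x ∈ U, Z x ∉ S.D x := by
  obtain ⟨U, X, hc, hX⟩ := S.exists_isOrthoFrame c
  obtain ⟨w, hw⟩ := S.exists_notMem_D c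
  let Z : ∀ x : M, TSpace (k + 1) x := fun x => dChartInv c x (show Eucl (k + 1) from w)
  have hZ : SmoothFieldOn Z (U ∩ (extChartAt (𝓡 (k + 1)) c).source) :=
    SmoothFieldOn.mono (VolumeForm.smoothFieldOn_dChartInv c _) inter_subset_right
  have ho := hX.isOpen.inter (isOpen_extChartAt_source (I := 𝓡 (k + 1)) c)
  have hcont := (SmoothFormOn.apply ((hX.smoothFormOn_conormal Ω).mono
    (inter_subset_left (t := (extChartAt (𝓡 (k + 1)) c).source))) hZ).continuousOn
  have hV := hcont.isOpen_inter_preimage ho (isOpen_compl_singleton (x := (0 : ℝ)))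
  refine ⟨(U ∩ (extChartAt (𝓡 (k + 1)) c).source) ∩
    (fun x => conormal Ω X x (Z x)) ⁻¹' {0}ᶜ, X, Z, ⟨⟨hc, mem_extChartAt_source c⟩, ?_⟩, hX.mono hV
    (inter_subset_left.trans inter_subset_left), hZ.mono inter_subset_left, fun x hx h => hx.2 ?_⟩
  · intro h0
    apply hw
    have e : Z c = w := dChartInv_self c _
    rw [← e]
    exact (conormal_eq_zero_iff Ω (hX.orth c hc) _).1 h0
  · exact (conormal_eq_zero_iff Ω (hX.orth x hx.1.1) _).2 h

/-- The section `v ↦ η(v) ξ` of `Hom(TM / D, ker J)`. -/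
def homOfSection (hη : S.IsDefiningForm η) (ξ : S.kerJSections) : S.kerJHoms :=
  ⟨⟨fun q => (η q).smulRight (ξ.1 q), by
    refine contMDiff_hom_of_forall fun c => ⟨univ, isOpen_univ, mem_univ c, fun U _ _ Y hY => ?_⟩
    exact SmoothFieldOn.smul (SmoothFormOn.apply (hη.1.mono (subset_univ U)) hY)
      ξ.1.contMDiff.contMDiffOn⟩, fun q => ⟨fun v hv => by
    change η q v • ξ.1 q = 0
    rw [(hη.eq_zero_iff v).2 hv, zero_smul], fun v => (S.kerJ q).smul_mem _ (ξ.2 q)⟩⟩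

theorem homOfSection_apply (hη : S.IsDefiningForm η) (ξ : S.kerJSections) (q : M)
    (w : TSpace (k + 1) q) : (homOfSection hη ξ).1 q w = η q w • ξ.1 q := rfl

theorem kerJHoms_apply_eq (hη : S.IsDefiningForm η) (B : S.kerJHoms) {q : M}
    {e : TSpace (k + 1) q} (he : η q e = 1) (w : TSpace (k + 1) q) :
    B.1 q w = η q w • B.1 q e := by
  have h : w - η q w • e ∈ S.D q := by
    rw [← hη.eq_zero_iff]
    simp [he]
  have h2 := (B.2 q).1 _ h
  rwa [map_sub, map_smul, sub_eq_zero] at h2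

/-- The value of a section of `Hom(TM / D, ker J)` at a vector field `e` with `η(e) = 1`. -/
def sectionOfHom (Ω : VolumeForm (k + 1) M) (hη : S.IsDefiningForm η) (B : S.kerJHoms) :
    S.kerJSections :=
  ⟨⟨fun q => B.1 q (hη.exists_eq_one q).choose, by
    intro c
    obtain ⟨U, X, Z, hc, hX, hZ, hZD⟩ := S.exists_smooth_notMem_D Ω c
    have h0 : ∀ x ∈ U, η x (Z x) ≠ 0 := fun x hx h => hZD x hx ((hη.eq_zero_iff _).1 h)
    -- The vectors chosen with η = 1 need not depend smoothly on the point. As B vanishes on D, its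
    -- value on them agrees with its value on the normalization of any smooth transversal field.
    have h1 : SmoothFieldOn (fun x => (η x (Z x))⁻¹ • B.1 x (Z x)) U :=
      SmoothFieldOn.smul ((SmoothFormOn.apply (hη.1.mono (subset_univ U)) hZ).inv₀ h0)
        ((isShear_of_kerJHoms B).smooth U Z hZ)
    have h2 : SmoothFieldOn (fun x => B.1 x (hη.exists_eq_one x).choose) U :=
      h1.congr fun x hx => by
        rw [kerJHoms_apply_eq hη B (hη.exists_eq_one x).choose_spec (Z x), inv_smul_smul₀ (h0 x hx)]
    exact ContMDiffOn.contMDiffAt h2 (hX.isOpen.mem_nhds hc)⟩, fun q => (B.2 q).2 _⟩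

theorem homOfSection_sectionOfHom (hη : S.IsDefiningForm η) (B : S.kerJHoms) :
    homOfSection hη (sectionOfHom Ω hη B) = B := by
  refine Subtype.ext (ContMDiffSection.ext fun q => ContinuousLinearMap.ext fun w => ?_)
  rw [homOfSection_apply]
  exact (kerJHoms_apply_eq hη B (hη.exists_eq_one q).choose_spec w).symm

theorem sectionOfHom_homOfSection (hη : S.IsDefiningForm η) (ξ : S.kerJSections) :
    sectionOfHom Ω hη (homOfSection hη ξ) = ξ := by
  refine Subtype.ext (ContMDiffSection.ext fun q => ?_)
  refine (homOfSection_apply hη ξ q _).trans ?_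
  rw [(hη.exists_eq_one q).choose_spec, one_smul]

theorem homOfSection_add (hη : S.IsDefiningForm η) (ξ ξ' : S.kerJSections) :
    homOfSection hη (ξ + ξ') = homOfSection hη ξ + homOfSection hη ξ' := by
  refine Subtype.ext (ContMDiffSection.ext fun q => ContinuousLinearMap.ext fun w => ?_)
  exact smul_add (η q w) (ξ.1 q) (ξ'.1 q)

theorem homOfSection_zero (hη : S.IsDefiningForm η) : homOfSection hη 0 = 0 := by
  refine Subtype.ext (ContMDiffSection.ext fun q => ContinuousLinearMap.ext fun w => ?_)
  exact smul_zero (η q w)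

variable [T2Space M] [NeZero k]

/-- With one solution as origin, the inhomogeneous terms disappear and compatibility is the
pointwise condition of `iff_sub_mem_kerJ`. -/
theorem mem_compatible_iff_of_mem {V : S.Complement} (hV : V ∈ S.compatible Ω μ)
    (W : S.Complement) : W ∈ S.compatible Ω μ ↔
      ∀ q w, ((V.proj q w - W.proj q w : S.D q) : TSpace (k + 1) q) ∈ S.kerJ q := by
  have hV' := (μ V).compatible_iff.1 hV
  constructor
  · intro hW q
    have hW' := (μ W).compatible_iff.1 hW
    obtain ⟨U, X, hq, hX⟩ := S.exists_isOrthoFrame q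
    exact (SolvesAt.iff_sub_mem_kerJ hX hq (V.proj_of_mem q) (W.proj_of_mem q)
      (hV' q U X hX hq)).1 (hW' q U X hX hq)
  · intro h
    refine (μ W).compatible_iff.2 fun q U X hX hq => ?_
    exact (SolvesAt.iff_sub_mem_kerJ hX hq (V.proj_of_mem q) (W.proj_of_mem q)
      (hV' q U X hX hq)).2 (h q)

/-- The difference of two compatible complements. -/
def homDiff (V W : S.compatible Ω μ) : S.kerJHoms :=
  -- A shear by B subtracts B from the projection, so the B that carries W to V is the projection
  -- along W minus the one along V.
  ⟨⟨fun q => LinearMap.toContinuousLinearMap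
      ((S.D q).subtype ∘ₗ (W.1.proj q - V.1.proj q)), by
    refine contMDiff_hom_of_forall fun c => ?_
    obtain ⟨U₁, hU₁, hc₁, h₁⟩ := W.1.exists_smoothFieldOn_proj Ω c
    obtain ⟨U₂, hU₂, hc₂, h₂⟩ := V.1.exists_smoothFieldOn_proj Ω c
    refine ⟨U₁ ∩ U₂, hU₁.inter hU₂, ⟨hc₁, hc₂⟩, fun U hU _ Y hY => ?_⟩
    exact SmoothFieldOn.sub (h₁ U (hU.trans inter_subset_left) Y hY)
      (h₂ U (hU.trans inter_subset_right) Y hY)⟩, fun q => ⟨fun v hv => by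
    change ((W.1.proj q v - V.1.proj q v : S.D q) : TSpace (k + 1) q) = 0
    have h1 := W.1.proj_of_mem q ⟨v, hv⟩
    have h2 := V.1.proj_of_mem q ⟨v, hv⟩
    simp only at h1 h2
    rw [h1, h2, sub_self]
    rfl, (mem_compatible_iff_of_mem W.2 V.1).1 V.2 q⟩⟩

theorem homDiff_apply (V W : S.compatible Ω μ) (q : M) (w : TSpace (k + 1) q) :
    (homDiff V W).1 q w = ((W.1.proj q w - V.1.proj q w : S.D q) : TSpace (k + 1) q) := rfl

/-- The action of the sections of `Hom(TM / D, ker J)` on the compatible complements. -/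
def shearCompatible (B : S.kerJHoms) (V : S.compatible Ω μ) : S.compatible Ω μ :=
  ⟨V.1.shear (isShear_of_kerJHoms B), (mem_compatible_iff_of_mem V.2 _).2 fun q w => by
    rw [V.1.proj_shear, sub_sub_cancel]
    exact (B.2 q).2 w⟩

theorem proj_shearCompatible (B : S.kerJHoms) (V : S.compatible Ω μ) (q : M)
    (w : TSpace (k + 1) q) :
    (((shearCompatible B V).1.proj q w : S.D q) : TSpace (k + 1) q) = V.1.proj q w - B.1 q w := by
  rw [shearCompatible, V.1.proj_shear]
  rfl

theorem zero_shearCompatible (V : S.compatible Ω μ) : shearCompatible 0 V = V := by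
  refine compatible_ext fun q w => ?_
  have h : (0 : S.kerJHoms).1 q w = 0 := rfl
  rw [proj_shearCompatible, h, sub_zero]

theorem add_shearCompatible (B B' : S.kerJHoms) (V : S.compatible Ω μ) :
    shearCompatible (B + B') V = shearCompatible B (shearCompatible B' V) := by
  refine compatible_ext fun q w => ?_
  have h : (B + B').1 q w = B.1 q w + B'.1 q w := rfl
  rw [proj_shearCompatible, proj_shearCompatible, proj_shearCompatible, h]
  abel

theorem shearCompatible_homDiff (V W : S.compatible Ω μ) : shearCompatible (homDiff V W) W = V := by
  refine compatible_ext fun q w => ?_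
  rw [proj_shearCompatible, homDiff_apply, Submodule.coe_sub, sub_sub_cancel]

theorem homDiff_shearCompatible (B : S.kerJHoms) (V : S.compatible Ω μ) :
    homDiff (shearCompatible B V) V = B := by
  refine Subtype.ext (ContMDiffSection.ext fun q => ContinuousLinearMap.ext fun w => ?_)
  rw [homDiff_apply, Submodule.coe_sub, proj_shearCompatible, sub_sub_cancel]

theorem fiber_shearCompatible_homOfSection (hη : S.IsDefiningForm η) (ξ : S.kerJSections)
    (V : S.compatible Ω μ) {q : M} {e : TSpace (k + 1) q}
    (hV : V.1.fiber q = Submodule.span ℝ {e}) (he : η q e = 1) :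
    (shearCompatible (homOfSection hη ξ) V).1.fiber q =
      Submodule.span ℝ {e + (ξ.1 q : TSpace (k + 1) q)} := by
  change (V.1.fiber q).map _ = _
  rw [hV, Submodule.map_span, image_singleton]
  change Submodule.span ℝ {e + (homOfSection hη ξ).1 q e} = _
  rw [homOfSection_apply, he, one_smul]

end Structure

end Complements

/-! ### Smoothness of determinants, brackets and divergences -/

section Smoothness

variable {n : ℕ} {M : Type*} [TopologicalSpace M] [ChartedSpace (Eucl n) M]

theorem contMDiffOn_det {ι : Type*} [Fintype ι] [DecidableEq ι] {A : M → Matrix ι ι ℝ} {U : Set M}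
    (hA : ∀ i j, ContMDiffOn (𝓡 n) 𝓘(ℝ, ℝ) ∞ (fun x => A x i j) U) :
    ContMDiffOn (𝓡 n) 𝓘(ℝ, ℝ) ∞ (fun x => (A x).det) U := by
  simp only [Matrix.det_apply']
  exact contMDiffOn_finsetSum fun σ _ => contMDiffOn_const.mul
    (contMDiffOn_finsetProd fun i _ => hA _ _)

variable [IsManifold (𝓡 n) ∞ M]

theorem SmoothFieldOn.mlieBracket {X Y : ∀ q : M, TSpace n q} {U : Set M} (hU : IsOpen U)
    (hX : SmoothFieldOn X U) (hY : SmoothFieldOn Y U) :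
    SmoothFieldOn (VectorField.mlieBracket (𝓡 n) X Y) U := by
  -- The bracket costs one derivative, which at order ∞ is no loss.
  have h : ((∞ : WithTop ℕ∞) + 1) = ∞ := rfl
  have : IsManifold (𝓡 n) (((⊤ : ℕ∞) : WithTop ℕ∞) + 1) M := by rwa [h]
  have : IsManifold (𝓡 n) (minSmoothness ℝ 2) M := by
    rw [minSmoothness_of_isRCLikeNormedField]
    infer_instance
  have : IsManifold (𝓡 n) (minSmoothness ℝ 3) M := by
    rw [minSmoothness_of_isRCLikeNormedField]
    exact IsManifold.of_le (n := ∞) (WithTop.coe_le_coe.2 (le_top : (3 : ℕ∞) ≤ ⊤))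
  intro x hx
  refine (ContMDiffAt.mlieBracket_vectorField (m := ⊤) (n := ⊤)
    (hX.contMDiffAt (hU.mem_nhds hx)) (hY.contMDiffAt (hU.mem_nhds hx)) ?_).contMDiffWithinAt
  rw [minSmoothness_of_isRCLikeNormedField]
  exact h.le

theorem contMDiffOn_dFun_apply {f : M → ℝ} {Z : ∀ q : M, TSpace n q} {U : Set M} (hU : IsOpen U)
    (hf : ContMDiffOn (𝓡 n) 𝓘(ℝ, ℝ) ∞ f U) (hZ : SmoothFieldOn Z U) :
    ContMDiffOn (𝓡 n) 𝓘(ℝ, ℝ) ∞ (fun q => dFun f q (Z q)) U := by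
  intro c hc
  have ho := isOpen_chart_inter (n := n) c hU
  have h1 : ContDiffOn ℝ ∞ (f ∘ (extChartAt (𝓡 n) c).symm)
      ((extChartAt (𝓡 n) c).target ∩ (extChartAt (𝓡 n) c).symm ⁻¹' U) := by
    rw [← contMDiffOn_iff_contDiffOn]
    exact hf.comp ((contMDiffOn_extChartAt_symm c).mono inter_subset_left) fun x hx => hx.2
  have h2 := ((h1.fderiv_of_isOpen ho (m := ∞) (by simp)).clm_apply (contDiffOn_fieldRep c hU hZ))
  have hs := mem_extChartAt_source (I := 𝓡 n) c
  have hm : extChartAt (𝓡 n) c c ∈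
      (extChartAt (𝓡 n) c).target ∩ (extChartAt (𝓡 n) c).symm ⁻¹' U :=
    ⟨mem_extChartAt_target c, by rw [mem_preimage, (extChartAt (𝓡 n) c).left_inv hs]; exact hc⟩
  have h3 := ((h2.contDiffAt (ho.mem_nhds hm)).contMDiffAt).comp c
    (contMDiffAt_extChartAt (I := 𝓡 n) (n := ∞) (x := c))
  refine (h3.congr_of_eventuallyEq ?_).contMDiffWithinAt
  filter_upwards [(hU.inter (isOpen_extChartAt_source (I := 𝓡 n) c)).mem_nhds ⟨hc, hs⟩] with p hp
  rw [dFun_eq ((hf.contMDiffAt (hU.mem_nhds hp.1)).mdifferentiableAt (by simp)) hp.2]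
  simp only [Function.comp]
  rw [fieldRep_extChartAt hp.2]

namespace VolumeForm

variable (Ω : VolumeForm n M)

theorem contMDiffOn_apply_update {Y : Fin n → ∀ q : M, TSpace n q} {W : ∀ q : M, TSpace n q}
    {U : Set M} (hU : IsOpen U) (hY : ∀ i, SmoothFieldOn (Y i) U) (hW : SmoothFieldOn W U)
    (a : Fin n) : ContMDiffOn (𝓡 n) 𝓘(ℝ, ℝ) ∞
      (fun x => Ω.toFun x (Function.update (fun i => Y i x) a (W x))) U := by
  refine (Ω.smooth U hU (Function.update Y a W) fun i => ?_).congr fun x _ => ?_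
  · by_cases h : i = a
    · subst h; rwa [Function.update_self]
    · rw [Function.update_of_ne h]; exact hY i
  · congr 1
    ext1 i
    by_cases h : i = a
    · subst h; rw [Function.update_self, Function.update_self]
    · rw [Function.update_of_ne h, Function.update_of_ne h]

/-- `coordDivergence` uses a different chart at each point, so its smoothness is not visible from
its definition. It equals the quotient of the Lie derivative of Ω on a frame by the value of Ω on
that frame, and both are smooth. -/
theorem contMDiffOn_coordDivergence {Y : Fin n → ∀ q : M, TSpace n q} {Z : ∀ q : M, TSpace n q}
    {U : Set M} (hU : IsOpen U) (hY : ∀ i, SmoothFieldOn (Y i) U) (hZ : SmoothFieldOn Z U)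
    (h0 : ∀ x ∈ U, Ω.toFun x (fun i => Y i x) ≠ 0) :
    ContMDiffOn (𝓡 n) 𝓘(ℝ, ℝ) ∞ (Ω.coordDivergence Z) U := by
  have h1 : ContMDiffOn (𝓡 n) 𝓘(ℝ, ℝ) ∞ (Ω.lieDerivative Z Y) U :=
    (contMDiffOn_dFun_apply hU (Ω.smooth U hU Y hY) hZ).sub
      (contMDiffOn_finsetSum fun i _ => Ω.contMDiffOn_apply_update hU hY
        (SmoothFieldOn.mlieBracket hU hZ (hY i)) i)
  refine (h1.div₀ (Ω.smooth U hU Y hY) h0).congr fun x hx => ?_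
  change _ = Ω.lieDerivative Z Y x / _
  rw [Ω.lieDerivative_eq Z hU hx hY, mul_div_cancel_right₀ _ (h0 x hx)]

end VolumeForm

end Smoothness

/-! ### Existence and uniqueness when ker J is trivial -/

section NondegenerateCase

variable {k : ℕ} {M : Type*} [TopologicalSpace M] [ChartedSpace (Eucl (k + 1)) M]
  [IsManifold (𝓡 (k + 1)) ∞ M] {S : Structure (k + 1) k M}

namespace Structure

theorem ker_eq_span_singleton (Ω : VolumeForm (k + 1) M) {q : M}
    {ρ : TSpace (k + 1) q →ₗ[ℝ] S.D q} (hρ : ∀ v : S.D q, ρ (v : TSpace (k + 1) q) = v)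
    {e : TSpace (k + 1) q} (he : e ∉ S.D q) (h0 : ρ e = 0) :
    LinearMap.ker ρ = Submodule.span ℝ {e} := by
  obtain ⟨θ, -, hθ, -⟩ := S.exists_normalized_form Ω q
  have hθe : θ e ≠ 0 := fun h => he ((hθ e).1 h)
  apply le_antisymm
  · intro w hw
    have h1 : w - (θ w / θ e) • e ∈ S.D q := by
      rw [← hθ]; simp [hθe]
    have h2 := hρ ⟨_, h1⟩
    have h3 : ρ w = 0 := hw
    simp only [map_sub, map_smul, h0, h3, smul_zero, sub_zero] at h2
    have h4 : w - (θ w / θ e) • e = 0 := congrArg Subtype.val h2.symm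
    rw [Submodule.mem_span_singleton]
    exact ⟨_, (sub_eq_zero.1 h4).symm⟩
  · rw [Submodule.span_singleton_le_iff_mem]
    exact h0

/-- A null vector of the matrix η([X_j, X_i]) gives the coordinates of a nonzero element of ker J.
-/
theorem det_bracketMatrix_ne_zero {Ω : VolumeForm (k + 1) M} {U : Set M}
    {X : Fin k → ∀ x : M, S.D x} (hX : S.IsOrthoFrame U X) {q : M} (hq : q ∈ U)
    (hJ : S.kerJ q = ⊥) :
    (Matrix.of fun i j => conormal Ω X q (VectorField.mlieBracket (𝓡 (k + 1))
      (fun x => (X j x : TSpace (k + 1) x)) (fun x => (X i x : TSpace (k + 1) x)) q)).det ≠ 0 := by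
  intro h
  obtain ⟨v, hv0, hv⟩ := Matrix.exists_mulVec_eq_zero_iff.2 h
  apply hv0
  have hc : ∀ j, S.g q (X j q) (∑ j, v j • X j q) = v j := fun j => by
    simp [hX.orth q hq]
  have hmem : ((∑ j, v j • X j q : S.D q) : TSpace (k + 1) q) ∈ S.kerJ q := by
    rw [mem_kerJ_iff Ω hX hq]
    intro i
    simp only [hc]
    rw [← conormal_eq_zero_iff Ω (hX.orth q hq), map_sum, ← neg_eq_zero, ← Finset.sum_neg_distrib]
    refine Eq.trans (Finset.sum_congr rfl fun j _ => ?_) (congrFun hv i)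
    rw [VectorField.mlieBracket_swap_apply (V := fun x => (X i x : TSpace (k + 1) x))]
    simp [mul_comm]
  rw [hJ, Submodule.mem_bot] at hmem
  have h0 : (∑ j, v j • X j q : S.D q) = 0 := Subtype.ext hmem
  ext1 j
  rw [← hc j, h0, map_zero]
  rfl

/-- The coefficient of `w` with respect to `Y a` in the frame `Y`. -/
def frameCoeff (Ω : VolumeForm (k + 1) M) (Y : Fin (k + 1) → ∀ x : M, TSpace (k + 1) x)
    (a : Fin (k + 1)) (x : M) : TSpace (k + 1) x →ₗ[ℝ] ℝ :=
  (Ω.toFun x fun i => Y i x)⁻¹ •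
    (Ω.toFun x).toMultilinearMap.toLinearMap (fun i => Y i x) a

theorem frameCoeff_apply (Ω : VolumeForm (k + 1) M)
    (Y : Fin (k + 1) → ∀ x : M, TSpace (k + 1) x) (a : Fin (k + 1)) (x : M)
    (w : TSpace (k + 1) x) : frameCoeff Ω Y a x w =
      (Ω.toFun x fun i => Y i x)⁻¹ * Ω.toFun x (Function.update (fun i => Y i x) a w) := rfl

theorem frameCoeff_self {Ω : VolumeForm (k + 1) M} {Y : Fin (k + 1) → ∀ x : M, TSpace (k + 1) x}
    {x : M} (h0 : Ω.toFun x (fun i => Y i x) ≠ 0) (a b : Fin (k + 1)) :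
    frameCoeff Ω Y a x (Y b x) = if a = b then 1 else 0 := by
  rw [frameCoeff_apply]
  split_ifs with h
  · subst h
    rw [Function.update_eq_self, inv_mul_cancel₀ h0]
  · have hz : Ω.toFun x (Function.update (fun i => Y i x) a (Y b x)) = 0 :=
      (Ω.toFun x).map_eq_zero_of_eq _ (i := a) (j := b) (by simp [Ne.symm h]) h
    rw [hz, mul_zero]

/-- The line is sought as the span of Z + ∑ ξ_j X_j with Z any transversal field. The equations
become a linear system for ξ with the invertible matrix η([X_j, X_i]), and Cramer's rule shows that
ξ is smooth. -/
theorem exists_local_solution {Ω : VolumeForm (k + 1) M} (hJ : ∀ q, S.kerJ q = ⊥) (c : M) :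
    ∃ (U : Set M) (X : Fin k → ∀ x : M, S.D x) (Z : ∀ x : M, TSpace (k + 1) x),
      c ∈ U ∧ S.IsOrthoFrame U X ∧ SmoothFieldOn Z U ∧ ∀ x ∈ U, Z x ∉ S.D x ∧
        ∃ ρ : TSpace (k + 1) x →ₗ[ℝ] S.D x, (∀ v : S.D x, ρ (v : TSpace (k + 1) x) = v) ∧
          ρ (Z x) = 0 ∧ S.SolvesAt Ω X x ρ := by
  obtain ⟨U, X, Z, hc, hX, hZ, hZD⟩ := S.exists_smooth_notMem_D Ω c
  have hU := hX.isOpen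
  let br : Fin k → Fin k → ∀ x : M, TSpace (k + 1) x := fun j i =>
    VectorField.mlieBracket (𝓡 (k + 1)) (fun x => (X j x : TSpace (k + 1) x))
      (fun x => (X i x : TSpace (k + 1) x))
  have hbr : ∀ j i, SmoothFieldOn (br j i) U := fun j i =>
    SmoothFieldOn.mlieBracket hU (hX.smooth j) (hX.smooth i)
  let Y := extendFrame X Z
  have hY : ∀ a, SmoothFieldOn (Y a) U := hX.smooth_extendFrame le_rfl hZ
  have hY0 : ∀ x ∈ U, Ω.toFun x (fun i => Y i x) ≠ 0 := fun x hx =>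
    apply_extendFrame_ne_zero Ω (hX.orth x hx) (hZD x hx)
  have hYc : ∀ (i : Fin k) x, Y i.castSucc x = (X i x : TSpace (k + 1) x) := fun i x =>
    extendFrame_castSucc X Z i x
  have hYl : ∀ x, Y (Fin.last k) x = Z x := fun x => extendFrame_last X Z x
  have hZη : ∀ x ∈ U, conormal Ω X x (Z x) ≠ 0 := fun x hx => by
    rw [conormal_apply]
    exact hY0 x hx
  let A : M → Matrix (Fin k) (Fin k) ℝ := fun x => Matrix.of fun i j => conormal Ω X x (br j i x)
  -- The defect of the initial projection along Z in the i-th equation, multiplied by η(Z) to clear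
  -- the denominator of the correction.
  let r : M → Fin k → ℝ := fun x i =>
    (∑ j, frameCoeff Ω Y j.castSucc x (br j i x) -
      Ω.coordDivergence (fun x => (X i x : TSpace (k + 1) x)) x) * conormal Ω X x (Z x)
  let ξ : M → Fin k → ℝ := fun x => (A x).det⁻¹ • (A x).cramer (r x)
  have hdet : ∀ x ∈ U, (A x).det ≠ 0 := fun x hx => det_bracketMatrix_ne_zero hX hx (hJ x)
  have hη := hX.smoothFormOn_conormal Ω
  have hA : ∀ i j, ContMDiffOn (𝓡 (k + 1)) 𝓘(ℝ, ℝ) ∞ (fun x => A x i j) U := fun i j =>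
    SmoothFormOn.apply hη (hbr j i)
  have hr : ∀ i, ContMDiffOn (𝓡 (k + 1)) 𝓘(ℝ, ℝ) ∞ (fun x => r x i) U := by
    intro i
    refine ContMDiffOn.mul (ContMDiffOn.sub (contMDiffOn_finsetSum fun j _ => ?_)
      (Ω.contMDiffOn_coordDivergence hU hY (hX.smooth i) hY0)) (SmoothFormOn.apply hη hZ)
    exact ((Ω.smooth U hU Y hY).inv₀ hY0).mul
      (Ω.contMDiffOn_apply_update hU hY (hbr j i) j.castSucc)
  have hξ : ∀ i, ContMDiffOn (𝓡 (k + 1)) 𝓘(ℝ, ℝ) ∞ (fun x => ξ x i) U := by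
    intro i
    refine ((contMDiffOn_det hA).inv₀ hdet).mul ?_
    simp only [Matrix.cramer_apply]
    refine contMDiffOn_det fun a b => ?_
    by_cases h : b = i
    · subst h
      simp only [Matrix.updateCol_self]
      exact hr a
    · simp only [Matrix.updateCol_ne h]
      exact hA a b
  have hAξ : ∀ x ∈ U, ∀ i, ∑ j, A x i j * ξ x j = r x i := by
    intro x hx i
    have h1 : (A x).mulVec (ξ x) = r x := by
      simp only [ξ]
      rw [Matrix.mulVec_smul, Matrix.mulVec_cramer, smul_smul, inv_mul_cancel₀ (hdet x hx),
        one_smul]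
    exact congrFun h1 i
  let P : ∀ x : M, S.D x := fun x => ∑ j, ξ x j • X j x
  have hP : ∀ x, (P x : TSpace (k + 1) x) = ∑ j, ξ x j • (X j x : TSpace (k + 1) x) := fun x => by
    simp [P]
  refine ⟨U, X, fun x => Z x + P x, hc, hX, ?_, fun x hx => ⟨?_, ?_⟩⟩
  · refine SmoothFieldOn.add hZ ?_
    simp only [hP]
    exact SmoothFieldOn.sum _ fun j _ => SmoothFieldOn.smul (hξ j) (hX.smooth j)
  · intro h
    exact hZD x hx (by simpa using sub_mem h (P x).2)
  have hPη : conormal Ω X x (P x : TSpace (k + 1) x) = 0 :=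
    (conormal_eq_zero_iff Ω (hX.orth x hx) _).2 (P x).2
  let ρ₀ : TSpace (k + 1) x →ₗ[ℝ] S.D x :=
    ∑ j : Fin k, (frameCoeff Ω Y j.castSucc x).smulRight (X j x)
  -- The projection along Z corrected by -(η/η(Z)) P, so that Z + P is sent to 0 while D stays
  -- fixed.
  let ρ : TSpace (k + 1) x →ₗ[ℝ] S.D x := ρ₀ - ((conormal Ω X x (Z x))⁻¹ •
    (conormal Ω X x : TSpace (k + 1) x →ₗ[ℝ] ℝ)).smulRight (P x)
  have hρ₀ : ∀ w, ρ₀ w = ∑ j : Fin k, frameCoeff Ω Y j.castSucc x w • X j x := fun w => by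
    simp [ρ₀]
  have hρ : ∀ w, ρ w = ρ₀ w - ((conormal Ω X x (Z x))⁻¹ * conormal Ω X x w) • P x := fun w => rfl
  have hρ₀X : ∀ v : S.D x, ρ₀ (v : TSpace (k + 1) x) = v := by
    intro v
    have h1 : ∀ i, ρ₀ (X i x : TSpace (k + 1) x) = X i x := by
      intro i
      rw [hρ₀, ← hYc]
      simp [frameCoeff_self (hY0 x hx)]
    have h2 : (v : TSpace (k + 1) x) = ∑ j, S.g x (X j x) v • (X j x : TSpace (k + 1) x) := by
      simpa using congrArg (S.D x).subtype (eq_sum_of_orth (hX.orth x hx) v)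
    conv_lhs => rw [h2]
    conv_rhs => rw [eq_sum_of_orth (hX.orth x hx) v]
    simp [h1]
  have hρ₀Z : ρ₀ (Z x) = 0 := by
    rw [hρ₀, ← hYl]
    simp [frameCoeff_self (hY0 x hx), Fin.castSucc_ne_last]
  refine ⟨ρ, fun v => ?_, ?_, fun i => ?_⟩
  · rw [hρ, hρ₀X, (conormal_eq_zero_iff Ω (hX.orth x hx) _).2 v.2]
    simp
  · rw [hρ, map_add, map_add, hρ₀Z, hρ₀X, hPη, add_zero, inv_mul_cancel₀ (hZη x hx)]
    simp
  · have h1 : ∀ j, S.g x (X j x) (ρ (br j i x)) = frameCoeff Ω Y j.castSucc x (br j i x) -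
        (conormal Ω X x (Z x))⁻¹ * (A x i j * ξ x j) := by
      intro j
      have h2 : S.g x (X j x) (P x) = ξ x j := by simp [P, hX.orth x hx]
      have h3 : S.g x (X j x) (ρ₀ (br j i x)) = frameCoeff Ω Y j.castSucc x (br j i x) := by
        rw [hρ₀]
        simp [hX.orth x hx]
      rw [hρ, map_sub, map_smul, h2, h3, smul_eq_mul, mul_assoc]
      rfl
    change _ = ∑ j, S.g x (X j x) (ρ (br j i x))
    rw [Finset.sum_congr rfl fun j _ => h1 j, Finset.sum_sub_distrib, ← Finset.mul_sum, hAξ x hx i]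
    have := hZη x hx
    simp only [r]
    field_simp
    ring

variable [T2Space M]

theorem eq_of_solvesAt {Ω : VolumeForm (k + 1) M} {U U' : Set M} {X X' : Fin k → ∀ x : M, S.D x}
    (hX : S.IsOrthoFrame U X) (hX' : S.IsOrthoFrame U' X') {q : M} (hq : q ∈ U) (hq' : q ∈ U')
    (hJ : S.kerJ q = ⊥) {ρ ρ' : TSpace (k + 1) q →ₗ[ℝ] S.D q}
    (hρ : ∀ v : S.D q, ρ (v : TSpace (k + 1) q) = v)
    (hρ' : ∀ v : S.D q, ρ' (v : TSpace (k + 1) q) = v) (h : S.SolvesAt Ω X q ρ)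
    (h' : S.SolvesAt Ω X' q ρ') : ρ = ρ' := by
  have h1 := (SolvesAt.iff_sub_mem_kerJ hX hq hρ hρ' h).1 (h'.congr hX' hX hq' hq hρ')
  ext1 w
  have h2 := h1 w
  rw [hJ, Submodule.mem_bot] at h2
  exact sub_eq_zero.1 (Subtype.ext h2)

/-- If `J` is nondegenerate, there is exactly one compatible complement. -/
theorem existsUnique_mem_compatible [NeZero k] {Ω : VolumeForm (k + 1) M}
    {μ : ∀ V : S.Complement, V.AdaptedMeasure} (hJ : ∀ q, S.kerJ q = ⊥) :
    ∃! V : S.Complement, V ∈ S.compatible Ω μ := by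
  choose U X Z hU hX hZ h using S.exists_local_solution (Ω := Ω) hJ
  choose ρ hρ hρZ hsol using fun q => (h q q (hU q)).2
  -- The projections ρ x are chosen point by point. Uniqueness identifies each with the local
  -- solution built around any nearby `c`, so the smooth field `Z c` spans the kernels over all of
  -- `U c`.
  have hloc : ∀ c, ∀ x ∈ U c, LinearMap.ker (ρ x) = Submodule.span ℝ {Z c x} := by
    intro c x hx
    obtain ⟨hZx, ρ', hρ', hρZ', hsol'⟩ := h c x hx
    rw [eq_of_solvesAt (hX x) (hX c) (hU x) hx (hJ x) (hρ x) hρ' (hsol x) hsol']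
    exact ker_eq_span_singleton Ω hρ' hZx hρZ'
  let V : S.Complement :=
    { fiber := fun q => LinearMap.ker (ρ q)
      smooth := fun c => ⟨U c, (hX c).isOpen, hU c, 1, fun _ => Z c, fun _ => hZ c, fun x hx =>
        ⟨LinearIndependent.of_subsingleton 0 fun h0 => (h c x hx).1 (by
          have h1 : Z c x = 0 := h0
          rw [h1]; exact (S.D x).zero_mem), by
          change Submodule.span ℝ (range fun _ : Fin 1 => Z c x) = LinearMap.ker (ρ x)
          rw [hloc c x hx, range_const]⟩⟩
      isCompl := fun q => LinearMap.isCompl_of_proj (hρ q) }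
  have hV : ∀ q, V.proj q = ρ q := by
    intro q
    ext1 w
    refine V.proj_eq_of_sub_mem ?_
    change ρ q _ = 0
    rw [map_sub, hρ, sub_self]
  refine ⟨V, (μ V).compatible_iff.2 fun q U' X' hX' hq' => ?_, fun W hW => ?_⟩
  · rw [hV]
    exact (hsol q).congr (hX q) hX' (hU q) hq' (hρ q)
  · refine Complement.eq_of_proj_eq fun q w => ?_
    rw [hV, eq_of_solvesAt (hX q) (hX q) (hU q) (hU q) (hJ q) (W.proj_of_mem q) (hρ q)
      ((μ W).compatible_iff.1 hW q (U q) (X q) (hX q) (hU q)) (hsol q)]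

end Structure

end NondegenerateCase

/-! ### Step two excludes rank zero -/

section BracketGenerating

variable {k : ℕ} {M : Type*} [TopologicalSpace M] [ChartedSpace (Eucl (k + 1)) M]
  [IsManifold (𝓡 (k + 1)) ∞ M] {S : Structure (k + 1) k M}

/-- In rank zero the only horizontal field is 0 and its brackets vanish, so they cannot span a line.
Positive rank makes the unit sphere nonempty and 1/k meaningful. -/
theorem Structure.StepTwo.rank_ne_zero [Nonempty M] (h : S.StepTwo) : k ≠ 0 := by
  intro hk
  obtain ⟨q⟩ := ‹Nonempty M›
  have hD : ∀ x, S.D x = ⊥ := fun x => by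
    rw [← Submodule.finrank_eq_zero, S.finrank_D, hk]
  obtain ⟨w, hw⟩ := S.exists_notMem_D q
  apply hw
  have h1 : w ∈ (⊤ : Submodule ℝ (TSpace (k + 1) q)) := Submodule.mem_top
  rw [← h q] at h1
  refine (sup_le le_rfl (Submodule.span_le.2 ?_) : _ ≤ S.D q) h1
  rintro _ ⟨X, Y, -, -, hX, -, rfl⟩
  have hX0 : X = 0 := by
    ext1 x
    have := hX x
    rwa [hD, Submodule.mem_bot] at this
  rw [hX0, VectorField.mlieBracket_zero_left]
  exact Submodule.zero_mem _

end BracketGenerating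

/-! ### The affine structures -/

section Torsors

theorem exists_addTorsor {G P : Type*} [AddGroup G] [Nonempty P] (f : G → P → P) (d : P → P → G)
    (zero : ∀ p, f 0 p = p) (add : ∀ a b p, f (a + b) p = f a (f b p))
    (left : ∀ p p', f (d p p') p' = p) (right : ∀ a p, d (f a p) p = a) :
    ∃ T : AddTorsor G P, ∀ (a : G) (p : P), T.toVAdd.vadd a p = f a p :=
  ⟨{ vadd := f
     vsub := d
     nonempty := inferInstance
     zero_vadd := zero
     add_vadd := add
     vsub_vadd' := left
     vadd_vsub' := right }, fun _ _ => rfl⟩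

variable {k : ℕ} {M : Type*} [TopologicalSpace M] [ChartedSpace (Eucl (k + 1)) M]
  [IsManifold (𝓡 (k + 1)) ∞ M] {S : Structure (k + 1) k M} [T2Space M] [NeZero k]
  {Ω : VolumeForm (k + 1) M} {μ : ∀ V : S.Complement, V.AdaptedMeasure}

namespace Structure

theorem fiber_shearCompatible (B : S.kerJHoms) (V : S.compatible Ω μ) (q : M) :
    (shearCompatible B V).1.fiber q = (V.1.fiber q).map
      (LinearMap.id + (B.1 q : TSpace (k + 1) q →ₗ[ℝ] TSpace (k + 1) q)) := rfl

/-- The affine structure over homomorphisms on the set of compatible complements. -/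
theorem exists_homTorsor (h : (S.compatible Ω μ).Nonempty) :
    ∃ T : AddTorsor S.kerJHoms (S.compatible Ω μ),
      ∀ (B : S.kerJHoms) (V : S.compatible Ω μ), T.toVAdd.vadd B V = shearCompatible B V :=
  have := h.to_subtype
  exists_addTorsor shearCompatible homDiff zero_shearCompatible add_shearCompatible
    shearCompatible_homDiff homDiff_shearCompatible

/-- The affine structure given by a defining form on the set of compatible complements. -/
theorem exists_sectionTorsor {η : ∀ q : M, CSpace (k + 1) q} (hη : S.IsDefiningForm η)
    (h : (S.compatible Ω μ).Nonempty) :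
    ∃ T : AddTorsor S.kerJSections (S.compatible Ω μ),
      ∀ (ξ : S.kerJSections) (V : S.compatible Ω μ),
        T.toVAdd.vadd ξ V = shearCompatible (homOfSection hη ξ) V :=
  have := h.to_subtype
  exists_addTorsor (fun ξ V => shearCompatible (homOfSection hη ξ) V)
    (fun V W => sectionOfHom Ω hη (homDiff V W))
    (fun V => by rw [homOfSection_zero, zero_shearCompatible])
    (fun ξ ξ' V => by rw [homOfSection_add, add_shearCompatible])
    (fun V W => by rw [homOfSection_sectionOfHom, shearCompatible_homDiff])
    (fun ξ V => by rw [homDiff_shearCompatible, sectionOfHom_homOfSection])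

end Structure

end Torsors

end SubRiem

end

/-! ### The proposition -/

set_option maxHeartbeats 1000000 in
theorem propositionp {n k : ℕ} {M : Type*} [TopologicalSpace M] [T2Space M]
    [SecondCountableTopology M] [ConnectedSpace M] [ChartedSpace (Eucl n) M]
    [IsManifold (𝓡 n) ∞ M]
    (S : Structure n k M) (corank_one : k + 1 = n) (step_two : S.StepTwo)
    (Ω : VolumeForm n M) (μ : ∀ V : S.Complement, V.AdaptedMeasure) :
    ((∀ q, Module.finrank ℝ (S.kerJ q) = 0) → ∃! V : S.Complement, V ∈ S.compatible Ω μ) ∧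
    ((∀ q, 0 < Module.finrank ℝ (S.kerJ q)) →
      (S.compatible Ω μ = ∅ ∨
        ∃ _ : AddTorsor S.kerJHoms (S.compatible Ω μ),
          ∀ (B : S.kerJHoms) (V : S.compatible Ω μ) (q : M),
            (B +ᵥ V).1.fiber q =
              (V.1.fiber q).map (LinearMap.id + (B.1 q : TSpace n q →ₗ[ℝ] TSpace n q))) ∧
      ∀ η : ∀ q : M, CSpace n q, S.IsDefiningForm η →
        (S.compatible Ω μ = ∅ ∨
          ∃ _ : AddTorsor S.kerJSections (S.compatible Ω μ),
            ∀ (ξ : S.kerJSections) (V : S.compatible Ω μ) (q : M) (X₀ : TSpace n q),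
              V.1.fiber q = Submodule.span ℝ {X₀} → η q X₀ = 1 →
              (ξ +ᵥ V).1.fiber q = Submodule.span ℝ {X₀ + (ξ.1 q : TSpace n q)})) := by
  subst corank_one
  -- Connectedness supplies a point of `M`, at which the rank is excluded from being zero.
  have : NeZero k := ⟨step_two.rank_ne_zero⟩
  refine ⟨fun hJ => Structure.existsUnique_mem_compatible fun q =>
    Submodule.finrank_eq_zero.1 (hJ q), fun _ => ⟨?_, fun η hη => ?_⟩⟩
  · rcases (S.compatible Ω μ).eq_empty_or_nonempty with h | h
    · exact Or.inl h
    · obtain ⟨T, hT⟩ := Structure.exists_homTorsor h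
      refine Or.inr ⟨T, fun B V q => ?_⟩
      exact (congrArg (fun W => W.1.fiber q) (hT B V)).trans
        (Structure.fiber_shearCompatible B V q)
  · rcases (S.compatible Ω μ).eq_empty_or_nonempty with h | h
    · exact Or.inl h
    · obtain ⟨T, hT⟩ := Structure.exists_sectionTorsor hη h
      refine Or.inr ⟨T, fun ξ V q X₀ hV he => ?_⟩
      exact (congrArg (fun W => W.1.fiber q) (hT ξ V)).trans
        (Structure.fiber_shearCompatible_homOfSection hη ξ V hV he)
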